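/- Let $At$ be a finite set of propositional atoms, $Ab\subseteq At$ the set of abnormality letters, and $\mathcal L$ the propositional formulas over $At$ (with $\top,\bot,\neg,\wedge,\vee$). A block is $B=\{c_1,\dots,c_l : B_1,\dots,B_m\}$ where $c_1,\dots,c_l$ are distinct atoms not in $Ab$ (the letters described by $B$) and each $B_i$ is a formula of $\mathcal L$ or a block. A nested abnormality theory (NAT) is a finite collection $\mathcal T=B_1,\dots,B_r$ of blocks. An interpretation $M\subseteq At$ satisfies $\mathcal T$ if it satisfies each of its blocks; it satisfies a block $B=\{C:B_1,\dots,B_m\}$ if there is $N\subseteq At$ with $N\setminus Ab=M\setminus Ab$ such that $N$ satisfies $B_1,\dots,B_m$ and every $N'\subseteq At$ that satisfies $B_1,\dots,B_m$, agrees with $N$ on all atoms outside $Ab\cup C$, and has $N'\cap Ab\subseteq N\cap Ab$ also has $N\cap Ab\subseteq N'\cap Ab$. Two NATs are equivalent if they are satisfied by the same interpretations of $At$. A NAT is Horn if every formula of $\mathcal L$ that is a member of one of its blocks, at any nesting depth, is a Horn CNF, that is, a conjunction of clauses each with at most one positive literal (the empty clause $\bot$ and the empty conjunction $\top$ are included).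 A NAT is without fixed letters if each of its blocks, at any nesting depth, describes all letters of $At\setminus Ab$. The size $\|\mathcal T\|$ is the number of symbols in which $\mathcal T$ is written, where an occurrence of an atom consists of a tag (ordinary or abnormality letter) and a number. **Theorem (Flat Normal Form).** There is an algorithm (one random access machine program for all alphabets, whose unit-cost steps are assignments, successor, predecessor, indexed array access and comparisons) which rewrites every Horn NAT $\mathcal T\neq\emptyset$ without fixed letters, in time $O(\|\mathcal T\|)$ with an absolute constant, to an equivalent Horn NAT $\{Z:\psi\}$ without fixed letters over the same $At$ and $Ab$, where $\psi\in\mathcal L$ is a Horn CNF. -/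

import Mathlib

namespace Circ

/-! ### Syntax of nested abnormality theories -/

/-- The finite alphabet `At`, with `n` ordinary letters and the `k` abnormality letters `Ab`. -/
inductive Atom (n k : ℕ) : Type where
  | letter (i : Fin n) : Atom n k
  | ab (j : Fin k) : Atom n k

/-- The set `Ab` of abnormality letters. -/
def abSet (n k : ℕ) : Set (Atom n k) := Set.range Atom.ab

/-- The propositional language over `At`; an implication `p → q` abbreviates `¬ p ∨ q`. -/
inductive Formula (n k : ℕ) : Type where
  | verum : Formula n k
  | falsum : Formula n k
  | atom (a : Atom n k) : Formula n k
  | neg (φ : Formula n k) : Formula n k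
  | conj (φ ψ : Formula n k) : Formula n k
  | disj (φ ψ : Formula n k) : Formula n k

/-- A finite sequence `B₁, …, Bₘ`, each member of which is a formula or a block `{C : B'₁, …}`.
`C` is the list of the distinct letters (not in `Ab`) that the block describes. -/
inductive Body (n k : ℕ) : Type where
  | nil : Body n k
  | formula (φ : Formula n k) (rest : Body n k) : Body n k
  | block (C : List (Fin n)) (hC : C.Nodup) (body : Body n k) (rest : Body n k) : Body n k

/-- A block `{C : B₁, …, Bₘ}`. -/
structure Block (n k : ℕ) : Type where
  described : List (Fin n)
  nodup : described.Nodup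
  body : Body n k

/-- A nested abnormality theory: a finite collection of blocks. -/
abbrev NAT (n k : ℕ) : Type := List (Block n k)

/-- The unnested single-block theory `{Z : ψ}`. -/
def NAT.flat {n k : ℕ} (Z : List (Fin n)) (hZ : Z.Nodup) (ψ : Formula n k) : NAT n k :=
  [⟨Z, hZ, Body.formula ψ Body.nil⟩]

/-! ### Semantics -/

/-- An interpretation is identified with the set of atoms that are true in it. -/
abbrev Interp (n k : ℕ) : Type := Set (Atom n k)

def Formula.Sat {n k : ℕ} : Formula n k → Interp n k → Prop
  | .verum, _ => True
  | .falsum, _ => False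
  | .atom a, M => a ∈ M
  | .neg φ, M => ¬ φ.Sat M
  | .conj φ ψ, M => φ.Sat M ∧ ψ.Sat M
  | .disj φ ψ, M => φ.Sat M ∨ ψ.Sat M

/-- The models of the circumscription `CIRC(Φ; P; Z)`: the models of `Φ` whose `P`-part is minimal
among the models of `Φ` with the same values on all atoms outside `P ∪ Z`. -/
def CIRC {n k : ℕ} (Φ : Interp n k → Prop) (P Z : Set (Atom n k)) (M : Interp n k) : Prop :=
  Φ M ∧ ∀ M' : Interp n k, (∀ a, a ∉ P ∪ Z → (a ∈ M' ↔ a ∈ M)) → Φ M' →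
    M' ∩ P ⊆ M ∩ P → M ∩ P ⊆ M' ∩ P

/-- The models of `∃ Ab. CIRC(Φ; Ab; C)`. -/
def blockSat {n k : ℕ} (C : List (Fin n)) (Φ : Interp n k → Prop) (M : Interp n k) : Prop :=
  ∃ N : Interp n k, (∀ a, a ∉ abSet n k → (a ∈ N ↔ a ∈ M)) ∧
    CIRC Φ (abSet n k) {a | ∃ i ∈ C, a = Atom.letter i} N

/-- `M` satisfies all members of the sequence. -/
def Body.Sat {n k : ℕ} : Body n k → Interp n k → Prop
  | .nil, _ => True
  | .formula φ rest, M => φ.Sat M ∧ rest.Sat M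
  | .block C _ body rest, M => blockSat C body.Sat M ∧ rest.Sat M

def Block.Sat {n k : ℕ} (B : Block n k) (M : Interp n k) : Prop :=
  blockSat B.described B.body.Sat M

def NAT.Sat {n k : ℕ} (T : NAT n k) (M : Interp n k) : Prop := ∀ B ∈ T, B.Sat M

/-! ### Horn theories, and theories without fixed letters -/

/-- Clauses: disjunctions of literals (the empty one is `falsum`). -/
inductive Formula.IsClause {n k : ℕ} : Formula n k → Prop where
  | falsum : Formula.IsClause .falsum
  | pos (a : Atom n k) : Formula.IsClause (.atom a)
  | neg (a : Atom n k) : Formula.IsClause (.neg (.atom a))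
  | disj {φ ψ : Formula n k} (h₁ : Formula.IsClause φ) (h₂ : Formula.IsClause ψ) :
      Formula.IsClause (.disj φ ψ)

/-- The atoms that are positive literals of a clause. -/
def Formula.posAtoms {n k : ℕ} : Formula n k → Set (Atom n k)
  | .atom a => {a}
  | .disj φ ψ => φ.posAtoms ∪ ψ.posAtoms
  | _ => ∅

/-- A clause with at most one positive literal. -/
def Formula.IsHornClause {n k : ℕ} (φ : Formula n k) : Prop :=
  φ.IsClause ∧ φ.posAtoms.Subsingleton

/-- Horn CNFs: conjunctions of Horn clauses (the empty one is `verum`). -/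
inductive Formula.IsHornCNF {n k : ℕ} : Formula n k → Prop where
  | verum : Formula.IsHornCNF .verum
  | clause {φ : Formula n k} (h : φ.IsHornClause) : Formula.IsHornCNF φ
  | conj {φ ψ : Formula n k} (h₁ : Formula.IsHornCNF φ) (h₂ : Formula.IsHornCNF ψ) :
      Formula.IsHornCNF (.conj φ ψ)

def Body.IsHorn {n k : ℕ} : Body n k → Prop
  | .nil => True
  | .formula φ rest => φ.IsHornCNF ∧ rest.IsHorn
  | .block _ _ body rest => body.IsHorn ∧ rest.IsHorn

def NAT.IsHorn {n k : ℕ} (T : NAT n k) : Prop := ∀ B ∈ T, B.body.IsHorn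

/-- Every block in the sequence, at any depth, describes every letter outside `Ab`. -/
def Body.NoFixed {n k : ℕ} : Body n k → Prop
  | .nil => True
  | .formula _ rest => rest.NoFixed
  | .block C _ body rest => (∀ i : Fin n, i ∈ C) ∧ body.NoFixed ∧ rest.NoFixed

/-- Every block of `T`, at any depth, describes every letter outside `Ab`. -/
def NAT.NoFixed {n k : ℕ} (T : NAT n k) : Prop :=
  ∀ B ∈ T, (∀ i : Fin n, i ∈ B.described) ∧ B.body.NoFixed

/-! ### Representation as words, and size

Theories are written out symbol by symbol, with the following codes:
`2` is ⊤, `3` is ⊥, `4` is ¬, `5` is (, `6` is ), `7` is ∧, `8` is ∨,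
`9` is {, `10` is :, `11` is }, `12` is the comma that ends each member of a block;
the words `0, i` are the `i`-th letter, and `1, j` the `j`-th abnormality letter.
-/

def Atom.code {n k : ℕ} : Atom n k → List ℕ
  | .letter i => [0, i.val]
  | .ab j => [1, j.val]

/-- Fully parenthesized infix notation. -/
def Formula.code {n k : ℕ} : Formula n k → List ℕ
  | .verum => [2]
  | .falsum => [3]
  | .atom a => a.code
  | .neg φ => [4] ++ φ.code
  | .conj φ ψ => [5] ++ φ.code ++ [7] ++ ψ.code ++ [6]
  | .disj φ ψ => [5] ++ φ.code ++ [8] ++ ψ.code ++ [6]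

/-- The word `{C : b}`, for `b` the word of the members of a block. -/
def blockCode {n : ℕ} (C : List (Fin n)) (b : List ℕ) : List ℕ :=
  [9] ++ C.flatMap (fun i => [0, i.val]) ++ [10] ++ b ++ [11]

def Body.code {n k : ℕ} : Body n k → List ℕ
  | .nil => []
  | .formula φ rest => φ.code ++ [12] ++ rest.code
  | .block C _ body rest => blockCode C body.code ++ [12] ++ rest.code

def NAT.code {n k : ℕ} (T : NAT n k) : List ℕ :=
  T.flatMap fun B => blockCode B.described B.body.code

/-- The representation size `‖T‖`: the number of words that represent `T`. -/
def NAT.size {n k : ℕ} (T : NAT n k) : ℕ := T.code.length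

/-! ### Random access machines

A program uses finitely many registers and finitely many arrays of natural numbers. The only
arithmetic is the successor and the predecessor, so in `t` steps no value exceeds the largest
number in the input, its length or the program by more than `t`. -/

structure State : Type where
  reg : ℕ → ℕ
  arr : ℕ → ℕ → ℕ

inductive Instr : Type where
  | skip : Instr
  /-- `x := c` -/
  | const (x c : ℕ) : Instr
  /-- `x := y` -/
  | copy (x y : ℕ) : Instr
  /-- `x := x + 1` -/
  | succ (x : ℕ) : Instr
  /-- `x := x - 1`, where `0 - 1 = 0` -/
  | pred (x : ℕ) : Instr
  /-- `x := A[y]` -/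
  | load (x A y : ℕ) : Instr
  /-- `A[y] := x` -/
  | store (A y x : ℕ) : Instr

def Instr.run : Instr → State → State
  | .skip, s => s
  | .const x c, s => { s with reg := Function.update s.reg x c }
  | .copy x y, s => { s with reg := Function.update s.reg x (s.reg y) }
  | .succ x, s => { s with reg := Function.update s.reg x (s.reg x + 1) }
  | .pred x, s => { s with reg := Function.update s.reg x (s.reg x - 1) }
  | .load x A y, s => { s with reg := Function.update s.reg x (s.arr A (s.reg y)) }
  | .store A y x, s =>
      { s with arr := Function.update s.arr A (Function.update (s.arr A) (s.reg y) (s.reg x)) }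

/-- Comparisons of two registers. -/
inductive Test : Type where
  | eq (x y : ℕ) : Test
  | lt (x y : ℕ) : Test

def Test.Holds : Test → State → Prop
  | .eq x y, s => s.reg x = s.reg y
  | .lt x y, s => s.reg x < s.reg y

inductive Program : Type where
  | instr (i : Instr) : Program
  | seq (p q : Program) : Program
  /-- `if b then p else q` -/
  | ite (b : Test) (p q : Program) : Program
  /-- `while b do p` -/
  | loop (b : Test) (p : Program) : Program

/-- `Exec p s t s'`: started in the state `s`, the program `p` halts in the state `s'` after
exactly `t` steps; each instruction and each evaluation of a test is one step. -/
inductive Exec : Program → State → ℕ → State → Prop where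
  | instr (i : Instr) (s : State) : Exec (.instr i) s 1 (i.run s)
  | seq {p q : Program} {s s₁ s₂ : State} {t₁ t₂ : ℕ}
      (h₁ : Exec p s t₁ s₁) (h₂ : Exec q s₁ t₂ s₂) : Exec (.seq p q) s (t₁ + t₂) s₂
  | ite_true {b : Test} {p q : Program} {s s₁ : State} {t : ℕ}
      (hb : b.Holds s) (h : Exec p s t s₁) : Exec (.ite b p q) s (t + 1) s₁
  | ite_false {b : Test} {p q : Program} {s s₁ : State} {t : ℕ}
      (hb : ¬ b.Holds s) (h : Exec q s t s₁) : Exec (.ite b p q) s (t + 1) s₁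
  | loop_true {b : Test} {p : Program} {s s₁ s₂ : State} {t₁ t₂ : ℕ}
      (hb : b.Holds s) (h₁ : Exec p s t₁ s₁) (h₂ : Exec (.loop b p) s₁ t₂ s₂) :
      Exec (.loop b p) s (t₁ + t₂ + 1) s₂
  | loop_false {b : Test} {p : Program} {s : State}
      (hb : ¬ b.Holds s) : Exec (.loop b p) s 1 s

/-- The input is in array `0` and its length in register `0`; everything else is `0`. -/
def State.init (w : List ℕ) : State where
  reg := fun x => if x = 0 then w.length else 0
  arr := fun A i => if A = 0 then w.getD i 0 else 0

/-- The output is in array `1` and its length in register `1`. -/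
def State.output (s : State) : List ℕ := (List.range (s.reg 1)).map (s.arr 1)

/-- On input `w`, the program halts after exactly `t` steps with output `v`. -/
def Program.Computes (p : Program) (w : List ℕ) (t : ℕ) (v : List ℕ) : Prop :=
  ∃ s : State, Exec p (State.init w) t s ∧ s.output = v

end Circ

/-! Semantics. When no letter is fixed, all ordinary letters vary in the minimisation, so a model of
a block competes with every model of the block's members. A satisfiable Horn theory has a least
model, generated by its definite clauses. Hence the abnormality letters of a block have exactly one
minimal value, the set of those derivable from the definite clauses, and the block holds in `M` iff
its members hold in `M` with the abnormality letters set to that value (`blockSat_iff`). Seen from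
outside, such a block is again a Horn condition, now on letters only: its models are closed under
the rules `proj`, and every closed subset of a model is a model, because the purely negative clauses
pass to subsets. This is what carries the argument through the nesting
(`Body.closed_of_sat_and_sat_of_closed`). Substituting in each block the values of its abnormality
letters leaves formulas whose conjunction is equivalent to the theory (`Body.formulas_spec`). Truth
inside a clause is written `¬ ab`; this is sound because no positive abnormality literal survives,
so the circumscription of the result makes every `ab` false (`NAT.flat_spec`).

Algorithm. The values are found by unit propagation with counters of unsatisfied premises. Starting
it afresh in every block would cost a factor of the nesting depth. Instead one scan keeps a single
data structure. Letters derived in a child block are derivable in its parent, so the marks and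
counters of the child's clauses are kept and the propagation is resumed when the parent ends. The
occurrences of an atom form one linked list, the latest first; those inside the block being closed
are an initial segment of it. An occurrence leaves its list only once, and this pays for the
propagation: the potential is 400 for each pending occurrence and 300 for each entry of the stack.
Two points make the nesting work. Abnormality letters are local: an occurrence of an inner block
that is met after the end of that block is dropped without a mark, and a clause that has it as a
premise stays blocked, as it should. Letters are global: those derived in a child must reach the
occurrences in the parent that were read before, and they are found by running through the letters
that the parent describes, at a cost linear in that written list. The carrying lemmas are
`Popping.pop` (one occurrence), `Deriving.loop` and `Deriving.mem_iff` (cost and completeness of the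
propagation), `Seg.close` and `Seg.merge` (end of a block and return to its parent) and
`Body.readable` (the scan). A second scan copies the formulas with the values substituted
(`NAT.written`). -/

namespace Circ

/-! ### Semantics: elimination of the abnormality letters. -/

section Semantics

variable {n k : ℕ}

/-! ### Definite rules and their closure -/

/-- Atoms as they are written in a word: a tag (`0` for letters, `1` for abnormality letters)
and a number. -/
def Atom.raw : Atom n k → ℕ × ℕ
  | .letter i => (0, i.val)
  | .ab j => (1, j.val)

theorem Atom.raw_injective : Function.Injective (Atom.raw (n := n) (k := k)) := by
  rintro (i | i) (j | j) h <;> simp [Atom.raw, Fin.val_inj] at h <;> simp [h]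

/-- A definite rule: its premises and its conclusion. -/
abbrev Rule : Type := Set (ℕ × ℕ) × (ℕ × ℕ)

/-- The least set closed under the rules. -/
inductive Der (R : Set Rule) : ℕ × ℕ → Prop where
  | intro {B : Set (ℕ × ℕ)} {h : ℕ × ℕ} (hr : (B, h) ∈ R) (hB : ∀ a ∈ B, Der R a) : Der R h

def Closed (R : Set Rule) (X : Set (ℕ × ℕ)) : Prop :=
  ∀ B h, (B, h) ∈ R → B ⊆ X → h ∈ X

theorem Der.mem_of_closed {R : Set Rule} {X : Set (ℕ × ℕ)} (hX : Closed R X) {a : ℕ × ℕ}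
    (h : Der R a) : a ∈ X := by
  induction h with
  | intro hr _ ih => exact hX _ _ hr ih

theorem Der.mono {R S : Set Rule} (hRS : R ⊆ S) {a : ℕ × ℕ} (h : Der R a) : Der S a :=
  h.mem_of_closed (X := {a | Der S a}) fun _ _ hr hB => Der.intro (hRS hr) hB

/-- The rules for letters that remain when the abnormality letters get their least values. -/
def proj (R : Set Rule) : Set Rule :=
  {r | ∃ B, (B, r.2) ∈ R ∧ r.2.1 = 0 ∧ r.1 = {a ∈ B | a.1 = 0} ∧ ∀ a ∈ B, a.1 ≠ 0 → Der R a}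

/-- The abnormality premises cut out in `proj R` are derivable from `R` anyway, so no letter is
gained or lost. This allows letters derived in a child block to be passed to its parent. -/
theorem der_proj {R : Set Rule} {a : ℕ × ℕ} (ha : a.1 = 0) : Der (proj R) a ↔ Der R a := by
  constructor
  · intro h
    refine h.mem_of_closed (X := {a | Der R a}) ?_
    rintro B h ⟨B', hB', -, rfl, hab⟩ hB
    refine Der.intro hB' fun x hx => ?_
    by_cases h0 : x.1 = 0
    · exact hB ⟨hx, h0⟩
    · exact hab x hx h0
  · intro h
    induction h with
    | @intro B h hr hB ih =>
      exact Der.intro (B := {a ∈ B | a.1 = 0}) ⟨B, hr, ha, rfl, fun a ha _ => hB a ha⟩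
        fun x hx => ih x hx.1 hx.2

/-- The atoms that are positive literals. -/
def Formula.pos : Formula n k → Set (ℕ × ℕ)
  | .atom a => {a.raw}
  | .disj φ ψ => φ.pos ∪ ψ.pos
  | _ => ∅

/-- The atoms that are negative literals. -/
def Formula.negs : Formula n k → Set (ℕ × ℕ)
  | .neg (.atom a) => {a.raw}
  | .disj φ ψ => φ.negs ∪ ψ.negs
  | _ => ∅

/-- The definite clauses of a Horn CNF. -/
def Formula.rules : Formula n k → Set Rule
  | .conj φ ψ => φ.rules ∪ ψ.rules
  | φ => {r | r.1 = φ.negs ∧ r.2 ∈ φ.pos}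

/-- The definite rules of a sequence, the abnormality letters of its blocks having been
eliminated. -/
def Body.rules : Body n k → Set Rule
  | .nil => ∅
  | .formula φ rest => φ.rules ∪ rest.rules
  | .block _ _ body rest => proj body.rules ∪ rest.rules

theorem Formula.pos_eq (φ : Formula n k) : φ.pos = Atom.raw '' φ.posAtoms := by
  induction φ <;> simp_all [Formula.pos, Formula.posAtoms, Set.image_union]

theorem Formula.rules_range {φ : Formula n k} {r : Rule} (h : r ∈ φ.rules) :
    r.2 ∈ Set.range (Atom.raw (n := n) (k := k)) := by
  induction φ with
  | conj φ ψ h₁ h₂ => exact h.elim h₁ h₂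
  | _ =>
    have := h.2
    rw [Formula.pos_eq] at this
    exact Set.image_subset_range _ _ this

theorem Body.rules_range {b : Body n k} {r : Rule} (h : r ∈ b.rules) :
    r.2 ∈ Set.range (Atom.raw (n := n) (k := k)) := by
  induction b generalizing r with
  | nil => exact h.elim
  | formula φ rest ih => exact h.elim Formula.rules_range ih
  | block C hC body rest ih₁ ih₂ =>
    rcases h with ⟨B, hB, -⟩ | h
    · exact ih₁ (r := (B, r.2)) hB
    · exact ih₂ h

theorem Body.der_range {b : Body n k} {a : ℕ × ℕ} (h : Der b.rules a) :
    a ∈ Set.range (Atom.raw (n := n) (k := k)) := by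
  cases h with
  | intro hr _ => exact Body.rules_range hr

/-! ### Semantics of Horn theories without fixed letters -/

theorem Formula.IsClause.sat_iff {φ : Formula n k} (h : φ.IsClause) (N : Interp n k) :
    φ.Sat N ↔ (φ.negs ⊆ Atom.raw '' N → ∃ a ∈ φ.pos, a ∈ Atom.raw '' N) := by
  induction h with
  | falsum => simp [Formula.Sat, Formula.negs, Formula.pos]
  | pos a => simp [Formula.Sat, Formula.negs, Formula.pos, Atom.raw_injective.eq_iff]
  | neg a => simp [Formula.Sat, Formula.negs, Formula.pos, Atom.raw_injective.eq_iff]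
  | disj h₁ h₂ ih₁ ih₂ =>
    simp only [Formula.Sat, Formula.negs, Formula.pos, ih₁, ih₂, Set.union_subset_iff,
      Set.mem_union, or_and_right, exists_or]
    grind

theorem Formula.IsClause.rules_eq {φ : Formula n k} (h : φ.IsClause) :
    φ.rules = {r | r.1 = φ.negs ∧ r.2 ∈ φ.pos} := by
  cases h <;> rfl

theorem Formula.IsHornCNF.closed_of_sat {φ : Formula n k} (h : φ.IsHornCNF) {N : Interp n k}
    (hN : φ.Sat N) : Closed φ.rules (Atom.raw '' N) := by
  induction h with
  | verum => rintro B h ⟨-, h⟩; exact h.elim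
  | clause h =>
    rw [h.1.sat_iff] at hN
    rw [h.1.rules_eq]
    rintro B a ⟨rfl, ha⟩ hB
    obtain ⟨a', ha', hN'⟩ := hN hB
    change a ∈ _ at ha
    rw [Formula.pos_eq] at ha ha'
    rwa [(h.2.image _) ha ha']
  | conj h₁ h₂ ih₁ ih₂ =>
    rintro B a (h | h) hB
    · exact ih₁ hN.1 B a h hB
    · exact ih₂ hN.2 B a h hB

/-- A definite clause holds in `N'` by closure. A clause without positive literal that holds in `N`
has a premise false in `N`, which is then false in the smaller `N'`. -/
theorem Formula.IsHornCNF.sat_of_closed {φ : Formula n k} (h : φ.IsHornCNF) {N N' : Interp n k}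
    (hN : φ.Sat N) (hN' : N' ⊆ N) (hcl : Closed φ.rules (Atom.raw '' N')) : φ.Sat N' := by
  induction h with
  | verum => trivial
  | clause h =>
    rw [h.1.sat_iff] at hN ⊢
    rw [h.1.rules_eq] at hcl
    intro hB
    obtain ⟨a, ha, -⟩ := hN (hB.trans (Set.image_mono hN'))
    exact ⟨a, ha, hcl _ _ ⟨rfl, ha⟩ hB⟩
  | conj h₁ h₂ ih₁ ih₂ =>
    exact ⟨ih₁ hN.1 fun B a h => hcl B a (Or.inl h), ih₂ hN.2 fun B a h => hcl B a (Or.inr h)⟩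

/-- The interpretation with the letters of `M` and the abnormality letters in `A`. -/
def withAb (A : Set (ℕ × ℕ)) (M : Interp n k) : Interp n k :=
  {a | match a with
    | .letter i => Atom.letter i ∈ M
    | .ab j => (1, j.val) ∈ A}

@[simp] theorem letter_mem_withAb {A : Set (ℕ × ℕ)} {M : Interp n k} {i : Fin n} :
    Atom.letter i ∈ withAb A M ↔ Atom.letter i ∈ M := Iff.rfl

@[simp] theorem ab_mem_withAb {A : Set (ℕ × ℕ)} {M : Interp n k} {j : Fin k} :
    Atom.ab j ∈ withAb A M ↔ (1, j.val) ∈ A := Iff.rfl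

@[simp] theorem withAb_withAb {A A' : Set (ℕ × ℕ)} {M : Interp n k} :
    withAb A (withAb A' M) = withAb A M := by
  ext (i | j) <;> simp

theorem mem_raw_image {a : Atom n k} {M : Interp n k} : a.raw ∈ Atom.raw '' M ↔ a ∈ M :=
  Atom.raw_injective.mem_set_image

/-- As soon as there is a model, the derivable atoms form the least one. Since all letters vary, it
competes with every model, so the minimal models are those whose abnormality part is exactly the
derivable one. Only `h₁` and `h₂` are used of the body, which permits the induction over nested
blocks. -/
theorem blockSat_iff_of_closed {b : Body n k} {C : List (Fin n)} (hC : ∀ i, i ∈ C)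
    (h₁ : ∀ N, b.Sat N → Closed b.rules (Atom.raw '' N))
    (h₂ : ∀ N N', b.Sat N → N' ⊆ N → Closed b.rules (Atom.raw '' N') → b.Sat N')
    (M : Interp n k) :
    blockSat C b.Sat M ↔ b.Sat (withAb {a | Der b.rules a} M) := by
  have hall : ∀ a : Atom n k, a ∈ abSet n k ∪ {a | ∃ i ∈ C, a = Atom.letter i} := by
    rintro (i | j)
    · exact Or.inr ⟨i, hC i, rfl⟩
    · exact Or.inl ⟨j, rfl⟩
  have hlet : ∀ i : Fin n, Atom.letter i ∉ abSet n k := by rintro i ⟨j, hj⟩; cases hj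
  have hsub : ∀ N, b.Sat N → ∀ a : Atom n k, Der b.rules a.raw → a ∈ N := fun N hN a ha =>
    mem_raw_image.1 (ha.mem_of_closed (h₁ N hN))
  have hleast : ∀ N, b.Sat N → b.Sat {a | Der b.rules a.raw} := by
    intro N hN
    refine h₂ N _ hN (hsub N hN) ?_
    intro B a ha hB
    obtain ⟨a, rfl⟩ := Body.rules_range ha
    refine ⟨a, Der.intro ha fun x hx => ?_, rfl⟩
    obtain ⟨y, hy, rfl⟩ := hB hx
    exact hy
  constructor
  · rintro ⟨N, hNM, hN, hmin⟩
    have : N = withAb {a | Der b.rules a} M := by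
      ext (i | j)
      · simpa using hNM _ (hlet i)
      · constructor
        · intro h
          -- No atom lies outside `Ab ∪ C`, so the agreement required of the least model is vacuous.
          exact (hmin _ (fun a ha => (ha (hall a)).elim) (hleast N hN)
            (fun a ha => ⟨hsub N hN a ha.1, ha.2⟩) ⟨h, j, rfl⟩).1
        · exact fun h => hsub N hN _ h
    rwa [← this]
  · intro h
    refine ⟨_, ?_, h, ?_⟩
    · rintro (i | j) ha
      · simp
      · exact (ha ⟨j, rfl⟩).elim
    · rintro N' - hN' - _ ⟨ha, j, rfl⟩
      exact ⟨hsub N' hN' _ ha, j, rfl⟩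

/-- A block behaves like a Horn CNF with the rules `proj`: by `blockSat_iff_of_closed` it is its
body with constants for the abnormality letters, and those constants do not depend on the
interpretation. Both properties thus pass from the body to the block. -/
theorem Body.closed_of_sat_and_sat_of_closed (b : Body n k) (hb : b.IsHorn) (hf : b.NoFixed) :
    (∀ N, b.Sat N → Closed b.rules (Atom.raw '' N)) ∧
    (∀ N N', b.Sat N → N' ⊆ N → Closed b.rules (Atom.raw '' N') → b.Sat N') := by
  induction b with
  | nil => exact ⟨fun N _ B h hr => hr.elim, fun _ _ _ _ _ => trivial⟩
  | formula φ rest ih =>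
    obtain ⟨ih₁, ih₂⟩ := ih hb.2 hf
    constructor
    · rintro N hN B a (h | h) hB
      · exact hb.1.closed_of_sat hN.1 B a h hB
      · exact ih₁ N hN.2 B a h hB
    · intro N N' hN hN' hcl
      exact ⟨hb.1.sat_of_closed hN.1 hN' fun B a h => hcl B a (Or.inl h),
        ih₂ N N' hN.2 hN' fun B a h => hcl B a (Or.inr h)⟩
  | block C hC body rest ihb ih =>
    obtain ⟨ih₁, ih₂⟩ := ih hb.2 hf.2.2
    obtain ⟨ihb₁, ihb₂⟩ := ihb hb.1 hf.2.1
    have hbl := blockSat_iff_of_closed hf.1 ihb₁ ihb₂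
    constructor
    · rintro N hN B a (h | h) hB
      · obtain ⟨B', hB', ha, rfl, hab⟩ := h
        obtain ⟨a, rfl⟩ := Body.rules_range hB'
        have := ihb₁ _ ((hbl N).1 hN.1) _ _ hB' ?_
        · rw [mem_raw_image] at this ⊢
          cases a with
          | letter i => simpa using this
          | ab j => simp [Atom.raw] at ha
        · intro x hx
          by_cases h0 : x.1 = 0
          · obtain ⟨y, hy, rfl⟩ := hB ⟨hx, h0⟩
            cases y with
            | letter i => exact ⟨_, hy, rfl⟩
            | ab j => simp [Atom.raw] at h0
          · have hd := hab x hx h0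
            obtain ⟨y, rfl⟩ := Body.der_range hd
            cases y with
            | letter i => simp [Atom.raw] at h0
            | ab j => exact ⟨_, hd, rfl⟩
      · exact ih₁ N hN.2 B a h hB
    · intro N N' hN hN' hcl
      refine ⟨(hbl N').2 ?_, ih₂ N N' hN.2 hN' fun B a h => hcl B a (Or.inr h)⟩
      have hs := (hbl N).1 hN.1
      have hss : withAb {a | Der body.rules a} N' ⊆ withAb {a | Der body.rules a} N := by
        rintro (i | j) h
        · exact hN' h
        · exact h
      refine ihb₂ _ _ hs hss ?_
      intro B a ha hB
      obtain ⟨a, rfl⟩ := Body.rules_range ha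
      rw [mem_raw_image]
      cases a with
      | ab j =>
        -- The abnormality part is the same over `N` and `N'`, so the conclusion can be drawn over
        -- the larger one.
        have := ihb₁ _ hs _ _ ha (hB.trans (Set.image_mono hss))
        rw [mem_raw_image] at this
        exact this
      | letter i =>
        -- The abnormality premises true in `withAb` are derivable, hence the rule survives in
        -- `proj` and `hcl` applies to it.
        have hr : ({a ∈ B | a.1 = 0}, (Atom.letter i : Atom n k).raw) ∈ proj body.rules := by
          refine ⟨B, ha, rfl, rfl, fun x hx h0 => ?_⟩
          obtain ⟨y, hy, rfl⟩ := hB hx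
          cases y with
          | letter i => simp [Atom.raw] at h0
          | ab j => exact hy
        refine letter_mem_withAb.2 (mem_raw_image.1 (hcl _ _ (Or.inl hr) ?_))
        rintro x ⟨hx, h0⟩
        obtain ⟨y, hy, rfl⟩ := hB hx
        cases y with
        | letter i => exact ⟨_, hy, rfl⟩
        | ab j => simp [Atom.raw] at h0

theorem blockSat_iff {b : Body n k} (hb : b.IsHorn) (hf : b.NoFixed) {C : List (Fin n)}
    (hC : ∀ i, i ∈ C) (M : Interp n k) :
    blockSat C b.Sat M ↔ b.Sat (withAb {a | Der b.rules a} M) :=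
  have h := b.closed_of_sat_and_sat_of_closed hb hf
  blockSat_iff_of_closed hC h.1 h.2 M

/-! ### The flat theory -/

open Classical in
/-- Substitution of truth values for the abnormality letters in a Horn CNF: truth is written
`¬ ab` and falsity `⊥`. -/
noncomputable def Formula.subst (A : Set (ℕ × ℕ)) : Formula n k → Formula n k
  | .atom (.ab j) => if (1, j.val) ∈ A then .neg (.atom (.ab j)) else .falsum
  | .neg (.atom (.ab j)) => if (1, j.val) ∈ A then .falsum else .neg (.atom (.ab j))
  | .conj φ ψ => .conj (φ.subst A) (ψ.subst A)
  | .disj φ ψ => .disj (φ.subst A) (ψ.subst A)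
  | φ => φ

/-- The formulas of a sequence, at any depth, with the abnormality letters eliminated; those of
the sequence itself have the values `A`. -/
noncomputable def Body.formulas (A : Set (ℕ × ℕ)) : Body n k → List (Formula n k)
  | .nil => []
  | .formula φ rest => φ.subst A :: rest.formulas A
  | .block _ _ body rest => body.formulas {a | Der body.rules a} ++ rest.formulas A

/-- Over `withAb ∅ N` every `¬ ab` is true. It is preferred to `⊤` because `⊤` is not allowed inside
a clause. Since `⊥` and `¬ ab` have no positive literal, the result stays Horn and contains no
positive abnormality literal. -/
theorem Formula.IsClause.subst {φ : Formula n k} (h : φ.IsClause) (A : Set (ℕ × ℕ)) :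
    (φ.subst A).IsClause ∧ (φ.subst A).posAtoms ⊆ φ.posAtoms ∩ (abSet n k)ᶜ ∧
      ∀ N : Interp n k, (φ.subst A).Sat (withAb ∅ N) ↔ φ.Sat (withAb A N) := by
  induction h with
  | falsum => exact ⟨.falsum, by simp [Formula.subst, Formula.posAtoms], by
      simp [Formula.subst, Formula.Sat]⟩
  | pos a =>
    cases a with
    | letter i => exact ⟨.pos _, by simp [Formula.subst, Formula.posAtoms, abSet], by
        simp [Formula.subst, Formula.Sat]⟩
    | ab j =>
      by_cases hj : (1, j.val) ∈ A
      · simp only [Formula.subst, if_pos hj]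
        exact ⟨.neg _, by simp [Formula.posAtoms], by simp [Formula.Sat, hj]⟩
      · simp only [Formula.subst, if_neg hj]
        exact ⟨.falsum, by simp [Formula.posAtoms], by simp [Formula.Sat, hj]⟩
  | neg a =>
    cases a with
    | letter i => exact ⟨.neg _, by simp [Formula.subst, Formula.posAtoms], by
        simp [Formula.subst, Formula.Sat]⟩
    | ab j =>
      by_cases hj : (1, j.val) ∈ A
      · simp only [Formula.subst, if_pos hj]
        exact ⟨.falsum, by simp [Formula.posAtoms], by simp [Formula.Sat, hj]⟩
      · simp only [Formula.subst, if_neg hj]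
        exact ⟨.neg _, by simp [Formula.posAtoms], by simp [Formula.Sat, hj]⟩
  | disj h₁ h₂ ih₁ ih₂ =>
    refine ⟨.disj ih₁.1 ih₂.1, ?_, fun N => or_congr (ih₁.2.2 N) (ih₂.2.2 N)⟩
    rintro a (ha | ha)
    · exact ⟨Or.inl (ih₁.2.1 ha).1, (ih₁.2.1 ha).2⟩
    · exact ⟨Or.inr (ih₂.2.1 ha).1, (ih₂.2.1 ha).2⟩

theorem Formula.IsHornCNF.subst {φ : Formula n k} (h : φ.IsHornCNF) (A : Set (ℕ × ℕ)) :
    (φ.subst A).IsHornCNF ∧ (∀ r ∈ (φ.subst A).rules, r.2.1 = 0) ∧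
      ∀ N : Interp n k, (φ.subst A).Sat (withAb ∅ N) ↔ φ.Sat (withAb A N) := by
  induction h with
  | verum => exact ⟨.verum, fun r hr => hr.2.elim, fun N => Iff.rfl⟩
  | clause h =>
    obtain ⟨h₁, h₂, h₃⟩ := h.1.subst A
    refine ⟨.clause ⟨h₁, h.2.anti fun a ha => (h₂ ha).1⟩, ?_, h₃⟩
    intro r hr
    rw [h₁.rules_eq] at hr
    have := hr.2
    rw [Formula.pos_eq] at this
    obtain ⟨a, ha, h⟩ := this
    rw [← h]
    cases a with
    | letter i => rfl
    | ab j => exact ((h₂ ha).2 ⟨j, rfl⟩).elim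
  | conj h₁ h₂ ih₁ ih₂ =>
    exact ⟨.conj ih₁.1 ih₂.1, fun r hr => hr.elim (ih₁.2.1 r) (ih₂.2.1 r),
      fun N => and_congr (ih₁.2.2 N) (ih₂.2.2 N)⟩

/-- Different blocks give different values to the same abnormality letter, but after substitution
all formulas are evaluated at the same `withAb ∅ N`. The nesting disappears and one list of formulas
remains. -/
theorem Body.formulas_spec {b : Body n k} (hb : b.IsHorn) (hf : b.NoFixed) (A : Set (ℕ × ℕ)) :
    (∀ φ ∈ b.formulas A, φ.IsHornCNF ∧ ∀ r ∈ φ.rules, r.2.1 = 0) ∧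
      ∀ N : Interp n k, (∀ φ ∈ b.formulas A, φ.Sat (withAb ∅ N)) ↔ b.Sat (withAb A N) := by
  induction b generalizing A with
  | nil => simp [Body.formulas, Body.Sat]
  | formula φ rest ih =>
    obtain ⟨ih₁, ih₂⟩ := ih hb.2 hf A
    obtain ⟨h₁, h₂, h₃⟩ := hb.1.subst A
    simp only [Body.formulas, List.forall_mem_cons, Body.Sat, ih₂, h₃]
    exact ⟨⟨⟨h₁, h₂⟩, ih₁⟩, fun N => trivial⟩
  | block C hC body rest ihb ih =>
    obtain ⟨ih₁, ih₂⟩ := ih hb.2 hf.2.2 A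
    obtain ⟨ihb₁, ihb₂⟩ := ihb hb.1 hf.2.1 {a | Der body.rules a}
    simp only [Body.formulas, List.forall_mem_append, Body.Sat, ih₂, ihb₂,
      blockSat_iff hb.1 hf.2.1 hf.1, withAb_withAb]
    exact ⟨⟨ihb₁, ih₁⟩, fun N => trivial⟩

/-- The conjunction of a list of formulas. -/
def bigConj : List (Formula n k) → Formula n k
  | [] => .verum
  | φ :: l => .conj φ (bigConj l)

theorem bigConj_spec {l : List (Formula n k)}
    (hl : ∀ φ ∈ l, φ.IsHornCNF ∧ ∀ r ∈ φ.rules, r.2.1 = 0) :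
    (bigConj l).IsHornCNF ∧ (∀ r ∈ (bigConj l).rules, r.2.1 = 0) ∧
      ∀ N : Interp n k, (bigConj l).Sat N ↔ ∀ φ ∈ l, φ.Sat N := by
  induction l with
  | nil => exact ⟨.verum, fun r hr => hr.2.elim, by simp [bigConj, Formula.Sat]⟩
  | cons φ l ih =>
    rw [List.forall_mem_cons] at hl
    obtain ⟨h₁, h₂, h₃⟩ := ih hl.2
    refine ⟨.conj hl.1.1 h₁, fun r hr => hr.elim (hl.1.2 r) (h₂ r), fun N => ?_⟩
    simp [bigConj, Formula.Sat, h₃]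

/-- Nested to the right, the conjunction can be written in one pass: only the number of closing
brackets has to be remembered. -/
theorem bigConj_code (l : List (Formula n k)) :
    (bigConj l).code =
      l.flatMap (fun φ => [5] ++ φ.code ++ [7]) ++ [2] ++ List.replicate l.length 6 := by
  induction l with
  | nil => simp [bigConj, Formula.code]
  | cons φ l ih => simp [bigConj, Formula.code, ih, List.replicate_succ']

/-- The formulas of the flat theory. -/
noncomputable def NAT.formulas (T : NAT n k) : List (Formula n k) :=
  T.flatMap fun B => B.body.formulas {a | Der B.body.rules a}

theorem NAT.flat_spec {T : NAT n k} (hH : T.IsHorn) (hF : T.NoFixed) {Z : List (Fin n)}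
    (hZ : Z.Nodup) (hall : ∀ i, i ∈ Z) :
    (bigConj T.formulas).IsHornCNF ∧
      ∀ M : Interp n k, (NAT.flat Z hZ (bigConj T.formulas)).Sat M ↔ T.Sat M := by
  have hl : ∀ φ ∈ T.formulas, φ.IsHornCNF ∧ ∀ r ∈ φ.rules, r.2.1 = 0 := by
    intro φ hφ
    obtain ⟨B, hB, hφ⟩ := List.mem_flatMap.1 hφ
    exact (Body.formulas_spec (hH B hB) (hF B hB).2 _).1 φ hφ
  obtain ⟨h₁, h₂, h₃⟩ := bigConj_spec hl
  refine ⟨h₁, fun M => ?_⟩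
  -- No rule of the flat formula concludes an abnormality letter, so none is derivable and all are
  -- circumscribed to false.
  have he : withAb {a | Der (Body.formula (bigConj T.formulas) Body.nil).rules a} M =
      withAb ∅ M := by
    ext (i | j)
    · simp
    · simp only [ab_mem_withAb, Set.mem_ofPred_eq, Set.mem_empty_iff_false, iff_false]
      rintro ⟨hr, -⟩
      rcases hr with hr | hr
      · simpa using h₂ _ hr
      · exact hr.elim
  have hflat : (NAT.flat Z hZ (bigConj T.formulas)).Sat M ↔
      blockSat Z (Body.formula (bigConj T.formulas) Body.nil).Sat M := by
    simp [NAT.flat, NAT.Sat, Block.Sat]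
  rw [hflat, blockSat_iff (show Body.IsHorn (.formula _ .nil) from ⟨h₁, trivial⟩) trivial hall, he,
    Body.Sat, h₃]
  simp only [Body.Sat, and_true, NAT.Sat, Block.Sat, NAT.formulas, List.mem_flatMap,
    forall_exists_index, and_imp]
  constructor
  · intro h B hB
    rw [blockSat_iff (hH B hB) (hF B hB).2 (hF B hB).1, ← (Body.formulas_spec (hH B hB)
      (hF B hB).2 _).2]
    exact fun φ hφ => h φ B hB hφ
  · intro h φ B hB hφ
    have := h B hB
    rw [blockSat_iff (hH B hB) (hF B hB).2 (hF B hB).1, ← (Body.formulas_spec (hH B hB)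
      (hF B hB).2 _).2] at this
    exact this φ hφ

end Semantics

/-! ### Programs without loops -/

/-- Sequential composition of a list of programs. -/
def Program.all : List Program → Program
  | [] => .instr .skip
  | [p] => p
  | p :: l => .seq p (Program.all l)

/-- A sequence of instructions. -/
def Program.instrs (l : List Instr) : Program := Program.all (l.map Program.instr)

def Program.loopFree : Program → Bool
  | .instr _ => true
  | .seq p q => p.loopFree && q.loopFree
  | .ite _ p q => p.loopFree && q.loopFree
  | .loop _ _ => false

/-- The number of instructions and tests. -/
def Program.length : Program → ℕ
  | .instr _ => 1
  | .seq p q => p.length + q.length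
  | .ite _ p q => p.length + q.length + 1
  | .loop _ p => p.length + 1

open Classical in
/-- The effect of a program without loops. -/
noncomputable def Program.eval : Program → State → State
  | .instr i, s => i.run s
  | .seq p q, s => q.eval (p.eval s)
  | .ite b p q, s => if b.Holds s then p.eval s else q.eval s
  | .loop _ _, s => s

theorem Program.exec_eval {p : Program} (hp : p.loopFree) (s : State) :
    ∃ t, Exec p s t (p.eval s) ∧ t ≤ p.length := by
  induction p generalizing s with
  | instr i => exact ⟨1, .instr i s, le_rfl⟩
  | seq p q ihp ihq =>
    simp only [Program.loopFree, Bool.and_eq_true] at hp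
    obtain ⟨t₁, h₁, ht₁⟩ := ihp hp.1 s
    obtain ⟨t₂, h₂, ht₂⟩ := ihq hp.2 (p.eval s)
    exact ⟨t₁ + t₂, .seq h₁ h₂, by simp only [Program.length]; omega⟩
  | ite b p q ihp ihq =>
    simp only [Program.loopFree, Bool.and_eq_true] at hp
    by_cases hb : b.Holds s
    · obtain ⟨t, h, ht⟩ := ihp hp.1 s
      refine ⟨t + 1, ?_, by simp only [Program.length]; omega⟩
      simpa only [Program.eval, if_pos hb] using Exec.ite_true hb h
    · obtain ⟨t, h, ht⟩ := ihq hp.2 s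
      refine ⟨t + 1, ?_, by simp only [Program.length]; omega⟩
      simpa only [Program.eval, if_neg hb] using Exec.ite_false hb h
  | loop b p ih => simp [Program.loopFree] at hp

/-! ### The part of the state that matters -/

/-- The registers and arrays that the program uses permanently.

`i` is a position in the input, `cur` the position of the opening brace of the current block, `c`
the current clause, `wp` the height of the stack `wk` of derived atoms, `j` the length of the
output and `m` the number of its formulas. Occurrences of atoms and clauses are identified with
positions in the input. `tl` and `ta` are the heads of the lists (linked by `nx`) of the pending
occurrences of a letter or abnormality letter, `ow` is the block of an occurrence of an
abnormality letter, `cl` the clause of a negative occurrence, `cn` the number of premises of a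
clause not yet derived, `hd` its head, `mrk` marks occurrences that have become true, `tr` is the
last position where a letter has been derived, and `pa` the parent of a block. -/
structure View : Type where
  len : ℕ
  j : ℕ
  i : ℕ
  cur : ℕ
  c : ℕ
  wp : ℕ
  y : ℕ
  q : ℕ
  m : ℕ
  inp : ℕ → ℕ
  out : ℕ → ℕ
  tl : ℕ → ℕ
  ta : ℕ → ℕ
  nx : ℕ → ℕ
  ow : ℕ → ℕ
  cl : ℕ → ℕ
  cn : ℕ → ℕ
  hd : ℕ → ℕ
  mrk : ℕ → ℕ
  wk : ℕ → ℕ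
  tr : ℕ → ℕ
  pa : ℕ → ℕ

def view (s : State) : View where
  len := s.reg 0
  j := s.reg 1
  i := s.reg 2
  cur := s.reg 3
  c := s.reg 4
  wp := s.reg 5
  y := s.reg 6
  q := s.reg 7
  m := s.reg 8
  inp := s.arr 0
  out := s.arr 1
  tl := s.arr 2
  ta := s.arr 3
  nx := s.arr 4
  ow := s.arr 5
  cl := s.arr 6
  cn := s.arr 7
  hd := s.arr 8
  mrk := s.arr 9
  wk := s.arr 10
  tr := s.arr 11
  pa := s.arr 12

/-- From each state with view `σ` the program halts within `B` steps in a state with view `σ'`. -/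
def VExec (p : Program) (σ : View) (B : ℕ) (σ' : View) : Prop :=
  ∀ s, view s = σ → ∃ t s', Exec p s t s' ∧ t ≤ B ∧ view s' = σ'

theorem VExec.mono {p : Program} {σ σ' : View} {B B' : ℕ} (h : VExec p σ B σ') (hB : B ≤ B') :
    VExec p σ B' σ' := fun s hs =>
  let ⟨t, s', h₁, h₂, h₃⟩ := h s hs
  ⟨t, s', h₁, h₂.trans hB, h₃⟩

theorem VExec.seq {p q : Program} {σ₁ σ₂ σ₃ : View} {B₁ B₂ : ℕ} (h₁ : VExec p σ₁ B₁ σ₂)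
    (h₂ : VExec q σ₂ B₂ σ₃) : VExec (.seq p q) σ₁ (B₁ + B₂) σ₃ := fun s hs =>
  let ⟨_, s', e₁, ht₁, hs'⟩ := h₁ s hs
  let ⟨_, s'', e₂, ht₂, hs''⟩ := h₂ s' hs'
  ⟨_, s'', .seq e₁ e₂, by omega, hs''⟩

/-- The registers from `9` on are scratch and do not belong to the view, so `f` has to describe the
effect on the permanent part only. -/
theorem VExec.of_eval {p : Program} (hp : p.loopFree) {f : View → View}
    (h : ∀ s, view (p.eval s) = f (view s)) (σ : View) : VExec p σ p.length (f σ) := by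
  rintro s rfl
  obtain ⟨t, h₁, h₂⟩ := Program.exec_eval hp s
  exact ⟨t, _, h₁, h₂, h s⟩

/-- The test `b`, made after the instructions `g`, decides the condition `P`. -/
def Guard (g : List Instr) (b : Test) (P : View → Prop) : Prop :=
  ∀ s, view ((Program.instrs g).eval s) = view s ∧
    (b.Holds ((Program.instrs g).eval s) ↔ P (view s))

theorem Program.loopFree_instrs (g : List Instr) : (Program.instrs g).loopFree := by
  induction g with
  | nil => rfl
  | cons i g ih =>
    cases g with
    | nil => rfl
    | cons i' g => simpa [Program.instrs, Program.all, Program.loopFree] using ih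

/-- `if P then p else q`, where `P` is tested by `b` after the instructions `g`. -/
def Program.cond (g : List Instr) (b : Test) (p q : Program) : Program :=
  .seq (.instrs g) (.ite b p q)

theorem VExec.cond_true {g : List Instr} {b : Test} {P : View → Prop} (hg : Guard g b P)
    {p q : Program} {σ σ' : View} {B : ℕ} (hP : P σ) (h : VExec p σ B σ') :
    VExec (.cond g b p q) σ ((Program.instrs g).length + B + 1) σ' := by
  rintro s rfl
  obtain ⟨t, h₁, h₂⟩ := Program.exec_eval (Program.loopFree_instrs g) s
  obtain ⟨t', s', h₃, h₄, h₅⟩ := h _ (hg s).1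
  exact ⟨_, s', .seq h₁ (.ite_true ((hg s).2.2 hP) h₃), by omega, h₅⟩

theorem VExec.cond_false {g : List Instr} {b : Test} {P : View → Prop} (hg : Guard g b P)
    {p q : Program} {σ σ' : View} {B : ℕ} (hP : ¬ P σ) (h : VExec q σ B σ') :
    VExec (.cond g b p q) σ ((Program.instrs g).length + B + 1) σ' := by
  rintro s rfl
  obtain ⟨t, h₁, h₂⟩ := Program.exec_eval (Program.loopFree_instrs g) s
  obtain ⟨t', s', h₃, h₄, h₅⟩ := h _ (hg s).1
  exact ⟨_, s', .seq h₁ (.ite_false (fun h => hP ((hg s).2.1 h)) h₃), by omega, h₅⟩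

/-- `while P do p`, where `P` is tested by `b` after the instructions `g`. -/
def Program.whl (g : List Instr) (b : Test) (p : Program) : Program :=
  .seq (.instrs g) (.loop b (.seq p (.instrs g)))

/-- `Iter P d p σ B σ'`: some iterations of the loop lead from `σ` to `σ'` within `B` steps, where
`d` is the cost of the test. -/
inductive Iter (P : View → Prop) (d : ℕ) (p : Program) : View → ℕ → View → Prop where
  | refl (σ : View) (B : ℕ) : Iter P d p σ B σ
  | step {σ σ₁ σ₂ : View} {B B₁ B₂ : ℕ} (hP : P σ) (h₁ : VExec p σ B₁ σ₁)
      (h₂ : Iter P d p σ₁ B₂ σ₂) (hB : B₁ + B₂ + d ≤ B) : Iter P d p σ B σ₂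

theorem Iter.mono {P : View → Prop} {d : ℕ} {p : Program} {σ σ' : View} {B B' : ℕ}
    (h : Iter P d p σ B σ') (hB : B ≤ B') : Iter P d p σ B' σ' := by
  cases h with
  | refl => exact .refl _ _
  | step hP h₁ h₂ h => exact .step hP h₁ h₂ (h.trans hB)

theorem Iter.trans {P : View → Prop} {d : ℕ} {p : Program} {σ₁ σ₂ σ₃ : View} {B₁ B₂ : ℕ}
    (h₁ : Iter P d p σ₁ B₁ σ₂) (h₂ : Iter P d p σ₂ B₂ σ₃) : Iter P d p σ₁ (B₁ + B₂) σ₃ := by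
  induction h₁ with
  | refl σ B => exact h₂.mono (by omega)
  | step hP h _ hB ih => exact .step hP h (ih h₂) (by omega)

theorem Iter.single {P : View → Prop} {d : ℕ} {p : Program} {σ σ' : View} {B : ℕ}
    (hP : P σ) (h : VExec p σ B σ') : Iter P d p σ (B + d) σ' :=
  .step hP h (.refl _ 0) le_rfl

/-- The instructions `g` run before the first test and after each round, so a round costs its body,
`g` and one test; the last, failing test is the summand outside `B`. -/
theorem Iter.vexec {g : List Instr} {b : Test} {P : View → Prop} (hg : Guard g b P)
    {p : Program} {σ σ' : View} {B : ℕ}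
    (h : Iter P ((Program.instrs g).length + 1) p σ B σ') (hP : ¬ P σ') :
    VExec (.whl g b p) σ (B + (Program.instrs g).length + 1) σ' := by
  have key : ∀ s, view s = σ → ∃ t s', Exec (.loop b (.seq p (.instrs g)))
      ((Program.instrs g).eval s) t s' ∧ t ≤ B + 1 ∧ view s' = σ' := by
    induction h with
    | refl σ =>
      rintro s rfl
      exact ⟨1, _, .loop_false fun h => hP ((hg s).2.1 h), by omega, (hg s).1⟩
    | step hPσ h₁ _ hB ih =>
      rintro s rfl
      obtain ⟨t₁, s₁, e₁, ht₁, hs₁⟩ := h₁ _ (hg s).1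
      obtain ⟨t₂, s₂, e₂, ht₂, hs₂⟩ := ih hP s₁ hs₁
      obtain ⟨t, e, ht⟩ := Program.exec_eval (Program.loopFree_instrs g) s₁
      exact ⟨_, s₂, .loop_true ((hg s).2.2 hPσ) (.seq e₁ e) e₂, by omega, hs₂⟩
  intro s hs
  obtain ⟨t, s', e, ht, hs'⟩ := key s hs
  obtain ⟨t', e', ht'⟩ := Program.exec_eval (Program.loopFree_instrs g) s
  exact ⟨_, s', .seq e' e, by omega, hs'⟩

/-! ### The program -/

open Function (update)

/-- Puts the head of the clause in register `10` on the stack if all premises are derived. -/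
def fireProg : Program :=
  .all [.instr (.load 11 7 10), .instr (.const 12 0),
    .ite (.eq 11 12) (.seq (.instr (.load 9 8 10))
      (.ite (.lt 12 9) (.seq (.instr (.succ 5)) (.instr (.store 10 5 9))) (.instr .skip)))
      (.instr .skip)]

def View.setI (σ : View) (i : ℕ) : View := { σ with i := i }

def View.setY (σ : View) (y : ℕ) : View := { σ with y := y }

def View.setC (σ : View) (c : ℕ) : View := { σ with c := c }

-- Head `0` means that the clause has no positive literal: position `0` holds an opening brace,
-- never an atom.
open Classical in
noncomputable def View.fire (σ : View) (c : ℕ) : View :=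
  if σ.cn c = 0 ∧ 0 < σ.hd c then
    { σ with wp := σ.wp + 1, wk := update σ.wk (σ.wp + 1) (σ.hd c) }
  else σ

/-- Removes the occurrence `y` from its list. -/
def popProg : Program :=
  .all [.instr (.load 9 5 6),
    .ite (.lt 3 9) (.instr .skip)
      (.all [.instr (.const 9 1), .instr (.store 9 6 9), .instr (.load 10 6 6),
        .instr (.load 11 7 10), .instr (.pred 11), .instr (.store 7 10 11), fireProg]),
    .instr (.load 6 4 6)]

-- An occurrence with `cur < ow` is an abnormality letter of an inner block that has ended; its
-- value there is settled, so it is unlinked without a mark.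
open Classical in
noncomputable def View.pop (σ : View) : View :=
  if σ.cur < σ.ow σ.y then { σ with y := σ.nx σ.y }
  else (View.fire { σ with mrk := update σ.mrk σ.y 1,
                           cn := update σ.cn (σ.cl σ.y) (σ.cn (σ.cl σ.y) - 1) } (σ.cl σ.y)).setY
    (σ.nx σ.y)

/-- Takes the occurrence `q` of a derived atom from the stack. -/
def takeProg : Program := .instrs [.load 7 10 5, .pred 5]

def View.take (σ : View) : View := { σ with q := σ.wk σ.wp, wp := σ.wp - 1 }

/-- Finds the list of pending occurrences of the atom at `q`. -/
def findProg : Program :=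
  .all [.instr (.copy 11 7), .instr (.succ 11), .instr (.load 11 0 11), .instr (.load 9 0 7),
    .instr (.const 12 0),
    .ite (.eq 9 12) (.seq (.instr (.store 11 11 7)) (.instr (.load 6 2 11)))
      (.instr (.load 6 3 11))]

open Classical in
noncomputable def View.find (σ : View) : View :=
  if σ.inp σ.q = 0 then
    { σ with tr := update σ.tr (σ.inp (σ.q + 1)) σ.q, y := σ.tl (σ.inp (σ.q + 1)) }
  else { σ with y := σ.ta (σ.inp (σ.q + 1)) }

/-- Stores what remains of that list. -/
def resetProg : Program :=
  .all [.instr (.copy 11 7), .instr (.succ 11), .instr (.load 11 0 11), .instr (.load 9 0 7),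
    .instr (.const 12 0), .ite (.eq 9 12) (.instr (.store 2 11 6)) (.instr (.store 3 11 6))]

open Classical in
noncomputable def View.reset (σ : View) : View :=
  if σ.inp σ.q = 0 then { σ with tl := update σ.tl (σ.inp (σ.q + 1)) σ.y }
  else { σ with ta := update σ.ta (σ.inp (σ.q + 1)) σ.y }

/-- Processes the topmost derived atom. -/
def deriveProg : Program :=
  .seq takeProg (.cond [.load 9 5 7] (.lt 3 9) (.instr .skip)
    (.all [findProg, .whl [] (.lt 3 6) popProg, resetProg]))

/-- Puts the described letter at `q` on the stack if it is true in some child block. -/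
def collectProg : Program :=
  .all [.instr (.copy 11 7), .instr (.succ 11), .instr (.load 11 0 11), .instr (.load 9 11 11),
    .ite (.lt 3 9) (.seq (.instr (.succ 5)) (.instr (.store 10 5 7))) (.instr .skip),
    .instr (.succ 7), .instr (.succ 7)]

open Classical in
noncomputable def View.collect (σ : View) : View :=
  if σ.cur < σ.tr (σ.inp (σ.q + 1)) then
    { σ with wp := σ.wp + 1, wk := update σ.wk (σ.wp + 1) σ.q, q := σ.q + 2 }
  else { σ with q := σ.q + 2 }

/-- Enters the occurrence in register `13` into its list. -/
def occProg : Program :=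
  .all [.instr (.copy 11 13), .instr (.succ 11), .instr (.load 11 0 11), .instr (.load 9 0 13),
    .instr (.const 12 0),
    .ite (.eq 9 12)
      (.instrs [.load 10 2 11, .store 4 13 10, .store 2 11 13, .store 5 13 12])
      (.instrs [.load 10 3 11, .store 4 13 10, .store 3 11 13, .store 5 13 3])]

/-- Links the occurrence `x`. -/
def View.occ (σ : View) (x : ℕ) : View :=
  { σ with nx := update σ.nx x (if σ.inp x = 0 then σ.tl (σ.inp (x + 1)) else σ.ta (σ.inp (x + 1))),
           tl := if σ.inp x = 0 then update σ.tl (σ.inp (x + 1)) x else σ.tl,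
           ta := if σ.inp x = 0 then σ.ta else update σ.ta (σ.inp (x + 1)) x,
           -- With owner `0` the test `cur < ow` fails in every block: letters are shared by all
           -- blocks, abnormality letters belong to one.
           ow := update σ.ow x (if σ.inp x = 0 then 0 else σ.cur) }

/-- Reads a token, or a literal, of a formula. -/
def tokenProg : Program :=
  .all [.instr (.load 9 0 2), .instr (.const 10 4),
    .ite (.eq 9 10)
      (.all [.instr (.copy 13 2), .instr (.succ 13), occProg,
        .instrs [.store 6 13 4, .load 11 7 4, .succ 11, .store 7 4 11, .succ 2, .succ 2,
          .succ 2]])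
      (.seq (.instr (.const 10 2)) (.ite (.lt 9 10)
        (.all [.instr (.copy 13 2), occProg, .instrs [.store 8 4 13, .succ 2, .succ 2]])
        (.seq (.instr (.const 10 7)) (.ite (.eq 9 10)
          (.all [.instr (.copy 10 4), fireProg, .instr (.copy 4 2), .instr (.succ 2)])
          (.instr (.succ 2))))))]

/-- Counts the negative occurrence `x` as a premise of the clause `c`. -/
def View.addNeg (σ : View) (x : ℕ) : View :=
  { σ with cl := update σ.cl x σ.c, cn := update σ.cn σ.c (σ.cn σ.c + 1) }

/-- Makes the positive occurrence `x` the head of the clause `c`. -/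
def View.addPos (σ : View) (x : ℕ) : View := { σ with hd := update σ.hd σ.c x }

-- The sign `∧` ends a clause, and its own position names the next one. Brackets, `∨`, `⊤` and `⊥`
-- carry no information in a CNF and are passed over; `¬` is always followed by an atom.
open Classical in
noncomputable def View.token (σ : View) : View :=
  if σ.inp σ.i = 4 then ((σ.occ (σ.i + 1)).addNeg (σ.i + 1)).setI (σ.i + 3)
  else if σ.inp σ.i < 2 then ((σ.occ σ.i).addPos σ.i).setI (σ.i + 2)
  else if σ.inp σ.i = 7 then ((σ.fire σ.c).setC σ.i).setI (σ.i + 1)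
  else σ.setI (σ.i + 1)

def skipProg : Program :=
  .whl [.load 9 0 2, .const 10 10] (.lt 9 10) (.instrs [.succ 2, .succ 2])

def collectLoop : Program := .whl [.load 9 0 7, .const 10 10] (.lt 9 10) collectProg

def deriveLoop : Program := .whl [.load 9 10 5] (.lt 3 9) deriveProg

def formulaLoop : Program := .whl [.load 9 0 2, .const 10 12] (.lt 9 10) tokenProg

/-- Reads a formula, the beginning of a block, the end of a block, or a comma after a block. -/
def memberProg : Program :=
  .cond [.load 9 0 2, .const 10 9] (.lt 9 10)
    (.all [.instr (.copy 4 2), formulaLoop, .all [.instr (.copy 10 4), fireProg, .instr (.succ 2)]])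
    (.cond [.load 9 0 2, .const 10 9] (.eq 9 10)
      (.all [.instrs [.store 12 2 3, .copy 3 2, .succ 2], skipProg, .instr (.succ 2)])
      (.cond [.load 9 0 2, .const 10 11] (.eq 9 10)
        (.all [.instrs [.copy 7 3, .succ 7], collectLoop, deriveLoop,
          .instrs [.load 3 12 3, .succ 2]])
        (.instr (.succ 2))))

def markProg : Program := .whl [] (.lt 2 0) memberProg

/-- Writes the contents of the registers `l`. -/
def emitRegs (l : List ℕ) : Program := .instrs (l.flatMap fun r => [.store 1 1 r, .succ 1])

def emitConst (x : ℕ) : Program := .seq (.instr (.const 9 x)) (emitRegs [9])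

def View.emit (σ : View) (x : ℕ) : View := { σ with out := update σ.out σ.j x, j := σ.j + 1 }

/-- Copies a token, or a literal, of a formula. -/
def copyProg : Program :=
  .all [.instr (.load 9 0 2), .instr (.const 10 4), .instr (.const 13 0),
    .ite (.eq 9 10)
      (.all [.instrs [.copy 11 2, .succ 11, .load 12 0 11, .load 14 9 11, .succ 11, .load 15 0 11],
        .ite (.eq 12 13) (emitRegs [10, 12, 15])
          (.ite (.eq 14 13) (emitRegs [10, 12, 15]) (emitConst 3)),
        .instrs [.succ 2, .succ 2, .succ 2]])
      (.seq (.instr (.const 12 2)) (.ite (.lt 9 12)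
        (.all [.instrs [.copy 11 2, .load 14 9 11, .succ 11, .load 15 0 11],
          .ite (.eq 9 13) (emitRegs [9, 15])
            (.ite (.eq 14 13) (emitConst 3) (emitRegs [10, 9, 15])),
          .instrs [.succ 2, .succ 2]])
        (.seq (emitRegs [9]) (.instr (.succ 2)))))]

open Classical in
noncomputable def View.copy (σ : View) : View :=
  if σ.inp σ.i = 4 then
    (if σ.inp (σ.i + 1) = 0 ∨ σ.mrk (σ.i + 1) = 0 then
      ((σ.emit 4).emit (σ.inp (σ.i + 1))).emit (σ.inp (σ.i + 2)) else σ.emit 3).setI (σ.i + 3)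
  else if σ.inp σ.i < 2 then
    (if σ.inp σ.i = 0 then (σ.emit (σ.inp σ.i)).emit (σ.inp (σ.i + 1))
    else if σ.mrk σ.i = 0 then σ.emit 3
    else ((σ.emit 4).emit (σ.inp σ.i)).emit (σ.inp (σ.i + 1))).setI (σ.i + 2)
  else (σ.emit (σ.inp σ.i)).setI (σ.i + 1)

def copyLoop : Program := .whl [.load 9 0 2, .const 10 12] (.lt 9 10) copyProg

def copyMemberProg : Program :=
  .cond [.load 9 0 2, .const 10 9] (.lt 9 10)
    (.all [emitConst 5, copyLoop, .all [emitConst 7, .instr (.succ 8), .instr (.succ 2)]])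
    (.cond [.load 9 0 2, .const 10 9] (.eq 9 10)
      (.all [.instr (.succ 2), skipProg, .instr (.succ 2)])
      (.instr (.succ 2)))

def describedProg : Program :=
  .all [.instrs [.load 9 0 2, .succ 2], emitRegs [9], .instrs [.load 9 0 2, .succ 2], emitRegs [9]]

def describedLoop : Program := .whl [.load 9 0 2, .const 10 10] (.lt 9 10) describedProg

def closeLoop : Program := .whl [.const 9 0] (.lt 9 8) (.seq (emitConst 6) (.instr (.pred 8)))

/-- The second scan. The described letters of the first block are copied as those of the flat block,
since without fixed letters they are all the letters. -/
def writeProg : Program :=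
  .all [.all [.instr (.const 2 0), emitConst 9, .instr (.succ 2)], describedLoop,
    .all [emitConst 10, .instr (.succ 2)], .whl [] (.lt 2 0) copyMemberProg, emitConst 2,
    closeLoop, .all [emitConst 12, emitConst 11]]

/-! ### Execution of the parts of the program without loops -/

theorem guard_pos (n : ℕ) : Guard [.load 9 0 2, .const 10 n] (.lt 9 10) fun σ => σ.inp σ.i < n := by
  intro s
  simp [Program.instrs, Program.all, Program.eval, Instr.run, Test.Holds, view]

theorem guard_eq (n : ℕ) : Guard [.load 9 0 2, .const 10 n] (.eq 9 10) fun σ => σ.inp σ.i = n := by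
  intro s
  simp [Program.instrs, Program.all, Program.eval, Instr.run, Test.Holds, view]

theorem guard_end : Guard [] (.lt 2 0) fun σ => σ.i < σ.len := by
  intro s
  simp [Program.instrs, Program.all, Program.eval, Instr.run, Test.Holds, view]

theorem guard_list : Guard [] (.lt 3 6) fun σ => σ.cur < σ.y := by
  intro s
  simp [Program.instrs, Program.all, Program.eval, Instr.run, Test.Holds, view]

theorem guard_owner : Guard [.load 9 5 7] (.lt 3 9) fun σ => σ.cur < σ.ow σ.q := by
  intro s
  simp [Program.instrs, Program.all, Program.eval, Instr.run, Test.Holds, view]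

theorem guard_collect :
    Guard [.load 9 0 7, .const 10 10] (.lt 9 10) fun σ => σ.inp σ.q < 10 := by
  intro s
  simp [Program.instrs, Program.all, Program.eval, Instr.run, Test.Holds, view]

theorem guard_derive : Guard [.load 9 10 5] (.lt 3 9) fun σ => σ.cur < σ.wk σ.wp := by
  intro s
  simp [Program.instrs, Program.all, Program.eval, Instr.run, Test.Holds, view]

theorem guard_close : Guard [.const 9 0] (.lt 9 8) fun σ => 0 < σ.m := by
  intro s
  simp [Program.instrs, Program.all, Program.eval, Instr.run, Test.Holds, view]

/-- The bounds 50 and 80 in this and the following lemmas are round numbers above the lengths of the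
programs. -/
theorem vexec_pop (σ : View) : VExec popProg σ 50 σ.pop := by
  refine (VExec.of_eval (by rfl) (f := View.pop) (fun s => ?_) σ).mono (by decide)
  by_cases h₁ : s.reg 3 < s.arr 5 (s.reg 6)
  · simp [popProg, Program.all, Program.eval, Instr.run, Test.Holds, View.pop, view, h₁]
  · by_cases h₂ : s.arr 7 (s.arr 6 (s.reg 6)) - 1 = 0 <;>
      by_cases h₃ : 0 < s.arr 8 (s.arr 6 (s.reg 6)) <;>
        simp [popProg, fireProg, Program.all, Program.eval, Instr.run, Test.Holds, View.pop,
          View.fire, View.setY, view, h₁, h₂, h₃]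

theorem vexec_take (σ : View) : VExec takeProg σ 50 σ.take :=
  (VExec.of_eval (by rfl) (f := View.take) (fun s => by
    simp [takeProg, Program.instrs, Program.all, Program.eval, Instr.run, View.take, view])
    σ).mono (by decide)

theorem vexec_find (σ : View) : VExec findProg σ 50 σ.find := by
  refine (VExec.of_eval (by rfl) (f := View.find) (fun s => ?_) σ).mono (by decide)
  by_cases h : s.arr 0 (s.reg 7) = 0 <;>
    simp [findProg, Program.all, Program.eval, Instr.run, Test.Holds, View.find, view, h]

theorem vexec_reset (σ : View) : VExec resetProg σ 50 σ.reset := by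
  refine (VExec.of_eval (by rfl) (f := View.reset) (fun s => ?_) σ).mono (by decide)
  by_cases h : s.arr 0 (s.reg 7) = 0 <;>
    simp [resetProg, Program.all, Program.eval, Instr.run, Test.Holds, View.reset, view, h]

theorem vexec_collect (σ : View) : VExec collectProg σ 50 σ.collect := by
  refine (VExec.of_eval (by rfl) (f := View.collect) (fun s => ?_) σ).mono (by decide)
  by_cases h : s.reg 3 < s.arr 11 (s.arr 0 (s.reg 7 + 1)) <;>
    simp [collectProg, Program.all, Program.eval, Instr.run, Test.Holds, View.collect, view, h]

theorem vexec_token (σ : View) : VExec tokenProg σ 80 σ.token := by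
  refine (VExec.of_eval (by rfl) (f := View.token) (fun s => ?_) σ).mono (by decide)
  have h₄ : s.arr 0 (s.reg 2) = 4 ∨ s.arr 0 (s.reg 2) = 0 ∨ s.arr 0 (s.reg 2) = 1 ∨
    s.arr 0 (s.reg 2) = 7 ∨
    s.arr 0 (s.reg 2) ≠ 7 ∧ s.arr 0 (s.reg 2) ≠ 4 ∧ 2 ≤ s.arr 0 (s.reg 2) := by omega
  rcases h₄ with h | h | h | h | ⟨h, h', h''⟩
  · by_cases h₁ : s.arr 0 (s.reg 2 + 1) = 0 <;>
      simp [tokenProg, occProg, Program.instrs, Program.all, Program.eval, Instr.run,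
        Test.Holds, View.token, View.occ, View.addNeg, View.setI, view, h, h₁]
  · simp [tokenProg, occProg, Program.instrs, Program.all, Program.eval, Instr.run,
      Test.Holds, View.token, View.occ, View.addPos, View.setI, view, h]
  · simp [tokenProg, occProg, Program.instrs, Program.all, Program.eval, Instr.run,
      Test.Holds, View.token, View.occ, View.addPos, View.setI, view, h]
  · by_cases h₁ : s.arr 7 (s.reg 4) = 0 <;> by_cases h₂ : 0 < s.arr 8 (s.reg 4) <;>
      simp [tokenProg, fireProg, Program.instrs, Program.all, Program.eval, Instr.run,
        Test.Holds, View.token, View.fire, View.setI, View.setC, view, h, h₁, h₂]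
  · simp [tokenProg, Program.instrs, Program.all, Program.eval, Instr.run,
      Test.Holds, View.token, View.setI, view, h, h', h''.not_gt]

theorem vexec_copy (σ : View) : VExec copyProg σ 80 σ.copy := by
  refine (VExec.of_eval (by rfl) (f := View.copy) (fun s => ?_) σ).mono (by decide)
  have h₄ : s.arr 0 (s.reg 2) = 4 ∨ s.arr 0 (s.reg 2) = 0 ∨ s.arr 0 (s.reg 2) = 1 ∨
    s.arr 0 (s.reg 2) ≠ 4 ∧ 2 ≤ s.arr 0 (s.reg 2) := by omega
  rcases h₄ with h | h | h | ⟨h, h'⟩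
  · by_cases h₁ : s.arr 0 (s.reg 2 + 1) = 0 <;> by_cases h₂ : s.arr 9 (s.reg 2 + 1) = 0 <;>
      simp [copyProg, emitRegs, emitConst, Program.instrs, Program.all, Program.eval, Instr.run,
        Test.Holds, View.copy, View.emit, View.setI, view, h, h₁, h₂]
  · simp [copyProg, emitRegs, emitConst, Program.instrs, Program.all, Program.eval, Instr.run,
      Test.Holds, View.copy, View.emit, View.setI, view, h]
  · by_cases h₂ : s.arr 9 (s.reg 2) = 0 <;>
      simp [copyProg, emitRegs, emitConst, Program.instrs, Program.all, Program.eval, Instr.run,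
        Test.Holds, View.copy, View.emit, View.setI, view, h, h₂]
  · simp [copyProg, emitRegs, emitConst, Program.instrs, Program.all, Program.eval, Instr.run,
      Test.Holds, View.copy, View.emit, View.setI, view, h, h'.not_gt]

def View.openBlock (σ : View) : View :=
  { σ with pa := update σ.pa σ.i σ.cur, cur := σ.i, i := σ.i + 1 }

def View.setQ (σ : View) (q : ℕ) : View := { σ with q := q }

def View.closeBlock (σ : View) : View := { σ with cur := σ.pa σ.cur, i := σ.i + 1 }

def View.setM (σ : View) (m : ℕ) : View := { σ with m := m }

theorem vexec_setC (σ : View) : VExec (.instr (.copy 4 2)) σ 50 (σ.setC σ.i) :=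
  (VExec.of_eval (by rfl) (f := fun σ => σ.setC σ.i) (fun s => by
    simp [Program.eval, Instr.run, View.setC, view]) σ).mono (by decide)

theorem vexec_succ (σ : View) : VExec (.instr (.succ 2)) σ 50 (σ.setI (σ.i + 1)) :=
  (VExec.of_eval (by rfl) (f := fun σ => σ.setI (σ.i + 1)) (fun s => by
    simp [Program.eval, Instr.run, View.setI, view]) σ).mono (by decide)

theorem vexec_succ_succ (σ : View) :
    VExec (.instrs [.succ 2, .succ 2]) σ 50 (σ.setI (σ.i + 2)) :=
  (VExec.of_eval (by rfl) (f := fun σ => σ.setI (σ.i + 2)) (fun s => by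
    simp [Program.instrs, Program.all, Program.eval, Instr.run, View.setI, view])
    σ).mono (by decide)

theorem vexec_endClause (σ : View) :
    VExec (.all [.instr (.copy 10 4), fireProg, .instr (.succ 2)]) σ 50
      ((σ.fire σ.c).setI (σ.i + 1)) := by
  refine (VExec.of_eval (by rfl) (f := fun σ => (σ.fire σ.c).setI (σ.i + 1))
    (fun s => ?_) σ).mono (by decide)
  by_cases h₁ : s.arr 7 (s.reg 4) = 0 <;> by_cases h₂ : 0 < s.arr 8 (s.reg 4) <;>
    simp [fireProg, Program.all, Program.eval, Instr.run, Test.Holds, View.fire, View.setI, view,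
      h₁, h₂]

theorem vexec_openBlock (σ : View) :
    VExec (.instrs [.store 12 2 3, .copy 3 2, .succ 2]) σ 50 σ.openBlock :=
  (VExec.of_eval (by rfl) (f := View.openBlock) (fun s => by
    simp [Program.instrs, Program.all, Program.eval, Instr.run, View.openBlock, view])
    σ).mono (by decide)

theorem vexec_setQ (σ : View) : VExec (.instrs [.copy 7 3, .succ 7]) σ 50 (σ.setQ (σ.cur + 1)) :=
  (VExec.of_eval (by rfl) (f := fun σ => σ.setQ (σ.cur + 1)) (fun s => by
    simp [Program.instrs, Program.all, Program.eval, Instr.run, View.setQ, view])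
    σ).mono (by decide)

theorem vexec_closeBlock (σ : View) :
    VExec (.instrs [.load 3 12 3, .succ 2]) σ 50 σ.closeBlock :=
  (VExec.of_eval (by rfl) (f := View.closeBlock) (fun s => by
    simp [Program.instrs, Program.all, Program.eval, Instr.run, View.closeBlock, view])
    σ).mono (by decide)

theorem vexec_emitConst (x : ℕ) (σ : View) : VExec (emitConst x) σ 50 (σ.emit x) :=
  (VExec.of_eval (by rfl) (f := fun σ => σ.emit x) (fun s => by
    simp [emitConst, emitRegs, Program.instrs, Program.all, Program.eval, Instr.run, View.emit,
      view]) σ).mono (by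
    simp [emitConst, emitRegs, Program.instrs, Program.all, Program.length])

theorem vexec_endCopy (σ : View) :
    VExec (.all [emitConst 7, .instr (.succ 8), .instr (.succ 2)]) σ 50
      (((σ.emit 7).setM (σ.m + 1)).setI (σ.i + 1)) :=
  (VExec.of_eval (by rfl) (f := fun σ => ((σ.emit 7).setM (σ.m + 1)).setI (σ.i + 1)) (fun s => by
    simp [emitConst, emitRegs, Program.instrs, Program.all, Program.eval, Instr.run, View.emit,
      View.setI, View.setM, view]) σ).mono (by decide)

theorem vexec_described (σ : View) :
    VExec describedProg σ 50
      (((σ.emit (σ.inp σ.i)).emit (σ.inp (σ.i + 1))).setI (σ.i + 2)) :=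
  (VExec.of_eval (by rfl)
    (f := fun σ => ((σ.emit (σ.inp σ.i)).emit (σ.inp (σ.i + 1))).setI (σ.i + 2)) (fun s => by
    simp [describedProg, emitRegs, Program.instrs, Program.all, Program.eval, Instr.run, View.emit,
      View.setI, view]) σ).mono (by decide)

theorem vexec_beginWrite (σ : View) :
    VExec (.all [.instr (.const 2 0), emitConst 9, .instr (.succ 2)]) σ 50
      ((σ.emit 9).setI 1) :=
  (VExec.of_eval (by rfl) (f := fun σ => (σ.emit 9).setI 1) (fun s => by
    simp [emitConst, emitRegs, Program.instrs, Program.all, Program.eval, Instr.run, View.emit,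
      View.setI, view]) σ).mono (by decide)

theorem vexec_emit_succ (σ : View) :
    VExec (.all [emitConst 10, .instr (.succ 2)]) σ 50 ((σ.emit 10).setI (σ.i + 1)) :=
  (VExec.of_eval (by rfl) (f := fun σ => (σ.emit 10).setI (σ.i + 1)) (fun s => by
    simp [emitConst, emitRegs, Program.instrs, Program.all, Program.eval, Instr.run, View.emit,
      View.setI, view]) σ).mono (by decide)

theorem vexec_closeParen (σ : View) :
    VExec (.seq (emitConst 6) (.instr (.pred 8))) σ 50 ((σ.emit 6).setM (σ.m - 1)) :=
  (VExec.of_eval (by rfl) (f := fun σ => (σ.emit 6).setM (σ.m - 1)) (fun s => by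
    simp [emitConst, emitRegs, Program.instrs, Program.all, Program.eval, Instr.run, View.emit,
      View.setM, view]) σ).mono (by decide)

theorem vexec_endWrite (σ : View) :
    VExec (.all [emitConst 12, emitConst 11]) σ 50 ((σ.emit 12).emit 11) :=
  (VExec.of_eval (by rfl) (f := fun σ => (σ.emit 12).emit 11) (fun s => by
    simp [emitConst, emitRegs, Program.instrs, Program.all, Program.eval, Instr.run, View.emit,
      view]) σ).mono (by decide)

/-! ### Lists in arrays -/

/-- The list that starts at `h`, is linked by `nx`, and ends before `e`. -/
def Chain (nx : ℕ → ℕ) (e : ℕ) : ℕ → List ℕ → Prop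
  | h, [] => h = e
  | h, x :: l => h = x ∧ Chain nx e (nx x) l

theorem Chain.congr {nx nx' : ℕ → ℕ} {e h : ℕ} {l : List ℕ} (hc : Chain nx e h l)
    (hl : ∀ x ∈ l, nx' x = nx x) : Chain nx' e h l := by
  induction l generalizing h with
  | nil => exact hc
  | cons x l ih =>
    refine ⟨hc.1, ?_⟩
    rw [hl x (by simp)]
    exact ih hc.2 fun y hy => hl y (by simp [hy])

theorem Chain.append {nx : ℕ → ℕ} {e e' h : ℕ} {l l' : List ℕ} (hc : Chain nx e h l)
    (hc' : Chain nx e' e l') : Chain nx e' h (l ++ l') := by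
  induction l generalizing h with
  | nil => cases hc; exact hc'
  | cons x l ih => exact ⟨hc.1, ih hc.2⟩

theorem Chain.head_mem {nx : ℕ → ℕ} {e h : ℕ} {l : List ℕ} (hc : Chain nx e h l) :
    h = e ∨ h ∈ l := by
  cases l with
  | nil => exact Or.inl hc
  | cons x l => exact Or.inr (by simp [hc.1])

/-- The contents of the stack `wk` of height `n`, the top first. -/
def stackOf (wk : ℕ → ℕ) : ℕ → List ℕ
  | 0 => []
  | n + 1 => wk (n + 1) :: stackOf wk n

theorem stackOf_update {wk : ℕ → ℕ} {n m x : ℕ} (h : n < m) :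
    stackOf (update wk m x) n = stackOf wk n := by
  induction n with
  | zero => rfl
  | succ n ih =>
    rw [stackOf, stackOf, ih (by omega), Function.update_of_ne (by omega)]

/-! ### Clauses -/

/-- A clause that has been read: its position, its block, and the positions of its literals. -/
structure Clause : Type where
  id : ℕ
  own : ℕ
  neg : List ℕ
  pos : List ℕ

def Clause.occs (c : Clause) : List ℕ := c.neg ++ c.pos

theorem Clause.mem_occs {c : Clause} {x : ℕ} : x ∈ c.occs ↔ x ∈ c.neg ∨ x ∈ c.pos :=
  List.mem_append

/-- The atom at the position `x`. -/
def View.atom (σ : View) (x : ℕ) : ℕ × ℕ := (σ.inp x, σ.inp (x + 1))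

/-- The first pending occurrence of an atom. -/
def View.top (σ : View) (a : ℕ × ℕ) : ℕ := if a.1 = 0 then σ.tl a.2 else σ.ta a.2

/-- The rules of a clause from the point of view of the block `s`: a clause of `s` itself is a rule
if it has a head, and in a clause of a block inside `s` the abnormality letters have the values
given by the marks. -/
def Clause.rules (σ : View) (s : ℕ) (c : Clause) : Set Rule :=
  {r | ∃ x ∈ c.pos, r.2 = σ.atom x ∧
    ((c.own = s ∧ r.1 = {a | ∃ y ∈ c.neg, σ.atom y = a}) ∨
     (c.own ≠ s ∧ σ.inp x = 0 ∧ (∀ y ∈ c.neg, σ.inp y ≠ 0 → σ.mrk y ≠ 0) ∧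
      r.1 = {a | ∃ y ∈ c.neg, σ.inp y = 0 ∧ σ.atom y = a}))}

def rulesOf (σ : View) (s : ℕ) (A : List Clause) : Set Rule := {r | ∃ c ∈ A, r ∈ c.rules σ s}

/-- The data structure for the clauses `A` that begin at `lo` or later in the block `s`, of which
the occurrences `U` are still in the lists that start at `top`. -/
structure Base (σ : View) (s lo : ℕ) (base top : ℕ × ℕ → ℕ) (A : List Clause) (U : List ℕ) :
    Prop where
  chain : ∀ a, a.1 ≤ 1 → Chain σ.nx (base a) (top a) (U.filter fun x => σ.atom x = a)
  nodup : U.Nodup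
  base_le : ∀ a, base a ≤ s
  lt_lo : s < lo
  pending : ∀ x ∈ U, σ.mrk x = 0 ∧ ∃ c ∈ A, x ∈ c.occs
  ids : ∀ c ∈ A, ∀ c' ∈ A, c.id = c'.id → c = c'
  id_le : ∀ c ∈ A, lo ≤ c.id ∧ c.id ≤ σ.i
  own_le : ∀ c ∈ A, s ≤ c.own
  occ : ∀ c ∈ A, ∀ y ∈ c.occs, lo ≤ y ∧ y < σ.i ∧ σ.inp y ≤ 1 ∧
    σ.ow y = if σ.inp y = 0 then 0 else c.own
  cl_neg : ∀ c ∈ A, ∀ y ∈ c.neg, σ.cl y = c.id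
  -- Positive occurrences are in the lists too, since their marks are needed for the output. They
  -- point to a dummy clause `0` with count `0` and no head, so marking them has no other effect.
  cl_pos : ∀ c ∈ A, ∀ y ∈ c.pos, σ.cl y = 0
  hd : ∀ c ∈ A, σ.hd c.id = c.pos.headD 0
  cn : ∀ c ∈ A, σ.cn c.id = (c.neg.filter fun y => σ.mrk y = 0).length
  neg_nodup : ∀ c ∈ A, c.neg.Nodup
  pos_eq : ∀ c ∈ A, ∀ x ∈ c.pos, ∀ y ∈ c.pos, σ.atom x = σ.atom y
  -- Only occurrences that count in the block `s` are guaranteed to be listed; those owned by inner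
  -- blocks may have been dropped.
  unmarked : ∀ c ∈ A, ∀ y ∈ c.occs, σ.ow y ≤ s → σ.mrk y = 0 → y ∈ U
  zero : σ.cn 0 = 0 ∧ σ.hd 0 = 0

/-- The stack consists of the occurrences `ws` after `s`, and those in `wb` before. -/
structure Stack (σ : View) (s : ℕ) (ws wb : List ℕ) : Prop where
  eq : stackOf σ.wk σ.wp = ws ++ wb
  zero : σ.wk 0 = 0
  lt : ∀ z ∈ ws, s < z
  le : ∀ z ∈ wb, z ≤ s

theorem Stack.push {σ σ' : View} {s : ℕ} {ws wb : List ℕ} (h : Stack σ s ws wb) {x : ℕ}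
    (hx : s < x) (hwp : σ'.wp = σ.wp + 1) (hwk : σ'.wk = update σ.wk (σ.wp + 1) x) :
    Stack σ' s (x :: ws) wb where
  eq := by simp [hwp, hwk, stackOf, stackOf_update, h.eq]
  zero := by simp [hwk, h.zero]
  lt := by simpa [hx] using h.lt
  le := h.le

theorem Stack.congr {σ σ' : View} {s : ℕ} {ws wb : List ℕ} (h : Stack σ s ws wb)
    (hwp : σ'.wp = σ.wp) (hwk : σ'.wk = σ.wk) : Stack σ' s ws wb :=
  ⟨by rw [hwp, hwk, h.eq], by rw [hwk, h.zero], h.lt, h.le⟩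

theorem Stack.lt_iff {σ : View} {s : ℕ} {ws wb : List ℕ} (h : Stack σ s ws wb) :
    s < σ.wk σ.wp ↔ ws ≠ [] := by
  have he := h.eq
  cases hwp : σ.wp with
  | zero =>
    rw [hwp, stackOf] at he
    simp [h.zero, (List.append_eq_nil_iff.1 he.symm).1]
  | succ n =>
    rw [hwp, stackOf] at he
    cases ws with
    | nil =>
      have := h.le (σ.wk (n + 1)) (by rw [List.nil_append] at he; simp [← he])
      simpa using this
    | cons z ws =>
      have := h.lt z (by simp)
      rw [List.cons_append, List.cons.injEq] at he
      simpa [he.1] using this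

theorem Stack.pop {σ : View} {s z : ℕ} {ws wb : List ℕ} (h : Stack σ s (z :: ws) wb) :
    σ.wk σ.wp = z ∧ Stack σ.take s ws wb := by
  have he := h.eq
  cases hwp : σ.wp with
  | zero => simp [hwp, stackOf] at he
  | succ n =>
    rw [hwp, stackOf, List.cons_append, List.cons.injEq] at he
    refine ⟨he.1, ⟨?_, h.zero, fun x hx => h.lt x (by simp [hx]), h.le⟩⟩
    simp [View.take, hwp, he.2]

/-- Work in progress at the end of the block `s`: the atoms in `X` have been derived from the rules
`R`, all pending occurrences of those in `Y` have been treated, and those on the stack `ws` wait. -/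
structure Work (σ : View) (s lo : ℕ) (base top : ℕ × ℕ → ℕ) (A : List Clause) (R : Set Rule)
    (wb U ws : List ℕ) (X Y : Set (ℕ × ℕ)) : Prop where
  base : Base σ s lo base top A U
  rules : rulesOf σ s A = R
  cur : σ.cur = s
  stack : Stack σ s ws wb
  marked : ∀ c ∈ A, ∀ y ∈ c.occs, σ.ow y ≤ s → σ.mrk y ≠ 0 → Der R (σ.atom y)
  der : ∀ a ∈ X, Der R a
  -- Any waiting occurrence of the same atom will do, as the propagation treats atoms and not
  -- occurrences.
  fired : ∀ c ∈ A, (∀ y ∈ c.neg, σ.mrk y ≠ 0) → ∀ x ∈ c.pos, σ.ow x ≤ s →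
    σ.atom x ∈ X ∨ ∃ z ∈ ws, σ.ow z ≤ s ∧ σ.atom z = σ.atom x
  waiting : ∀ z ∈ ws, z < σ.i ∧ σ.inp z ≤ 1 ∧ (σ.ow z ≤ s → Der R (σ.atom z))
  tr : ∀ p, s < σ.tr p → (0, p) ∈ X ∨ ∃ z ∈ ws, σ.ow z ≤ s ∧ σ.atom z = (0, p)
  lt_tr : ∀ p, (0, p) ∈ X → s < σ.tr p
  done : ∀ x ∈ U, σ.ow x ≤ s → σ.atom x ∉ Y

/-- What the treatment of the end of a block leaves unchanged. -/
structure CloseRel (σ σ' : View) (s lo : ℕ) : Prop where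
  len : σ'.len = σ.len
  j : σ'.j = σ.j
  i : σ'.i = σ.i
  cur : σ'.cur = σ.cur
  m : σ'.m = σ.m
  inp : σ'.inp = σ.inp
  out : σ'.out = σ.out
  nx : σ'.nx = σ.nx
  ow : σ'.ow = σ.ow
  cl : σ'.cl = σ.cl
  hd : σ'.hd = σ.hd
  pa : σ'.pa = σ.pa
  mrk : ∀ x, (lo ≤ x ∧ x < σ.i ∧ σ.ow x ≤ s) ∨ σ'.mrk x = σ.mrk x
  cn : ∀ x, (lo ≤ x ∧ x ≤ σ.i) ∨ σ'.cn x = σ.cn x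
  tr : ∀ p, (s < σ'.tr p ∧ σ'.tr p ≤ σ.i) ∨ σ'.tr p = σ.tr p

theorem CloseRel.refl (σ : View) (s lo : ℕ) : CloseRel σ σ s lo := by
  constructor <;> simp

theorem CloseRel.trans {σ₁ σ₂ σ₃ : View} {s lo : ℕ} (h₁ : CloseRel σ₁ σ₂ s lo)
    (h₂ : CloseRel σ₂ σ₃ s lo) : CloseRel σ₁ σ₃ s lo where
  len := h₂.len.trans h₁.len
  j := h₂.j.trans h₁.j
  i := h₂.i.trans h₁.i
  cur := h₂.cur.trans h₁.cur
  m := h₂.m.trans h₁.m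
  inp := h₂.inp.trans h₁.inp
  out := h₂.out.trans h₁.out
  nx := h₂.nx.trans h₁.nx
  ow := h₂.ow.trans h₁.ow
  cl := h₂.cl.trans h₁.cl
  hd := h₂.hd.trans h₁.hd
  pa := h₂.pa.trans h₁.pa
  mrk x := by
    have := h₁.mrk x; have := h₂.mrk x; rw [h₁.i, h₁.ow] at this
    grind
  cn x := by
    have := h₁.cn x; have := h₂.cn x; rw [h₁.i] at this
    grind
  tr p := by
    have := h₁.tr p; have := h₂.tr p; rw [h₁.i] at this
    grind

/-- Clause numbers are distinct and positive, so `cl` identifies the one clause of which `y` is a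
premise, and the value `0` excludes all of them. -/
theorem Base.mem_neg_iff {σ : View} {s lo : ℕ} {base top : ℕ × ℕ → ℕ} {A : List Clause}
    {U : List ℕ} (h : Base σ s lo base top A U) {c₀ c : Clause} (hc₀ : c₀ ∈ A) (hc : c ∈ A)
    {y : ℕ} (hy : y ∈ c₀.occs) : y ∈ c.neg ↔ c.id = σ.cl y := by
  constructor
  · exact fun hn => (h.cl_neg c hc y hn).symm
  · intro he
    rcases Clause.mem_occs.1 hy with hn | hp
    · rw [h.cl_neg c₀ hc₀ y hn] at he
      rwa [h.ids c hc c₀ hc₀ he]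
    · rw [h.cl_pos c₀ hc₀ y hp] at he
      have := h.id_le c hc
      have := h.lt_lo
      omega

theorem length_filter_update {l : List ℕ} (hl : l.Nodup) {f : ℕ → ℕ} {y : ℕ} (hy : f y = 0) :
    (l.filter fun z => update f y 1 z = 0).length =
      (l.filter fun z => f z = 0).length - if y ∈ l then 1 else 0 := by
  have h : (l.filter fun z => update f y 1 z = 0) = (l.filter fun z => f z = 0).erase y := by
    rw [(hl.filter _).erase_eq_filter, List.filter_filter]
    refine List.filter_congr fun z _ => ?_
    by_cases hz : z = y <;> simp [hz]
  rw [h, List.length_erase]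
  by_cases hm : y ∈ l <;> simp [hm, hy]

theorem filter_ne_of_filter_eq_cons {U l : List ℕ} (hU : U.Nodup) {P : ℕ → Bool} {y : ℕ}
    (h : U.filter P = y :: l) : (U.filter (· ≠ y)).filter P = l := by
  have hn := hU.filter P
  rw [h, List.nodup_cons] at hn
  rw [List.filter_filter, show (fun a => P a && decide (a ≠ y)) = fun a => decide (a ≠ y) && P a
    from funext fun a => Bool.and_comm _ _, ← List.filter_filter, h, List.filter_cons]
  simp only [ne_eq, not_true_eq_false, decide_false, Bool.false_eq_true, if_false]
  exact List.filter_eq_self.2 fun z hz => by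
    simp only [decide_not, Bool.not_eq_true', decide_eq_false_iff_not]
    rintro rfl
    exact hn.1 hz

/-- The rules depend only on the marks of the abnormality letters of inner blocks. -/
theorem rulesOf_congr {σ σ' : View} {s : ℕ} {A : List Clause} (hinp : σ'.inp = σ.inp)
    (hm : ∀ c ∈ A, c.own ≠ s → ∀ y ∈ c.neg, σ.inp y ≠ 0 → σ'.mrk y = σ.mrk y) :
    rulesOf σ' s A = rulesOf σ s A := by
  have hat : σ'.atom = σ.atom := by funext x; simp [View.atom, hinp]
  ext r
  simp only [rulesOf, Clause.rules, hat, hinp, Set.mem_ofPred_eq]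
  refine exists_congr fun c => and_congr_right fun hc => exists_congr fun x =>
    and_congr_right fun _ => and_congr_right fun _ => or_congr_right ?_
  refine and_congr_right fun ho => and_congr_right fun _ => and_congr_left fun _ => ?_
  exact forall₂_congr fun y hy => forall_congr' fun h0 => by rw [hm c hc ho y hy h0]

/-! ### Treatment of the end of a block -/

@[simp] theorem fire_len (σ : View) (c : ℕ) : (σ.fire c).len = σ.len := by
  unfold View.fire; split <;> rfl

@[simp] theorem fire_j (σ : View) (c : ℕ) : (σ.fire c).j = σ.j := by
  unfold View.fire; split <;> rfl

@[simp] theorem fire_i (σ : View) (c : ℕ) : (σ.fire c).i = σ.i := by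
  unfold View.fire; split <;> rfl

@[simp] theorem fire_cur (σ : View) (c : ℕ) : (σ.fire c).cur = σ.cur := by
  unfold View.fire; split <;> rfl

@[simp] theorem fire_y (σ : View) (c : ℕ) : (σ.fire c).y = σ.y := by
  unfold View.fire; split <;> rfl

@[simp] theorem fire_q (σ : View) (c : ℕ) : (σ.fire c).q = σ.q := by
  unfold View.fire; split <;> rfl

@[simp] theorem fire_m (σ : View) (c : ℕ) : (σ.fire c).m = σ.m := by
  unfold View.fire; split <;> rfl

@[simp] theorem fire_inp (σ : View) (c : ℕ) : (σ.fire c).inp = σ.inp := by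
  unfold View.fire; split <;> rfl

@[simp] theorem fire_out (σ : View) (c : ℕ) : (σ.fire c).out = σ.out := by
  unfold View.fire; split <;> rfl

@[simp] theorem fire_tl (σ : View) (c : ℕ) : (σ.fire c).tl = σ.tl := by
  unfold View.fire; split <;> rfl

@[simp] theorem fire_ta (σ : View) (c : ℕ) : (σ.fire c).ta = σ.ta := by
  unfold View.fire; split <;> rfl

@[simp] theorem fire_nx (σ : View) (c : ℕ) : (σ.fire c).nx = σ.nx := by
  unfold View.fire; split <;> rfl

@[simp] theorem fire_ow (σ : View) (c : ℕ) : (σ.fire c).ow = σ.ow := by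
  unfold View.fire; split <;> rfl

@[simp] theorem fire_cl (σ : View) (c : ℕ) : (σ.fire c).cl = σ.cl := by
  unfold View.fire; split <;> rfl

@[simp] theorem fire_cn (σ : View) (c : ℕ) : (σ.fire c).cn = σ.cn := by
  unfold View.fire; split <;> rfl

@[simp] theorem fire_hd (σ : View) (c : ℕ) : (σ.fire c).hd = σ.hd := by
  unfold View.fire; split <;> rfl

@[simp] theorem fire_mrk (σ : View) (c : ℕ) : (σ.fire c).mrk = σ.mrk := by
  unfold View.fire; split <;> rfl

@[simp] theorem fire_tr (σ : View) (c : ℕ) : (σ.fire c).tr = σ.tr := by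
  unfold View.fire; split <;> rfl

@[simp] theorem fire_pa (σ : View) (c : ℕ) : (σ.fire c).pa = σ.pa := by
  unfold View.fire; split <;> rfl

theorem Base.congr {σ σ' : View} {s lo : ℕ} {base top : ℕ × ℕ → ℕ} {A : List Clause}
    {U : List ℕ} (h : Base σ s lo base top A U) (hi : σ.i ≤ σ'.i) (hinp : σ'.inp = σ.inp)
    (hnx : σ'.nx = σ.nx) (how : σ'.ow = σ.ow) (hcl : σ'.cl = σ.cl) (hcn : σ'.cn = σ.cn)
    (hhd : σ'.hd = σ.hd) (hmrk : σ'.mrk = σ.mrk) : Base σ' s lo base top A U := by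
  have hat : σ'.atom = σ.atom := by funext x; simp [View.atom, hinp]
  constructor <;> try simp only [hat, hinp, hnx, how, hcl, hcn, hhd, hmrk]
  · exact h.chain
  · exact h.nodup
  · exact h.base_le
  · exact h.lt_lo
  · exact h.pending
  · exact h.ids
  · exact fun c hc => ⟨(h.id_le c hc).1, (h.id_le c hc).2.trans hi⟩
  · exact h.own_le
  · exact fun c hc y hy => ⟨(h.occ c hc y hy).1, (h.occ c hc y hy).2.1.trans_le hi,
      (h.occ c hc y hy).2.2⟩
  · exact h.cl_neg
  · exact h.cl_pos
  · exact h.hd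
  · exact h.cn
  · exact h.neg_nodup
  · exact h.pos_eq
  · exact h.unmarked
  · exact h.zero

/-- Marks the occurrence `y` and tells its clause. -/
def View.markOcc (σ : View) : View :=
  { σ with mrk := update σ.mrk σ.y 1, cn := update σ.cn (σ.cl σ.y) (σ.cn (σ.cl σ.y) - 1) }

theorem pop_of_lt {σ : View} (h : σ.cur < σ.ow σ.y) : σ.pop = σ.setY (σ.nx σ.y) := if_pos h

theorem pop_of_not_lt {σ : View} (h : ¬ σ.cur < σ.ow σ.y) :
    σ.pop = (σ.markOcc.fire (σ.cl σ.y)).setY (σ.nx σ.y) := if_neg h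

/-! ### Emptying the list of pending occurrences of one derived atom. -/

section Pop

variable {σ : View} {s lo : ℕ} {base top top' : ℕ × ℕ → ℕ} {A : List Clause} {R : Set Rule}
  {wb U ws l : List ℕ} {X Y : Set (ℕ × ℕ)} {v : ℕ × ℕ}

theorem Base.skip (h : Base σ s lo base top A U) (hs : s < σ.ow σ.y)
    (hc : ∀ a, a.1 ≤ 1 →
      Chain σ.nx (base a) (top' a) ((U.filter (· ≠ σ.y)).filter fun x => σ.atom x = a)) :
    Base σ s lo base top' A (U.filter (· ≠ σ.y)) :=
  { h with
    chain := hc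
    nodup := h.nodup.filter _
    pending := fun x hx => h.pending x (List.mem_of_mem_filter hx)
    unmarked := fun c hc y hy ho hm => List.mem_filter.2 ⟨h.unmarked c hc y hy ho hm, by
      simp only [ne_eq, decide_not, Bool.not_eq_true', decide_eq_false_iff_not]
      rintro rfl
      omega⟩ }

/-- A listed occurrence is unmarked and occurs at most once among the premises of a clause, so
exactly the counter of its own clause drops, by one. -/
theorem Base.markOcc (h : Base σ s lo base top A U) (hy : σ.y ∈ U)
    (hc : ∀ a, a.1 ≤ 1 →
      Chain σ.nx (base a) (top' a) ((U.filter (· ≠ σ.y)).filter fun x => σ.atom x = a)) :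
    Base σ.markOcc s lo base top' A (U.filter (· ≠ σ.y)) := by
  obtain ⟨hy0, c₀, hc₀, hy₀⟩ := h.pending _ hy
  exact
  { h with
    chain := hc
    nodup := h.nodup.filter _
    pending := fun x hx => by
      rw [List.mem_filter] at hx
      have hne : x ≠ σ.y := by simpa using hx.2
      have := h.pending x hx.1
      simpa [View.markOcc, hne] using this
    cn := fun c hc => by
      refine Eq.trans ?_ (length_filter_update (h.neg_nodup c hc) hy0).symm
      rw [← h.cn c hc]
      simp only [View.markOcc, h.mem_neg_iff hc₀ hc hy₀]
      by_cases hid : c.id = σ.cl σ.y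
      · simp [hid]
      · simp [hid]
    unmarked := fun c hc y hy ho hm => by
      by_cases hne : y = σ.y
      · subst hne; simp [View.markOcc] at hm
      · refine List.mem_filter.2 ⟨h.unmarked c hc y hy ho ?_, by simpa using hne⟩
        simpa [View.markOcc, hne] using hm
    -- For a positive occurrence the dummy counter is decremented; the truncated predecessor leaves
    -- it at `0`.
    zero := by
      refine ⟨?_, h.zero.2⟩
      simp only [View.markOcc]
      by_cases h0 : σ.cl σ.y = 0
      · simp [h0, h.zero.1]
      · rw [Function.update_of_ne (Ne.symm h0)]
        exact h.zero.1 }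

/-- The situation while the list of pending occurrences of `v` is being treated. -/
abbrev Popping (σ : View) (s lo : ℕ) (base : ℕ × ℕ → ℕ) (A : List Clause) (R : Set Rule)
    (wb U ws : List ℕ) (v : ℕ × ℕ) (Y : Set (ℕ × ℕ)) : Prop :=
  Work σ s lo base (fun a => if a = v then σ.y else σ.top a) A R wb U ws (insert v Y) Y

/-- The list of `v` is held by the register `y` and all others by `top`. Unlinking its head leaves
the other lists intact, since an occurrence carries only one atom. -/
theorem Popping.chain_pop (h : Popping σ s lo base A R wb U ws v Y) (hv : v.1 ≤ 1) {y : ℕ}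
    (hl : U.filter (fun x => σ.atom x = v) = y :: l) :
    σ.y = y ∧ y ∈ U ∧ σ.atom y = v ∧ s < y ∧ (U.filter (· ≠ y)).filter (σ.atom · = v) = l ∧
      ∀ a, a.1 ≤ 1 → Chain σ.nx (base a) (if a = v then σ.nx σ.y else σ.top a)
        ((U.filter (· ≠ σ.y)).filter fun x => σ.atom x = a) := by
  have hc := h.base.chain v hv
  rw [if_pos rfl, hl] at hc
  have hm : y ∈ U.filter (fun x => σ.atom x = v) := by simp [hl]
  have hyv : y ∈ U ∧ σ.atom y = v := by simpa using hm
  have hfl := filter_ne_of_filter_eq_cons h.base.nodup hl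
  refine ⟨hc.1, hyv.1, hyv.2, ?_, hfl, ?_⟩
  · obtain ⟨-, c, hc, hy⟩ := h.base.pending y hyv.1
    exact h.base.lt_lo.trans_le (h.base.occ c hc y hy).1
  · intro a ha
    rw [hc.1]
    by_cases hav : a = v
    · subst hav
      rw [if_pos rfl, hfl]
      exact hc.2
    · have := h.base.chain a ha
      rw [if_neg hav] at this ⊢
      rw [List.filter_filter]
      convert this using 1
      refine List.filter_congr fun x _ => ?_
      by_cases hx : x = y
      · subst hx
        simp [hyv.2, Ne.symm hav]
      · simp [hx]

/-- Soundness: marks are put only on derived atoms, so a clause with all premises marked has a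
derivable head. Completeness: a new mark can complete only the clause of the popped occurrence, and
exactly then its head is pushed. -/
theorem Popping.pop (h : Popping σ s lo base A R wb U ws v Y) (hv : v.1 ≤ 1) {y : ℕ}
    (hl : U.filter (fun x => σ.atom x = v) = y :: l) (hvd : Der R v) :
    ∃ ws', Popping σ.pop s lo base A R wb (U.filter (· ≠ y)) ws' v Y ∧ CloseRel σ σ.pop s lo ∧
      ws'.length ≤ ws.length + 1 ∧ σ.pop.q = σ.q ∧ σ.pop.tl = σ.tl ∧ σ.pop.ta = σ.ta := by
  obtain ⟨rfl, hyU, hyv, hsy, hfl, hch⟩ := h.chain_pop hv hl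
  have hcur := h.cur
  by_cases hlt : σ.cur < σ.ow σ.y
  · rw [pop_of_lt hlt]
    refine ⟨ws, ?_, by constructor <;> simp [View.setY], by omega, rfl, rfl, rfl⟩
    exact
    { base := (h.base.skip (by omega) hch).congr le_rfl rfl rfl rfl rfl rfl rfl rfl
      rules := h.rules
      cur := h.cur
      stack := h.stack.congr rfl rfl
      marked := h.marked
      der := h.der
      fired := h.fired
      waiting := h.waiting
      tr := h.tr
      lt_tr := h.lt_tr
      done := fun x hx => h.done x (List.mem_of_mem_filter hx) }
  · rw [pop_of_not_lt hlt]
    obtain ⟨hy0, c₀, hc₀, hy₀⟩ := h.base.pending _ hyU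
    have hocc := h.base.occ c₀ hc₀ _ hy₀
    have hb := h.base.markOcc hyU hch
    have hmrk : ∀ x, σ.markOcc.mrk x ≠ 0 ↔ x = σ.y ∨ σ.mrk x ≠ 0 := by
      intro x
      by_cases hx : x = σ.y <;> simp [View.markOcc, hx]
    have hrel : CloseRel σ σ.markOcc s lo := by
      constructor <;> try first | rfl | (intro p; exact Or.inr rfl)
      · intro x
        by_cases hx : x = σ.y
        · left; subst hx; exact ⟨hocc.1, hocc.2.1, by omega⟩
        · right; simp [View.markOcc, hx]
      · intro x
        by_cases hx : x = σ.cl σ.y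
        · rcases Clause.mem_occs.1 hy₀ with hn | hp
          · left; rw [hx, h.base.cl_neg _ hc₀ _ hn]; exact h.base.id_le _ hc₀
          · right; rw [hx, h.base.cl_pos _ hc₀ _ hp]
            simp [View.markOcc, h.base.cl_pos _ hc₀ _ hp, h.base.zero.1]
        · right; simp [View.markOcc, hx]
    -- The rules depend on marks of abnormality letters of inner blocks only, and such occurrences
    -- are excluded here by `hlt`.
    have hrules : rulesOf σ.markOcc s A = R := by
      rw [← h.rules]
      refine rulesOf_congr rfl fun c hc ho y hy h0 => ?_
      rcases hrel.mrk y with h1 | h1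
      · have h2 := (h.base.occ c hc y (Clause.mem_occs.2 (Or.inl hy))).2.2.2
        rw [if_neg h0] at h2
        have := h.base.own_le c hc
        omega
      · exact h1
    have hmarked : ∀ c ∈ A, ∀ y ∈ c.occs, σ.ow y ≤ s → σ.markOcc.mrk y ≠ 0 →
        Der R (σ.atom y) := by
      intro c hc y hy ho hm
      rcases (hmrk y).1 hm with rfl | hm
      · rwa [hyv]
      · exact h.marked c hc y hy ho hm
    have hder : ∀ c ∈ A, (∀ y ∈ c.neg, σ.markOcc.mrk y ≠ 0) → ∀ x ∈ c.pos, σ.ow x ≤ s →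
        Der R (σ.atom x) := by
      intro c hc hneg x hx hox
      have hrule : ∀ B, (B, σ.atom x) ∈ c.rules σ.markOcc s → (∀ a ∈ B, Der R a) →
          Der R (σ.atom x) := by
        intro B hB hBd
        exact Der.intro (hrules ▸ ⟨c, hc, hB⟩) hBd
      by_cases ho : c.own = s
      · refine hrule _ ⟨x, hx, rfl, Or.inl ⟨ho, rfl⟩⟩ ?_
        rintro a ⟨y, hy, rfl⟩
        have hyo := Clause.mem_occs.2 (Or.inl hy : y ∈ c.neg ∨ y ∈ c.pos)
        refine hmarked c hc y hyo ?_ (hneg y hy)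
        rw [(h.base.occ c hc y hyo).2.2.2]
        split <;> omega
      -- An abnormality letter in a clause of an inner block would have an owner after `s`.
      · have h0 : σ.inp x = 0 := by
          by_contra h0
          have := (h.base.occ c hc x (Clause.mem_occs.2 (Or.inr hx))).2.2.2
          rw [if_neg h0] at this
          have := h.base.own_le c hc
          omega
        refine hrule _ ⟨x, hx, rfl, Or.inr ⟨ho, h0, fun y hy _ => hneg y hy, rfl⟩⟩ ?_
        rintro a ⟨y, hy, hy0, rfl⟩
        have hyo := Clause.mem_occs.2 (Or.inl hy : y ∈ c.neg ∨ y ∈ c.pos)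
        refine hmarked c hc y hyo ?_ (hneg y hy)
        change σ.inp y = 0 at hy0
        rw [(h.base.occ c hc y hyo).2.2.2, if_pos hy0]
        omega
    have hdone : ∀ x ∈ U.filter (· ≠ σ.y), σ.ow x ≤ s → σ.atom x ∉ Y :=
      fun x hx => h.done x (List.mem_of_mem_filter hx)
    -- a clause other than that of `y` has its premises marked only if it had them before
    have hother : ∀ c ∈ A, (∀ y ∈ c.neg, σ.markOcc.mrk y ≠ 0) → c.id ≠ σ.cl σ.y →
        ∀ y ∈ c.neg, σ.mrk y ≠ 0 := by
      intro c hc hneg hid y hy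
      rcases (hmrk y).1 (hneg y hy) with rfl | hm
      · exact absurd ((h.base.mem_neg_iff hc₀ hc hy₀).1 hy) hid
      · exact hm
    have hcount : ∀ c ∈ A, σ.markOcc.cn c.id = 0 ↔ ∀ y ∈ c.neg, σ.markOcc.mrk y ≠ 0 := by
      intro c hc
      rw [hb.cn c hc, List.length_eq_zero_iff, List.filter_eq_nil_iff]
      simp
    have hhead : ∀ c ∈ A, 0 < σ.hd c.id → σ.hd c.id ∈ c.pos := by
      intro c hc h0
      rw [h.base.hd c hc] at h0 ⊢
      cases hp : c.pos with
      | nil => simp [hp] at h0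
      | cons x l => simp
    by_cases hf : σ.markOcc.cn (σ.cl σ.y) = 0 ∧ 0 < σ.markOcc.hd (σ.cl σ.y)
    · -- the clause fires
      -- A positive occurrence belongs to the dummy clause, which has no head and cannot fire.
      have hclause : ∃ c ∈ A, c.id = σ.cl σ.y := by
        rcases Clause.mem_occs.1 hy₀ with hn | hp
        · exact ⟨c₀, hc₀, (h.base.cl_neg _ hc₀ _ hn).symm⟩
        · have := hf.2
          rw [h.base.cl_pos _ hc₀ _ hp] at this
          have h2 := h.base.zero.2
          simp only [View.markOcc] at this
          omega
      obtain ⟨c, hc, hid⟩ := hclause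
      rw [← hid] at hf
      have hhd := hhead c hc hf.2
      have hhocc := h.base.occ c hc _ (Clause.mem_occs.2 (Or.inr hhd))
      have hneg := (hcount c hc).1 hf.1
      have hfire : σ.markOcc.fire (σ.cl σ.y) = { σ.markOcc with
          wp := σ.wp + 1, wk := update σ.wk (σ.wp + 1) (σ.hd c.id) } := by
        rw [← hid, View.fire, if_pos hf]
        rfl
      rw [hfire]
      refine ⟨σ.hd c.id :: ws, ?_, ?_, by simp, rfl, rfl, rfl⟩
      · exact
        { base := hb.congr le_rfl rfl rfl rfl rfl rfl rfl rfl
          rules := hrules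
          cur := h.cur
          stack := h.stack.push (h.base.lt_lo.trans_le hhocc.1) rfl rfl
          marked := hmarked
          der := h.der
          fired := fun c' hc' hneg' x hx hox => by
            by_cases hid' : c'.id = σ.cl σ.y
            · right
              have : c' = c := h.base.ids _ hc' _ hc (hid'.trans hid.symm)
              subst this
              -- The positive literals of a Horn clause may be repeated but carry one atom, and the
              -- owner depends only on the tag and the clause; so the pushed head stands for all of
              -- them.
              have hat := h.base.pos_eq _ hc _ hhd _ hx
              refine ⟨_, List.mem_cons_self, ?_, hat⟩
              have h1 := (h.base.occ _ hc _ (Clause.mem_occs.2 (Or.inr hx))).2.2.2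
              have h2 := hhocc.2.2.2
              simp only [View.atom, Prod.mk.injEq] at hat
              change σ.ow x ≤ s at hox
              change σ.ow _ ≤ s
              rw [h2, hat.1, ← h1]
              exact hox
            · rcases h.fired c' hc' (hother c' hc' hneg' hid') x hx hox with h1 | ⟨z, hz, h1⟩
              · exact Or.inl h1
              · exact Or.inr ⟨z, List.mem_cons_of_mem _ hz, h1⟩
          waiting := fun z hz => by
            rcases List.mem_cons.1 hz with rfl | hz
            · exact ⟨hhocc.2.1, hhocc.2.2.1, hder c hc hneg _ hhd⟩
            · exact h.waiting z hz
          tr := fun p hp => by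
            rcases h.tr p hp with h1 | ⟨z, hz, h1⟩
            · exact Or.inl h1
            · exact Or.inr ⟨z, List.mem_cons_of_mem _ hz, h1⟩
          lt_tr := h.lt_tr
          done := hdone }
      · exact { hrel with }
    · rw [View.fire, if_neg hf]
      refine ⟨ws, ?_, { hrel with }, by omega, rfl, rfl, rfl⟩
      exact
      { base := hb.congr le_rfl rfl rfl rfl rfl rfl rfl rfl
        rules := hrules
        cur := h.cur
        stack := h.stack.congr rfl rfl
        marked := hmarked
        der := h.der
        fired := fun c' hc' hneg' x hx hox => by
          by_cases hid' : c'.id = σ.cl σ.y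
          -- A clause with a positive literal has a nonzero head, so with all premises marked it
          -- would have fired.
          · exfalso
            refine hf ⟨?_, ?_⟩
            · rw [← hid']
              exact (hcount c' hc').2 hneg'
            · rw [← hid']
              change 0 < σ.hd c'.id
              have h1 := h.base.occ _ hc'
              rw [h.base.hd _ hc']
              cases hp : c'.pos with
              | nil => rw [hp] at hx; cases hx
              | cons z l =>
                have := (h1 z (Clause.mem_occs.2 (Or.inr (by simp [hp])))).1
                have := h.base.lt_lo
                rw [List.headD_cons]
                omega
          · exact h.fired c' hc' (hother c' hc' hneg' hid') x hx hox
        waiting := h.waiting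
        tr := h.tr
        lt_tr := h.lt_tr
        done := hdone }

/-- Treatment of all pending occurrences of `v`. -/
theorem Popping.loop (hv : v.1 ≤ 1) (hvd : Der R v) (h : Popping σ s lo base A R wb U ws v Y) :
    ∃ σ' U' ws' B, Iter (fun σ => σ.cur < σ.y) ((Program.instrs []).length + 1) popProg σ B σ' ∧
      Popping σ' s lo base A R wb U' ws' v Y ∧ CloseRel σ σ' s lo ∧
      U'.filter (fun x => σ'.atom x = v) = [] ∧ ¬ σ'.cur < σ'.y ∧
      σ'.q = σ.q ∧ σ'.tl = σ.tl ∧ σ'.ta = σ.ta ∧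
      B + 400 * U'.length + 300 * ws'.length ≤ 400 * U.length + 300 * ws.length := by
  generalize hl : U.filter (fun x => σ.atom x = v) = l
  induction l generalizing σ U ws with
  | nil =>
    refine ⟨σ, U, ws, 0, .refl _ _, h, .refl _ _ _, hl, ?_, rfl, rfl, rfl, by omega⟩
    have hc := h.base.chain v hv
    rw [hl, if_pos rfl] at hc
    have := h.base.base_le v
    have := h.cur
    have hy : σ.y = base v := hc
    omega
  | cons y l ih =>
    obtain ⟨ws₁, h₁, hrel₁, hws₁, hq₁, htl₁, hta₁⟩ := h.pop hv hl hvd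
    obtain ⟨hy, hyU, hyv, hsy, hfl, -⟩ := h.chain_pop hv hl
    have hat : σ.pop.atom = σ.atom := by funext x; simp [View.atom, hrel₁.inp]
    obtain ⟨σ', U', ws', B, hit, h', hrel, hnil, hlt, hq, htl, hta, hB⟩ :=
      ih h₁ (by rw [← hfl, hat])
    refine ⟨σ', U', ws', _, .step (by rw [h.cur, hy]; exact hsy) (vexec_pop σ) hit le_rfl, h',
      hrel₁.trans hrel, hnil, hlt, hq.trans hq₁, htl.trans htl₁, hta.trans hta₁, ?_⟩
    -- The 400 units released by the removed occurrence cover the round (50, and 2 for the test) and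
    -- the 300 units of the at most one new entry of the stack.
    have hlen : (U.filter (· ≠ y)).length + 1 = U.length := by
      have := List.length_erase_add_one hyU
      rwa [h.base.nodup.erase_eq_filter, show (fun x => x != y) = fun x => decide (x ≠ y) from
        funext fun x => by by_cases hx : x = y <;> simp [hx]] at this
    have h1 : (Program.instrs []).length = 1 := rfl
    omega

end Pop

theorem Base.congr_top {σ : View} {s lo : ℕ} {base top top' : ℕ × ℕ → ℕ} {A : List Clause}
    {U : List ℕ} (h : Base σ s lo base top A U) (ht : ∀ a, a.1 ≤ 1 → top' a = top a) :
    Base σ s lo base top' A U :=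
  { h with chain := fun a ha => by rw [ht a ha]; exact h.chain a ha }

/-! ### Unit propagation until the part of the stack that belongs to the block is empty. -/

section Derive

variable {σ : View} {s lo : ℕ} {base : ℕ × ℕ → ℕ} {A : List Clause} {R : Set Rule}
  {wb U ws : List ℕ} {X : Set (ℕ × ℕ)}

/-- The situation between two steps of the derivation at the end of a block. -/
abbrev Deriving (σ : View) (s lo : ℕ) (base : ℕ × ℕ → ℕ) (A : List Clause) (R : Set Rule)
    (wb U ws : List ℕ) (X : Set (ℕ × ℕ)) : Prop :=
  Work σ s lo base σ.top A R wb U ws X X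

/-- An abnormality letter of an inner block may be pushed when an inner clause fires late. It says
nothing about the letter of the same name in `s`, and the invariants count only entries with owner
at most `s`. -/
theorem Deriving.skip {z : ℕ} (h : Deriving σ s lo base A R wb U (z :: ws) X)
    (hz : s < σ.ow z) : Deriving σ.take s lo base A R wb U ws X := by
  have hne : ∀ z', z' ∈ z :: ws → σ.ow z' ≤ s → z' ∈ ws := by
    intro z' hz' ho
    rcases List.mem_cons.1 hz' with rfl | hz'
    · omega
    · exact hz'
  exact
  { base := h.base.congr le_rfl rfl rfl rfl rfl rfl rfl rfl
    rules := h.rules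
    cur := h.cur
    stack := h.stack.pop.2
    marked := h.marked
    der := h.der
    fired := fun c hc hn x hx ho => by
      rcases h.fired c hc hn x hx ho with h1 | ⟨z', hz', h1, h2⟩
      · exact Or.inl h1
      · exact Or.inr ⟨z', hne z' hz' h1, h1, h2⟩
    waiting := fun z' hz' => h.waiting z' (List.mem_cons_of_mem _ hz')
    tr := fun p hp => by
      rcases h.tr p hp with h1 | ⟨z', hz', h1, h2⟩
      · exact Or.inl h1
      · exact Or.inr ⟨z', hne z' hz' h1, h1, h2⟩
    lt_tr := h.lt_tr
    done := h.done }

theorem find_eq (σ : View) : σ.find = { σ with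
    tr := if σ.inp σ.q = 0 then update σ.tr (σ.inp (σ.q + 1)) σ.q else σ.tr,
    y := σ.top (σ.atom σ.q) } := by
  unfold View.find View.top View.atom
  by_cases h : σ.inp σ.q = 0 <;> simp [h]

theorem reset_eq (σ : View) : σ.reset = { σ with
    tl := if σ.inp σ.q = 0 then update σ.tl (σ.inp (σ.q + 1)) σ.y else σ.tl,
    ta := if σ.inp σ.q = 0 then σ.ta else update σ.ta (σ.inp (σ.q + 1)) σ.y } := by
  unfold View.reset
  by_cases h : σ.inp σ.q = 0 <;> simp [h]

theorem reset_top {σ : View} (hq : σ.inp σ.q ≤ 1) {a : ℕ × ℕ} (ha : a.1 ≤ 1) :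
    σ.reset.top a = if a = σ.atom σ.q then σ.y else σ.top a := by
  obtain ⟨t, p⟩ := a
  rw [reset_eq]
  unfold View.top View.atom
  have h : σ.inp σ.q = 0 ∨ σ.inp σ.q = 1 := by omega
  have ht : t = 0 ∨ t = 1 := by
    simp only at ha
    omega
  rcases h with h | h <;> rcases ht with rfl | rfl <;> simp [h, Function.update_apply]

theorem CloseRel.find (hi : s < σ.q) (hi' : σ.q ≤ σ.i) : CloseRel σ σ.find s lo := by
  rw [find_eq]
  constructor <;> try first | rfl | (intro p; exact Or.inr rfl)
  intro p
  by_cases h : σ.inp σ.q = 0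
  · by_cases hp : p = σ.inp (σ.q + 1)
    · left; simp [h, hp, hi, hi']
    · right; simp [h, hp]
  · right; simp [h]

theorem CloseRel.reset (σ : View) (s lo : ℕ) : CloseRel σ σ.reset s lo := by
  rw [reset_eq]
  constructor <;> first | rfl | (intro p; exact Or.inr rfl)

theorem CloseRel.take (σ : View) (s lo : ℕ) : CloseRel σ σ.take s lo := by
  constructor <;> first | rfl | (intro p; exact Or.inr rfl)

/-- The atom moves from the stack to the derived atoms before its occurrences are treated; this is
the reason for the two sets in `Work`, which differ by that atom. -/
theorem Deriving.find {z : ℕ} (h : Deriving σ s lo base A R wb U (z :: ws) X)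
    (hz : σ.ow z ≤ s) : Popping σ.take.find s lo base A R wb U ws (σ.atom z) X := by
  have hq : σ.take.q = z := h.stack.pop.1
  have hw := h.waiting z List.mem_cons_self
  have hf := find_eq σ.take
  have hat : σ.take.atom = σ.atom := rfl
  have htop : σ.take.top = σ.top := rfl
  rw [hq, hat, htop] at hf
  have hb : Base σ.take.find s lo base σ.top A U := by
    rw [hf]
    exact h.base.congr le_rfl rfl rfl rfl rfl rfl rfl rfl
  rw [hf] at hb ⊢
  have hne : ∀ z', z' ∈ z :: ws → ∀ a, a ≠ σ.atom z → σ.atom z' = a → z' ∈ ws := by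
    intro z' hz' a ha he
    rcases List.mem_cons.1 hz' with rfl | hz'
    · exact absurd he.symm ha
    · exact hz'
  exact
  { base := hb.congr_top fun a _ => by
      by_cases ha : a = σ.atom z
      · simp [ha]
      · simp only [if_neg ha]; rfl
    rules := h.rules
    cur := h.cur
    stack := h.stack.pop.2.congr rfl rfl
    marked := h.marked
    der := by
      rintro a (rfl | ha)
      · exact hw.2.2 hz
      · exact h.der a ha
    fired := fun c hc hn x hx ho => by
      by_cases hxa : σ.atom x = σ.atom z
      · exact Or.inl (Or.inl hxa)
      rcases h.fired c hc hn x hx ho with h1 | ⟨z', hz', h1, h2⟩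
      · exact Or.inl (Or.inr h1)
      · exact Or.inr ⟨z', hne z' hz' _ hxa h2, h1, h2⟩
    waiting := fun z' hz' => h.waiting z' (List.mem_cons_of_mem _ hz')
    tr := fun p hp => by
      by_cases hpa : (0, p) = σ.atom z
      · exact Or.inl (Or.inl hpa)
      have hp' : s < σ.tr p := by
        by_cases h0 : σ.inp z = 0
        · have hpz : p ≠ σ.inp (z + 1) := by
            rintro rfl
            exact hpa (by simp [View.atom, h0])
          simpa [View.take, h0, hpz] using hp
        · simpa [View.take, h0] using hp
      rcases h.tr p hp' with h1 | ⟨z', hz', h1, h2⟩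
      · exact Or.inl (Or.inr h1)
      · exact Or.inr ⟨z', hne z' hz' _ hpa h2, h1, h2⟩
    lt_tr := fun p hp => by
      have hsz := h.stack.lt z List.mem_cons_self
      by_cases h0 : σ.inp z = 0
      · by_cases hpz : p = σ.inp (z + 1)
        · simpa [View.take, h0, hpz] using hsz
        · have : (0, p) ∈ X := by
            rcases hp with hp | hp
            · simp [View.atom, hpz] at hp
            · exact hp
          simpa [View.take, h0, hpz] using h.lt_tr p this
      · have : (0, p) ∈ X := by
          rcases hp with hp | hp
          · simp [View.atom, Ne.symm h0] at hp
          · exact hp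
        simpa [View.take, h0] using h.lt_tr p this
    done := h.done }

/-- The 300 units of the removed entry pay for everything outside the inner loop. The remaining 100
pay for the test of the outer loop and make the potential decrease strictly, even when the stack
grows. -/
theorem Deriving.step {z : ℕ} (h : Deriving σ s lo base A R wb U (z :: ws) X) :
    ∃ σ' U' ws' X' B, VExec deriveProg σ B σ' ∧ Deriving σ' s lo base A R wb U' ws' X' ∧
      CloseRel σ σ' s lo ∧
      B + 100 + 400 * U'.length + 300 * ws'.length ≤ 400 * U.length + 300 * (ws.length + 1) := by
  have hq : σ.take.q = z := h.stack.pop.1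
  have hw := h.waiting z List.mem_cons_self
  have hl : (Program.instrs [Instr.load 9 5 7]).length = 1 := rfl
  have hl' : (Program.instrs []).length = 1 := rfl
  by_cases hz : σ.take.cur < σ.take.ow σ.take.q
  · refine ⟨σ.take, U, ws, X, _, (vexec_take σ).seq (.cond_true guard_owner hz (B := 1) ?_),
      h.skip (by rw [← h.cur, ← hq]; exact hz), .take _ _ _, ?_⟩
    · exact fun s hs => ⟨1, s, .instr .skip s, le_rfl, hs⟩
    · omega
  · have hz' : σ.ow z ≤ s := by rw [← h.cur, ← hq]; exact not_lt.1 hz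
    obtain ⟨σ₁, U', ws', B, hit, hp, hrel, hnil, hlt, hq₁, -, -, hB⟩ :=
      (h.find hz').loop hw.2.1 (hw.2.2 hz')
    have hq₂ : σ₁.q = z := by rw [hq₁, find_eq]; exact hq
    have hrel₂ : CloseRel σ σ₁ s lo :=
      ((CloseRel.take σ s lo).trans (.find (by rw [hq]; exact h.stack.lt z List.mem_cons_self)
        (by rw [hq]; exact hw.1.le))).trans hrel
    have hat : σ₁.atom σ₁.q = σ.atom z := by rw [hq₂]; simp [View.atom, hrel₂.inp]
    refine ⟨σ₁.reset, U', ws', insert (σ.atom z) X, _,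
      (vexec_take σ).seq (.cond_false guard_owner hz ((vexec_find _).seq
        ((hit.vexec guard_list hlt).seq (vexec_reset _)))), ?_,
      hrel₂.trans (.reset _ _ _), by omega⟩
    have hb : Base σ₁.reset s lo base σ₁.reset.top A U' := by
      have := (hp.base.congr_top (top' := σ₁.reset.top) fun a ha => by
        rw [reset_top (by rw [hq₂, hrel₂.inp]; exact hw.2.1) ha, hat])
      rw [reset_eq] at this ⊢
      exact this.congr le_rfl rfl rfl rfl rfl rfl rfl rfl
    have hdone : ∀ x ∈ U', σ₁.ow x ≤ s → σ₁.atom x ∉ insert (σ.atom z) X := by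
      rintro x hx ho (hx' | hx')
      · rw [List.filter_eq_nil_iff] at hnil
        exact hnil x hx (by simp [hx'])
      · exact hp.done x hx ho hx'
    rw [reset_eq] at hb ⊢
    exact
    { base := hb
      rules := hp.rules
      cur := hp.cur
      stack := hp.stack.congr rfl rfl
      marked := hp.marked
      der := hp.der
      fired := hp.fired
      waiting := hp.waiting
      tr := hp.tr
      lt_tr := hp.lt_tr
      done := hdone }

/-- By induction on the potential: each round lowers it by at least its own cost. -/
theorem Deriving.loop (h : Deriving σ s lo base A R wb U ws X) :
    ∃ σ' U' X' B, VExec deriveLoop σ B σ' ∧ Deriving σ' s lo base A R wb U' [] X' ∧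
      CloseRel σ σ' s lo ∧ B + 400 * U'.length ≤ 400 * U.length + 300 * ws.length + 5 := by
  have key : ∃ σ' U' X' B, Iter (fun σ => σ.cur < σ.wk σ.wp)
      ((Program.instrs [.load 9 10 5]).length + 1) deriveProg σ B σ' ∧
      Deriving σ' s lo base A R wb U' [] X' ∧
      CloseRel σ σ' s lo ∧ B + 400 * U'.length ≤ 400 * U.length + 300 * ws.length := by
    generalize hm : 400 * U.length + 300 * ws.length = m
    induction m using Nat.strong_induction_on generalizing σ U ws X with
    | _ m ih =>
      cases ws with
      | nil =>
        refine ⟨σ, U, X, 0, .refl _ _, h, .refl _ _ _, ?_⟩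
        simp only [List.length_nil] at hm
        omega
      | cons z ws =>
        obtain ⟨σ₁, U₁, ws₁, X₁, B₁, he, h₁, hrel₁, hB₁⟩ := h.step
        simp only [List.length_cons] at hm
        obtain ⟨σ₂, U₂, X₂, B₂, hit, h₂, hrel₂, hB₂⟩ := ih _ (by omega) h₁ rfl
        refine ⟨σ₂, U₂, X₂, _, .step ?_ he hit le_rfl, h₂, hrel₁.trans hrel₂, ?_⟩
        · rw [h.cur, h.stack.lt_iff]
          simp
        · have : (Program.instrs [Instr.load 9 10 5]).length = 1 := rfl
          omega
  obtain ⟨σ', U', X', B, hit, h', hrel, hB⟩ := key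
  refine ⟨σ', U', X', _, hit.vexec guard_derive ?_, h', hrel, ?_⟩
  · rw [h'.cur, h'.stack.lt_iff]
    simp
  · have : (Program.instrs [Instr.load 9 10 5]).length = 1 := rfl
    omega

/-- When the stack is empty, all consequences have been derived. -/
theorem Deriving.mem_iff (h : Deriving σ s lo base A R wb U [] X) (a : ℕ × ℕ) :
    a ∈ X ↔ Der R a := by
  refine ⟨h.der a, fun ha => ha.mem_of_closed ?_⟩
  -- An unmarked occurrence that counts in `s` is still listed, but no listed one carries an atom
  -- already treated. So the derived set is closed under the rules.
  have hmk : ∀ c ∈ A, ∀ y ∈ c.neg, σ.ow y ≤ s → σ.atom y ∈ X → σ.mrk y ≠ 0 := by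
    intro c hc y hy ho hX hm
    exact h.done y (h.base.unmarked c hc y (Clause.mem_occs.2 (Or.inl hy)) ho hm) ho hX
  have how : ∀ c ∈ A, ∀ y ∈ c.occs, c.own = s ∨ σ.inp y = 0 → σ.ow y ≤ s := by
    intro c hc y hy ho
    rw [(h.base.occ c hc y hy).2.2.2]
    split <;> omega
  have hfired : ∀ c ∈ A, (∀ y ∈ c.neg, σ.mrk y ≠ 0) → ∀ x ∈ c.pos, σ.ow x ≤ s → σ.atom x ∈ X := by
    intro c hc hn x hx ho
    simpa using h.fired c hc hn x hx ho
  intro B a hr hB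
  rw [← h.rules] at hr
  obtain ⟨c, hc, x, hx, rfl, ⟨ho, rfl⟩ | ⟨ho, h0, hab, rfl⟩⟩ := hr
  · refine hfired c hc (fun y hy => ?_) x hx (how c hc x (Clause.mem_occs.2 (Or.inr hx)) (.inl ho))
    exact hmk c hc y hy (how c hc y (Clause.mem_occs.2 (Or.inl hy)) (.inl ho)) (hB ⟨y, hy, rfl⟩)
  · refine hfired c hc (fun y hy => ?_) x hx (how c hc x (Clause.mem_occs.2 (Or.inr hx)) (.inr h0))
    by_cases hy0 : σ.inp y = 0
    · exact hmk c hc y hy (how c hc y (Clause.mem_occs.2 (Or.inl hy)) (.inr hy0))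
        (hB ⟨y, hy, hy0, rfl⟩)
    · exact hab y hy hy0

end Derive

/-! ### Words in the input -/

/-- The word `l` stands in the array `f` from the index `o` on. -/
def Txt (f : ℕ → ℕ) : ℕ → List ℕ → Prop
  | _, [] => True
  | o, a :: l => f o = a ∧ Txt f (o + 1) l

theorem txt_append {f : ℕ → ℕ} {o : ℕ} {l l' : List ℕ} :
    Txt f o (l ++ l') ↔ Txt f o l ∧ Txt f (o + l.length) l' := by
  induction l generalizing o with
  | nil => simp [Txt]
  | cons a l ih => simp [Txt, ih, and_assoc, Nat.add_assoc, Nat.add_comm 1]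

/-- The word of a list of letters. -/
def lettersCode (C : List ℕ) : List ℕ := C.flatMap fun p => [0, p]

theorem length_lettersCode (C : List ℕ) : (lettersCode C).length = 2 * C.length := by
  induction C with
  | nil => rfl
  | cons p C ih =>
    have : lettersCode (p :: C) = 0 :: p :: lettersCode C := rfl
    simp only [this, List.length_cons, ih]
    omega

theorem lettersCode_cons (p : ℕ) (C : List ℕ) :
    lettersCode (p :: C) = 0 :: p :: lettersCode C := rfl

theorem vexec_skip {C : List ℕ} {σ : View} (hC : Txt σ.inp σ.i (lettersCode C))
    (hend : σ.inp (σ.i + 2 * C.length) = 10) :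
    VExec skipProg σ (60 * C.length + 10) (σ.setI (σ.i + 2 * C.length)) := by
  have key : Iter (fun σ => σ.inp σ.i < 10)
      ((Program.instrs [.load 9 0 2, .const 10 10]).length + 1)
      (Program.instrs [.succ 2, .succ 2]) σ (60 * C.length) (σ.setI (σ.i + 2 * C.length)) := by
    induction C generalizing σ with
    | nil => exact .refl _ _
    | cons p C ih =>
      rw [lettersCode_cons] at hC
      simp only [List.length_cons] at hend ⊢
      have := ih (σ := σ.setI (σ.i + 2)) hC.2.2
        (by rw [← hend]; simp only [View.setI]; congr 1; omega)
      have he : (σ.setI (σ.i + 2)).setI ((σ.setI (σ.i + 2)).i + 2 * C.length) =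
          σ.setI (σ.i + 2 * (C.length + 1)) := by
        simp only [View.setI]; congr 1; omega
      rw [he] at this
      refine .step (by rw [hC.1]; omega) (vexec_succ_succ σ) this ?_
      have : (Program.instrs [.load 9 0 2, .const 10 10]).length = 2 := rfl
      omega
  refine (key.vexec (guard_pos 10) ?_).mono (by
    have : (Program.instrs [.load 9 0 2, .const 10 10]).length = 2 := rfl
    omega)
  simp only [View.setI]
  omega

/-! ### Invariants of the scan -/

/-- Beyond the current position nothing has been written. -/
structure Fresh (σ : View) : Prop where
  arr : ∀ x, σ.i ≤ x → σ.cn x = 0 ∧ σ.hd x = 0 ∧ σ.cl x = 0 ∧ σ.mrk x = 0 ∧ σ.ow x = 0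
  tr : ∀ p, σ.tr p ≤ σ.i
  top : ∀ v, σ.tl v ≤ σ.i ∧ σ.ta v ≤ σ.i
  stack : ∀ z ∈ stackOf σ.wk σ.wp, z ≤ σ.i
  zero : σ.wk 0 = 0 ∧ σ.cn 0 = 0 ∧ σ.hd 0 = 0

theorem Fresh.top_le {σ : View} (h : Fresh σ) (a : ℕ × ℕ) : σ.top a ≤ σ.i := by
  unfold View.top
  split
  · exact (h.top _).1
  · exact (h.top _).2

/-- Before the position `f` nothing changes. -/
structure Frame (σ σ' : View) (f : ℕ) : Prop where
  len : σ'.len = σ.len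
  j : σ'.j = σ.j
  m : σ'.m = σ.m
  inp : σ'.inp = σ.inp
  out : σ'.out = σ.out
  arr : ∀ x < f, σ'.nx x = σ.nx x ∧ σ'.ow x = σ.ow x ∧ σ'.cl x = σ.cl x ∧ σ'.cn x = σ.cn x ∧
    σ'.hd x = σ.hd x ∧ σ'.mrk x = σ.mrk x ∧ σ'.pa x = σ.pa x
  tr : ∀ p, σ'.tr p = σ.tr p ∨ f ≤ σ'.tr p

theorem Frame.refl (σ : View) (f : ℕ) : Frame σ σ f := by
  constructor <;> simp

theorem Frame.mono {σ σ' : View} {f f' : ℕ} (h : Frame σ σ' f) (hf : f' ≤ f) : Frame σ σ' f' :=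
  { h with
    arr := fun x hx => h.arr x (by omega)
    tr := fun p => (h.tr p).imp_right hf.trans }

theorem Frame.trans {σ₁ σ₂ σ₃ : View} {f : ℕ} (h₁ : Frame σ₁ σ₂ f) (h₂ : Frame σ₂ σ₃ f) :
    Frame σ₁ σ₃ f where
  len := h₂.len.trans h₁.len
  j := h₂.j.trans h₁.j
  m := h₂.m.trans h₁.m
  inp := h₂.inp.trans h₁.inp
  out := h₂.out.trans h₁.out
  arr x hx := by
    have := h₁.arr x hx
    have := h₂.arr x hx
    grind
  tr p := by
    have := h₁.tr p
    have := h₂.tr p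
    grind

theorem CloseRel.frame {σ σ' : View} {s lo : ℕ} (h : CloseRel σ σ' s lo) {f : ℕ} (hf : f ≤ lo)
    (hs : f ≤ s) : Frame σ σ' f where
  len := h.len
  j := h.j
  m := h.m
  inp := h.inp
  out := h.out
  arr x hx := by
    refine ⟨by rw [h.nx], by rw [h.ow], by rw [h.cl], ?_, by rw [h.hd], ?_, by rw [h.pa]⟩
    · exact (h.cn x).resolve_left (by omega)
    · exact (h.mrk x).resolve_left (by omega)
  tr p := (h.tr p).symm.imp_right fun h => by omega

/-- The situation while the block `s`, whose members begin at `lo`, is being read: `G` are the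
clauses read, `E` is the unfinished one, if any, `R` are the rules and `D` the letters derived in
child blocks. -/
structure Seg (σ : View) (s lo : ℕ) (base : ℕ × ℕ → ℕ) (wb : List ℕ) (E G : List Clause)
    (R : Set Rule) (U ws : List ℕ) (D : Set (ℕ × ℕ)) : Prop where
  base : Base σ s lo base σ.top (E ++ G) U
  fresh : Fresh σ
  id_lt : ∀ c ∈ G, c.id < σ.i
  rules : rulesOf σ s G = R
  cur : σ.cur = s
  stack : Stack σ s ws wb
  marked : ∀ c ∈ E ++ G, ∀ y ∈ c.occs, σ.ow y ≤ s → σ.mrk y ≠ 0 → σ.atom y ∈ D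
  fired : ∀ c ∈ G, (∀ y ∈ c.neg, σ.mrk y ≠ 0) → ∀ x ∈ c.pos, σ.ow x ≤ s →
    σ.atom x ∈ D ∨ ∃ z ∈ ws, σ.ow z ≤ s ∧ σ.atom z = σ.atom x
  waiting : ∀ z ∈ ws, z < σ.i ∧ σ.inp z ≤ 1 ∧ σ.ow z ≤ s ∧ Der R (σ.atom z)
  tr : ∀ p, s < σ.tr p ↔ (0, p) ∈ D
  der : ∀ a ∈ D, a.1 = 0 ∧ Der R a

/-! ### The end of a block -/

/-- The place of a letter in the list of described letters serves as its occurrence on the stack.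
The 400 units for each described letter include the 300 for its possible entry. -/
theorem vexec_collectLoop {σ : View} {s : ℕ} {C ws wb : List ℕ} (hcur : σ.cur = s)
    (hs : s < σ.q) (hC : Txt σ.inp σ.q (lettersCode C)) (hend : σ.inp (σ.q + 2 * C.length) = 10)
    (hst : Stack σ s ws wb) :
    ∃ wp wk q qs B, VExec collectLoop σ B { σ with wp := wp, wk := wk, q := q } ∧
      Stack { σ with wp := wp, wk := wk, q := q } s (qs ++ ws) wb ∧
      (∀ z ∈ qs, σ.q ≤ z ∧ z < σ.q + 2 * C.length ∧ σ.inp z = 0 ∧ s < σ.tr (σ.inp (z + 1))) ∧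
      (∀ p ∈ C, s < σ.tr p → ∃ z ∈ qs, σ.atom z = (0, p)) ∧
      B + 300 * qs.length ≤ 400 * C.length + 10 := by
  have hl : (Program.instrs [.load 9 0 7, .const 10 10]).length = 2 := rfl
  suffices key : ∃ wp wk q qs B, Iter (fun σ => σ.inp σ.q < 10)
      ((Program.instrs [.load 9 0 7, .const 10 10]).length + 1) collectProg σ B
        { σ with wp := wp, wk := wk, q := q } ∧ σ.inp q = 10 ∧
      Stack { σ with wp := wp, wk := wk, q := q } s (qs ++ ws) wb ∧
      (∀ z ∈ qs, σ.q ≤ z ∧ z < σ.q + 2 * C.length ∧ σ.inp z = 0 ∧ s < σ.tr (σ.inp (z + 1))) ∧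
      (∀ p ∈ C, s < σ.tr p → ∃ z ∈ qs, σ.atom z = (0, p)) ∧
      B + 300 * qs.length ≤ 400 * C.length by
    obtain ⟨wp, wk, q, qs, B, hit, hq, h₁, h₂, h₃, hB⟩ := key
    exact ⟨wp, wk, q, qs, _, hit.vexec guard_collect (by simp [hq]), h₁, h₂, h₃, by omega⟩
  induction C generalizing σ ws with
  | nil =>
    exact ⟨σ.wp, σ.wk, σ.q, [], 0, .refl _ _, by simpa using hend, hst, by simp, by simp, by simp⟩
  | cons p C ih =>
    rw [lettersCode_cons] at hC
    obtain ⟨h0, hp, hC⟩ := hC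
    have he : σ.inp (σ.q + 2 + 2 * C.length) = 10 := by
      rw [← hend, List.length_cons]; congr 1; omega
    by_cases hlt : s < σ.tr p
    · have hcol : σ.collect = { σ with
          wp := σ.wp + 1, wk := update σ.wk (σ.wp + 1) σ.q, q := σ.q + 2 } := by
        rw [View.collect, hp, hcur, if_pos hlt]
      have hst' : Stack σ.collect s (σ.q :: ws) wb := by
        rw [hcol]
        exact hst.push hs rfl rfl
      have hve := vexec_collect σ
      rw [hcol] at hst' hve
      obtain ⟨wp, wk, q, qs, B, hit, hq, h₁, h₂, h₃, hB⟩ :=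
        ih (σ := { σ with wp := σ.wp + 1, wk := update σ.wk (σ.wp + 1) σ.q, q := σ.q + 2 })
          hcur (by simp only; omega) hC he hst'
      refine ⟨wp, wk, q, qs ++ [σ.q], _, .step (by rw [h0]; omega) hve hit le_rfl, hq,
        by simpa using h₁, ?_, ?_, ?_⟩
      · intro z hz
        rcases List.mem_append.1 hz with hz | hz
        · have := h₂ z hz
          simp only [List.length_cons] at this ⊢
          exact ⟨by omega, by omega, this.2.2⟩
        · rw [List.mem_singleton] at hz
          subst hz
          simp only [List.length_cons]
          exact ⟨le_rfl, by omega, h0, by rw [hp]; exact hlt⟩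
      · intro p' hp' hlt'
        rcases List.mem_cons.1 hp' with rfl | hp'
        · exact ⟨σ.q, by simp, by simp [View.atom, h0, hp]⟩
        · obtain ⟨z, hz, hz'⟩ := h₃ p' hp' hlt'
          exact ⟨z, by simp [hz], hz'⟩
      · simp only [List.length_append, List.length_cons, List.length_nil]
        omega
    · have hcol : σ.collect = { σ with q := σ.q + 2 } := by
        rw [View.collect, hp, hcur, if_neg hlt]
      have hve := vexec_collect σ
      rw [hcol] at hve
      obtain ⟨wp, wk, q, qs, B, hit, hq, h₁, h₂, h₃, hB⟩ :=
        ih (σ := { σ with q := σ.q + 2 }) hcur (by simp only; omega) hC he (hst.congr rfl rfl)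
      refine ⟨wp, wk, q, qs, _, .step (by rw [h0]; omega) hve hit le_rfl, hq, h₁, ?_, ?_, ?_⟩
      · intro z hz
        have := h₂ z hz
        simp only [List.length_cons] at this ⊢
        exact ⟨by omega, by omega, this.2.2⟩
      · intro p' hp' hlt'
        rcases List.mem_cons.1 hp' with rfl | hp'
        · exact absurd hlt' hlt
        · exact h₃ p' hp' hlt'
      · simp only [List.length_cons]
        omega

section Close

variable {σ : View} {s lo : ℕ} {base : ℕ × ℕ → ℕ} {G : List Clause} {R : Set Rule}
  {wb U ws C : List ℕ} {D : Set (ℕ × ℕ)}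

/-- The propagation starts from the empty set: letters already derived in child blocks are pushed
once more, because their occurrences in this block outside the children have not been treated. They
can all be found, since by `hmem` every derivable letter is described. -/
theorem Seg.close (h : Seg σ s lo base wb [] G R U ws D)
    (hC : Txt σ.inp (s + 1) (lettersCode C)) (hend : σ.inp (s + 1 + 2 * C.length) = 10)
    (hlo : lo = s + 1 + 2 * C.length + 1) (hlt : lo ≤ σ.i)
    (hmem : ∀ a, Der R a → a.1 = 0 → a.2 ∈ C) (how : ∀ x, s < x → x < lo → σ.ow x = 0) :
    ∃ σ' U' B, VExec (.all [.instrs [.copy 7 3, .succ 7], collectLoop, deriveLoop,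
        .instrs [.load 3 12 3, .succ 2]]) σ B σ'.closeBlock ∧
      Deriving σ' s lo base G R wb U' [] {a | Der R a} ∧ CloseRel σ σ' s lo ∧
      B + 400 * U'.length ≤ 400 * U.length + 300 * ws.length + 400 * C.length + 200 := by
  have hcur := h.cur
  obtain ⟨wp, wk, q, qs, B₁, he₁, hst, hqs, hCq, hB₁⟩ :=
    vexec_collectLoop (σ := σ.setQ (σ.cur + 1)) (C := C) (ws := ws) (wb := wb) h.cur
      (by simp only [View.setQ]; omega) (by simpa only [View.setQ, hcur] using hC)
      (by simpa only [View.setQ, hcur] using hend) (h.stack.congr rfl rfl)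
  simp only [View.setQ, hcur] at hqs hCq
  have hrel₁ : CloseRel σ { σ.setQ (σ.cur + 1) with wp := wp, wk := wk, q := q } s lo := by
    constructor <;> first | rfl | (intro p; exact Or.inr rfl)
  have hD : ∀ a ∈ D, ∃ z ∈ qs, σ.ow z ≤ s ∧ σ.atom z = a := by
    rintro ⟨t, p⟩ ha
    obtain ⟨h0, hd⟩ := h.der _ ha
    simp only at h0
    subst h0
    obtain ⟨z, hz, hz'⟩ := hCq p (hmem _ hd rfl) ((h.tr p).2 ha)
    have := hqs z hz
    refine ⟨z, hz, ?_, hz'⟩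
    -- The positions of described letters are never entered as occurrences and keep the default
    -- owner `0`, which is right for letters.
    rw [how z (by omega) (by omega)]
    omega
  have hder : Deriving { σ.setQ (σ.cur + 1) with wp := wp, wk := wk, q := q } s lo base G R wb U
      (qs ++ ws) ∅ :=
    { base := h.base.congr le_rfl rfl rfl rfl rfl rfl rfl rfl
      rules := h.rules
      cur := h.cur
      stack := hst
      marked := fun c hc y hy ho hm => (h.der _ (h.marked c hc y hy ho hm)).2
      der := fun a ha => ha.elim
      fired := fun c hc hn x hx ho => by
        right
        rcases h.fired c hc hn x hx ho with h1 | ⟨z, hz, h1⟩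
        · obtain ⟨z, hz, h1⟩ := hD _ h1
          exact ⟨z, List.mem_append_left _ hz, h1⟩
        · exact ⟨z, List.mem_append_right _ hz, h1⟩
      waiting := fun z hz => by
        rcases List.mem_append.1 hz with hz | hz
        · have h1 := hqs z hz
          refine ⟨by simp only [View.setQ]; omega, ?_, fun _ => ?_⟩
          · change σ.inp z ≤ 1
            omega
          · have h2 := (h.der _ ((h.tr _).1 h1.2.2.2)).2
            rwa [← h1.2.2.1] at h2
        · have := h.waiting z hz
          exact ⟨this.1, this.2.1, fun _ => this.2.2.2⟩
      tr := fun p hp => by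
        right
        obtain ⟨z, hz, h1⟩ := hD _ ((h.tr p).1 hp)
        exact ⟨z, List.mem_append_left _ hz, h1⟩
      lt_tr := fun p hp => hp.elim
      done := fun x _ _ hx => hx.elim }
  obtain ⟨σ', U', X', B₂, he₂, hd, hrel₂, hB₂⟩ := hder.loop
  have hX : X' = {a | Der R a} := Set.ext fun a => hd.mem_iff a
  subst hX
  refine ⟨σ', U', _, (vexec_setQ σ).seq (he₁.seq (he₂.seq (vexec_closeBlock σ'))), hd,
    hrel₁.trans hrel₂, ?_⟩
  simp only [List.length_append] at hB₂
  omega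

/-- The rules of a finished block, seen from the parent block. -/
theorem Deriving.rulesOf_eq {s₀ : ℕ} (h : Deriving σ s lo base G R wb U [] {a | Der R a})
    (hs : s₀ < s) : rulesOf σ s₀ G = proj R := by
  have hocc : ∀ c ∈ G, ∀ y ∈ c.neg, σ.inp y ≤ 1 ∧ σ.ow y = if σ.inp y = 0 then 0 else c.own :=
    fun c hc y hy => (h.base.occ c hc y (Clause.mem_occs.2 (Or.inl hy))).2.2
  ext ⟨B, a⟩
  constructor
  · rintro ⟨c, hc, x, hx, rfl, ⟨ho, -⟩ | ⟨-, h0, hab, rfl⟩⟩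
    · have := h.base.own_le c hc
      omega
    · by_cases ho : c.own = s
      · refine ⟨{a | ∃ y ∈ c.neg, σ.atom y = a}, ?_, h0, ?_, ?_⟩
        · rw [← h.rules]
          exact ⟨c, hc, x, hx, rfl, Or.inl ⟨ho, rfl⟩⟩
        · ext b
          constructor
          · rintro ⟨y, hy, hy0, rfl⟩
            exact ⟨⟨y, hy, rfl⟩, hy0⟩
          · rintro ⟨⟨y, hy, rfl⟩, hy0⟩
            exact ⟨y, hy, hy0, rfl⟩
        · rintro b ⟨y, hy, rfl⟩ hb
          -- Marks are sound: a marked abnormality premise is derivable in the block.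
          refine h.marked c hc y (Clause.mem_occs.2 (Or.inl hy)) ?_ (hab y hy hb)
          rw [(hocc c hc y hy).2]
          split <;> omega
      · refine ⟨{a | ∃ y ∈ c.neg, σ.inp y = 0 ∧ σ.atom y = a}, ?_, h0, ?_, ?_⟩
        · rw [← h.rules]
          exact ⟨c, hc, x, hx, rfl, Or.inr ⟨ho, h0, hab, rfl⟩⟩
        · ext b
          constructor
          · rintro ⟨y, hy, hy0, rfl⟩
            exact ⟨⟨y, hy, hy0, rfl⟩, hy0⟩
          · exact fun hb => hb.1
        · rintro b ⟨y, hy, hy0, rfl⟩ hb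
          exact absurd hy0 hb
  · rintro ⟨B', hB', h0, hB, hab⟩
    simp only at hB hB' h0
    subst hB
    rw [← h.rules] at hB'
    obtain ⟨c, hc, x, hx, rfl, ⟨ho, hB⟩ | ⟨ho, -, hm, hB⟩⟩ := hB' <;> simp only at hB <;> subst hB
    · refine ⟨c, hc, x, hx, rfl, Or.inr ⟨by omega, h0, fun y hy hy0 hm => ?_, ?_⟩⟩
      · have hd := hab _ ⟨y, hy, rfl⟩ hy0
        have hos : σ.ow y ≤ s := by
          rw [(hocc c hc y hy).2]
          split <;> omega
        -- Marks are complete: an unmarked premise would still be listed, and no listed occurrence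
        -- carries a derived atom.
        exact h.done y (h.base.unmarked c hc y (Clause.mem_occs.2 (Or.inl hy)) hos hm) hos hd
      · ext b
        constructor
        · rintro ⟨⟨y, hy, rfl⟩, hy0⟩
          exact ⟨y, hy, hy0, rfl⟩
        · rintro ⟨y, hy, hy0, rfl⟩
          exact ⟨⟨y, hy, rfl⟩, hy0⟩
    · have := h.base.own_le c hc
      refine ⟨c, hc, x, hx, rfl, Or.inr ⟨by omega, h0, hm, ?_⟩⟩
      ext b
      constructor
      · exact fun hb => hb.1
      · rintro ⟨y, hy, hy0, rfl⟩
        exact ⟨⟨y, hy, hy0, rfl⟩, hy0⟩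

/-- A finished block becomes part of the parent block. -/
theorem Seg.merge {σ₀ : View} {s₀ lo₀ : ℕ} {base₀ : ℕ × ℕ → ℕ} {wb₀ U₀ ws₀ : List ℕ}
    {G₀ : List Clause} {R₀ : Set Rule} {D₀ : Set (ℕ × ℕ)}
    (h₀ : Seg σ₀ s₀ lo₀ base₀ wb₀ [] G₀ R₀ U₀ ws₀ D₀)
    (h : Deriving σ σ₀.i lo σ₀.top G R (ws₀ ++ wb₀) U [] {a | Der R a})
    (hframe : Frame σ₀ σ σ₀.i) (hfresh : Fresh σ.closeBlock) (hpa : σ.pa σ₀.i = s₀)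
    (hs : s₀ < σ₀.i) (hlo : lo₀ ≤ lo) (hi : lo ≤ σ.i) (htr : ∀ p, σ.tr p = σ₀.tr p ∨ σ₀.i < σ.tr p) :
    Seg σ.closeBlock s₀ lo₀ base₀ wb₀ [] (G ++ G₀) (R₀ ∪ proj R) (U ++ U₀) ws₀
      (D₀ ∪ {a | a.1 = 0 ∧ Der R a}) := by
  have hat : σ.atom = σ₀.atom := by funext x; simp [View.atom, hframe.inp]
  have hat' : σ.closeBlock.atom = σ₀.atom := hat
  have hinp : σ.closeBlock.inp = σ₀.inp := hframe.inp
  have hlt := h.base.lt_lo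
  have hocc₀ : ∀ c ∈ G₀, ∀ y ∈ c.occs, y < σ₀.i := fun c hc y hy =>
    (h₀.base.occ c hc y hy).2.1
  have hneg : ∀ {c : Clause} {y : ℕ}, y ∈ c.neg → y ∈ c.occs := fun hy =>
    Clause.mem_occs.2 (Or.inl hy)
  have hU₀ : ∀ x ∈ U₀, x < σ₀.i := fun x hx => by
    obtain ⟨-, c, hc, hy⟩ := h₀.base.pending x hx
    exact hocc₀ c hc x hy
  have hU : ∀ x ∈ U, lo ≤ x := fun x hx => by
    obtain ⟨-, c, hc, hy⟩ := h.base.pending x hx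
    exact (h.base.occ c hc x hy).1
  -- occurrences of the block that matter to the parent are occurrences of letters
  have hlet : ∀ c ∈ G, ∀ y ∈ c.occs, σ.ow y ≤ s₀ → σ.inp y = 0 ∧ σ.ow y ≤ σ₀.i := by
    intro c hc y hy ho
    refine ⟨?_, by omega⟩
    by_contra h0
    have := (h.base.occ c hc y hy).2.2.2
    rw [if_neg h0] at this
    have := h.base.own_le c hc
    omega
  refine
  { base := ?_
    fresh := hfresh
    id_lt := ?_
    rules := ?_
    cur := hpa ▸ congrArg σ.pa h.cur
    stack := ?_
    marked := ?_
    fired := ?_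
    waiting := ?_
    tr := ?_
    der := ?_ }
  · rw [List.nil_append]
    refine
    { chain := fun a ha => ?_
      nodup := ?_
      base_le := h₀.base.base_le
      lt_lo := h₀.base.lt_lo
      pending := ?_
      ids := ?_
      id_le := ?_
      own_le := ?_
      occ := ?_
      cl_neg := ?_
      cl_pos := ?_
      hd := ?_
      cn := ?_
      neg_nodup := ?_
      pos_eq := ?_
      unmarked := ?_
      zero := h.base.zero }
    · rw [List.filter_append]
      -- The child's list ends where the parent's began when the child was opened, so together they
      -- are one list of the parent.
      refine Chain.append (e := σ₀.top a) ?_ ?_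
      · exact h.base.chain a ha
      · rw [hat']
        refine (h₀.base.chain a ha).congr fun x hx => ?_
        exact (hframe.arr x (hU₀ x (List.mem_of_mem_filter hx))).1
    · refine List.nodup_append.2 ⟨h.base.nodup, h₀.base.nodup, fun x hx y hy => ?_⟩
      have := hU x hx
      have := hU₀ y hy
      omega
    · intro x hx
      rcases List.mem_append.1 hx with hx | hx
      · obtain ⟨h1, c, hc, h2⟩ := h.base.pending x hx
        exact ⟨h1, c, List.mem_append_left _ hc, h2⟩
      · obtain ⟨h1, c, hc, h2⟩ := h₀.base.pending x hx
        exact ⟨(hframe.arr x (hU₀ x hx)).2.2.2.2.2.1.trans h1, c, List.mem_append_right _ hc, h2⟩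
    · intro c hc c' hc' hid
      rcases List.mem_append.1 hc with hc | hc <;> rcases List.mem_append.1 hc' with hc' | hc'
      · exact h.base.ids c hc c' hc' hid
      · have := h.base.id_le c hc
        have := h₀.id_lt c' hc'
        omega
      · have := (h₀.base.id_le c hc).2
        have := h.base.id_le c' hc'
        omega
      · exact h₀.base.ids c hc c' hc' hid
    · intro c hc
      change _ ∧ c.id ≤ σ.i + 1
      rcases List.mem_append.1 hc with hc | hc
      · have := h.base.id_le c hc
        omega
      · have h1 := h₀.base.id_le c hc
        omega
    · intro c hc
      rcases List.mem_append.1 hc with hc | hc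
      · exact (hs.trans_le (h.base.own_le c hc)).le
      · exact h₀.base.own_le c hc
    · intro c hc y hy
      change lo₀ ≤ y ∧ y < σ.i + 1 ∧ σ.inp y ≤ 1 ∧ σ.ow y = if σ.inp y = 0 then 0 else c.own
      rcases List.mem_append.1 hc with hc | hc
      · have h1 := h.base.occ c hc y hy
        exact ⟨by omega, by omega, h1.2.2⟩
      · have h1 := h₀.base.occ c hc y hy
        rw [(hframe.arr y h1.2.1).2.1, hframe.inp]
        exact ⟨h1.1, by omega, h1.2.2⟩
    · intro c hc y hy
      rcases List.mem_append.1 hc with hc | hc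
      · exact h.base.cl_neg c hc y hy
      · exact (hframe.arr y (hocc₀ c hc y (hneg hy))).2.2.1.trans (h₀.base.cl_neg c hc y hy)
    · intro c hc y hy
      rcases List.mem_append.1 hc with hc | hc
      · exact h.base.cl_pos c hc y hy
      · exact (hframe.arr y (hocc₀ c hc y (Clause.mem_occs.2 (Or.inr hy)))).2.2.1.trans
          (h₀.base.cl_pos c hc y hy)
    · intro c hc
      rcases List.mem_append.1 hc with hc | hc
      · exact h.base.hd c hc
      · exact (hframe.arr c.id (h₀.id_lt c hc)).2.2.2.2.1.trans (h₀.base.hd c hc)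
    · intro c hc
      rcases List.mem_append.1 hc with hc | hc
      · exact h.base.cn c hc
      · refine ((hframe.arr c.id (h₀.id_lt c hc)).2.2.2.1.trans (h₀.base.cn c hc)).trans ?_
        congr 1
        refine List.filter_congr fun y hy => ?_
        change decide (σ₀.mrk y = 0) = decide (σ.mrk y = 0)
        rw [(hframe.arr y (hocc₀ c hc y (hneg hy))).2.2.2.2.2.1]
    · intro c hc
      rcases List.mem_append.1 hc with hc | hc
      · exact h.base.neg_nodup c hc
      · exact h₀.base.neg_nodup c hc
    · intro c hc
      rcases List.mem_append.1 hc with hc | hc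
      · exact h.base.pos_eq c hc
      · rw [hat']
        exact h₀.base.pos_eq c hc
    · intro c hc y hy ho hm
      change σ.ow y ≤ s₀ at ho
      change σ.mrk y = 0 at hm
      rcases List.mem_append.1 hc with hc | hc
      · exact List.mem_append_left _ (h.base.unmarked c hc y hy (hlet c hc y hy ho).2 hm)
      · have h1 := hframe.arr y (hocc₀ c hc y hy)
        rw [h1.2.1] at ho
        rw [h1.2.2.2.2.2.1] at hm
        exact List.mem_append_right _ (h₀.base.unmarked c hc y hy ho hm)
  · intro c hc
    change c.id < σ.i + 1
    rcases List.mem_append.1 hc with hc | hc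
    · have := (h.base.id_le c hc).2
      omega
    · have := h₀.id_lt c hc
      omega
  · have h1 : rulesOf σ.closeBlock s₀ G = proj R := h.rulesOf_eq hs
    have h2 : rulesOf σ.closeBlock s₀ G₀ = R₀ := by
      rw [← h₀.rules]
      refine rulesOf_congr hinp fun c hc _ y hy _ => ?_
      exact (hframe.arr y (hocc₀ c hc y (hneg hy))).2.2.2.2.2.1
    rw [← h1, ← h2]
    ext r
    simp only [rulesOf, List.mem_append, Set.mem_ofPred_eq, Set.mem_union]
    grind
  · refine ⟨?_, h.stack.zero, h₀.stack.lt, h₀.stack.le⟩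
    exact h.stack.eq
  · intro c hc y hy ho hm
    rw [List.nil_append] at hc
    change σ.ow y ≤ s₀ at ho
    change σ.mrk y ≠ 0 at hm
    rcases List.mem_append.1 hc with hc | hc
    · have h1 := hlet c hc y hy ho
      exact Or.inr ⟨h1.1, h.marked c hc y hy h1.2 hm⟩
    · have h1 := hframe.arr y (hocc₀ c hc y hy)
      rw [h1.2.1] at ho
      rw [h1.2.2.2.2.2.1] at hm
      rw [hat']
      exact Or.inl (h₀.marked c hc y hy ho hm)
  · intro c hc hn x hx ho
    change σ.ow x ≤ s₀ at ho
    have hxo := Clause.mem_occs.2 (Or.inr hx : x ∈ c.neg ∨ x ∈ c.pos)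
    rcases List.mem_append.1 hc with hc | hc
    · have h1 := hlet c hc x hxo ho
      rcases h.fired c hc hn x hx h1.2 with h2 | ⟨z, hz, -⟩
      · exact Or.inl (Or.inr ⟨h1.1, h2⟩)
      · cases hz
    · have h1 := hframe.arr x (hocc₀ c hc x hxo)
      rw [h1.2.1] at ho
      rw [hat']
      have hn' : ∀ y ∈ c.neg, σ₀.mrk y ≠ 0 := fun y hy => by
        rw [← (hframe.arr y (hocc₀ c hc y (hneg hy))).2.2.2.2.2.1]
        exact hn y hy
      rcases h₀.fired c hc hn' x hx ho with h2 | ⟨z, hz, h2, h3⟩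
      · exact Or.inl (Or.inl h2)
      · refine Or.inr ⟨z, hz, ?_, h3⟩
        exact (hframe.arr z (h₀.waiting z hz).1).2.1.trans_le h2
  · intro z hz
    have h1 := h₀.waiting z hz
    rw [hinp, hat']
    refine ⟨?_, h1.2.1, (hframe.arr z h1.1).2.1.trans_le h1.2.2.1,
      h1.2.2.2.mono Set.subset_union_left⟩
    change z < σ.i + 1
    omega
  · intro p
    -- A letter derived in the child has its latest derivation after the child's brace, other
    -- letters keep their old entry; so comparison with the parent's brace tells what any child has
    -- derived.
    have h1 : σ₀.i < σ.tr p ↔ Der R (0, p) := by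
      constructor
      · intro hp
        rcases h.tr p hp with h1 | ⟨z, hz, -⟩
        · exact h1
        · cases hz
      · exact fun hp => h.lt_tr p hp
    have h2 := h₀.tr p
    have h3 := htr p
    have h4 := h₀.fresh.tr p
    change s₀ < σ.tr p ↔ (0, p) ∈ D₀ ∨ (0 = 0 ∧ Der R (0, p))
    rw [← h1, ← h2]
    omega
  · rintro a (ha | ⟨h0, ha⟩)
    · exact ⟨(h₀.der a ha).1, (h₀.der a ha).2.mono Set.subset_union_left⟩
    · exact ⟨h0, ((der_proj h0).2 ha).mono Set.subset_union_right⟩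

/-- The end of a block keeps the invariant about the rest of the input. -/
theorem Deriving.fresh {σ₁ : View} (h : Deriving σ s lo base G R wb U [] {a | Der R a})
    (h₁ : Fresh σ₁) (hrel : CloseRel σ₁ σ s lo) (hs : s ≤ σ.i) : Fresh σ.closeBlock := by
  have hi := hrel.i
  have hU : ∀ x ∈ U, x < σ.i := fun x hx => by
    obtain ⟨-, c, hc, hy⟩ := h.base.pending x hx
    exact (h.base.occ c hc x hy).2.1
  have htop : ∀ a : ℕ × ℕ, a.1 ≤ 1 → σ.top a ≤ σ.i := by
    intro a ha
    rcases (h.base.chain a ha).head_mem with h1 | h1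
    · have := h.base.base_le a
      omega
    · exact (hU _ (List.mem_of_mem_filter h1)).le
  constructor
  · intro x hx
    change σ.i + 1 ≤ x at hx
    have h2 := h₁.arr x (by omega)
    have h3 := (hrel.mrk x).resolve_left (by omega)
    have h4 := (hrel.cn x).resolve_left (by omega)
    change σ.cn x = 0 ∧ σ.hd x = 0 ∧ σ.cl x = 0 ∧ σ.mrk x = 0 ∧ σ.ow x = 0
    rw [h3, h4, hrel.hd, hrel.cl, hrel.ow]
    exact h2
  · intro p
    change σ.tr p ≤ σ.i + 1
    have h2 := hrel.tr p
    have h3 := h₁.tr p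
    omega
  · intro v
    have h2 := htop (0, v) (by simp)
    have h3 := htop (1, v) (by simp)
    simp only [View.top, if_pos] at h2
    simp only [View.top, one_ne_zero, if_false] at h3
    change σ.tl v ≤ σ.i + 1 ∧ σ.ta v ≤ σ.i + 1
    omega
  · intro z hz
    change z ≤ σ.i + 1
    have h2 := h.stack.le z
    have h3 : z ∈ wb := by
      have := h.stack.eq
      rw [List.nil_append] at this
      rw [← this]
      exact hz
    have := h2 h3
    omega
  · exact ⟨h.stack.zero, h.base.zero⟩

end Close

/-! ### Reading formulas -/

theorem mem_cons_of_mem_append {α : Type*} {a b : α} {l : List α} (h : a ∈ [b] ++ l) :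
    a = b ∨ a ∈ l := by simpa using h

section Read

variable {σ σ' : View} {s lo x : ℕ} {base : ℕ × ℕ → ℕ} {c c' : Clause} {G : List Clause}
  {R : Set Rule} {wb U ws : List ℕ} {D : Set (ℕ × ℕ)}

theorem Seg.lt_of_mem {E : List Clause} (h : Seg σ s lo base wb E G R U ws D) {y : ℕ}
    (hy : y ∈ U) : y < σ.i := by
  obtain ⟨-, c, hc, hy⟩ := h.base.pending y hy
  exact (h.base.occ c hc y hy).2.1

theorem Fresh.setI (h : Fresh σ) {i : ℕ} (hi : σ.i ≤ i) : Fresh (σ.setI i) where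
  arr x hx := h.arr x (hi.trans hx)
  tr p := (h.tr p).trans hi
  top v := ⟨(h.top v).1.trans hi, (h.top v).2.trans hi⟩
  stack z hz := (h.stack z hz).trans hi
  zero := h.zero

theorem Seg.setI {E : List Clause} (h : Seg σ s lo base wb E G R U ws D) {i : ℕ}
    (hi : σ.i ≤ i) : Seg (σ.setI i) s lo base wb E G R U ws D :=
  { h with
    base := h.base.congr hi rfl rfl rfl rfl rfl rfl rfl
    fresh := h.fresh.setI hi
    id_lt := fun c hc => (h.id_lt c hc).trans_le hi
    waiting := fun z hz => ⟨(h.waiting z hz).1.trans_le hi, (h.waiting z hz).2⟩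
    stack := h.stack.congr rfl rfl }

/-- The clause `c` is being read. -/
structure Reading (σ : View) (s lo : ℕ) (base : ℕ × ℕ → ℕ) (wb : List ℕ) (c : Clause)
    (G : List Clause) (R : Set Rule) (U ws : List ℕ) (D : Set (ℕ × ℕ)) : Prop extends
    Seg σ s lo base wb [c] G R U ws D where
  c_eq : σ.c = c.id
  own : c.own = s
  ne : ∀ d ∈ G, d.id ≠ c.id

/-- A literal at the position `x` is added to the unfinished clause. -/
theorem Reading.addOcc (h : Reading σ s lo base wb c G R U ws D) (hx : σ.i ≤ x)
    (hinp : σ.inp x ≤ 1)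
    (hcase : (σ' = ((σ.occ x).addNeg x).setI (x + 2) ∧ c' = { c with neg := x :: c.neg }) ∨
      (σ' = ((σ.occ x).addPos x).setI (x + 2) ∧ c' = { c with pos := x :: c.pos } ∧
        ∀ y ∈ c.pos, σ.atom y = σ.atom x)) :
    Reading σ' s lo base wb c' G R (x :: U) ws D ∧ ∀ f ≤ c.id, Frame σ σ' f := by
  have hi : σ'.i = x + 2 := by rcases hcase with ⟨rfl, -⟩ | ⟨rfl, -⟩ <;> rfl
  have hin : σ'.inp = σ.inp := by rcases hcase with ⟨rfl, -⟩ | ⟨rfl, -⟩ <;> rfl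
  have hmrk : σ'.mrk = σ.mrk := by rcases hcase with ⟨rfl, -⟩ | ⟨rfl, -⟩ <;> rfl
  have hcur : σ'.cur = σ.cur := by rcases hcase with ⟨rfl, -⟩ | ⟨rfl, -⟩ <;> rfl
  have hwp : σ'.wp = σ.wp := by rcases hcase with ⟨rfl, -⟩ | ⟨rfl, -⟩ <;> rfl
  have hwk : σ'.wk = σ.wk := by rcases hcase with ⟨rfl, -⟩ | ⟨rfl, -⟩ <;> rfl
  have htr : σ'.tr = σ.tr := by rcases hcase with ⟨rfl, -⟩ | ⟨rfl, -⟩ <;> rfl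
  have hat : σ'.atom = σ.atom := by funext y; simp [View.atom, hin]
  have hnx : σ'.nx = update σ.nx x (σ.top (σ.atom x)) := by
    rcases hcase with ⟨rfl, -⟩ | ⟨rfl, -⟩ <;> rfl
  have how : σ'.ow = update σ.ow x (if σ.inp x = 0 then 0 else s) := by
    rw [← h.cur]
    rcases hcase with ⟨rfl, -⟩ | ⟨rfl, -⟩ <;> rfl
  have htl : σ'.tl = if σ.inp x = 0 then update σ.tl (σ.inp (x + 1)) x else σ.tl := by
    rcases hcase with ⟨rfl, -⟩ | ⟨rfl, -⟩ <;> rfl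
  have hta : σ'.ta = if σ.inp x = 0 then σ.ta else update σ.ta (σ.inp (x + 1)) x := by
    rcases hcase with ⟨rfl, -⟩ | ⟨rfl, -⟩ <;> rfl
  have htop : ∀ a : ℕ × ℕ, a.1 ≤ 1 → σ'.top a = if σ.atom x = a then x else σ.top a := by
    rintro ⟨t, v⟩ ht
    simp only [View.top, htl, hta, View.atom, Prod.mk.injEq] at ht ⊢
    by_cases h0 : σ.inp x = 0
    · by_cases h1 : t = 0
      · by_cases h2 : σ.inp (x + 1) = v
        · simp [h0, h1, h2]
        · simp [h0, h1, h2, Function.update_of_ne (Ne.symm h2)]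
      · simp [h0, h1, Ne.symm h1]
    · by_cases h1 : t = 0
      · simp [h0, h1]
      · have : σ.inp x = t := by omega
        by_cases h2 : σ.inp (x + 1) = v
        · simp [h1, h2, this]
        · simp [h1, h2, Function.update_of_ne (Ne.symm h2), this]
  have hid : c'.id = c.id := by rcases hcase with ⟨-, rfl⟩ | ⟨-, rfl, -⟩ <;> rfl
  have hown : c'.own = c.own := by rcases hcase with ⟨-, rfl⟩ | ⟨-, rfl, -⟩ <;> rfl
  have hoccs : ∀ y, y ∈ c'.occs ↔ y = x ∨ y ∈ c.occs := by
    intro y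
    rcases hcase with ⟨-, rfl⟩ | ⟨-, rfl, -⟩ <;> simp only [Clause.mem_occs, List.mem_cons] <;>
      tauto
  have hcid := h.base.id_le c (by simp)
  have hUx : ∀ y ∈ U, y ≠ x := fun y hy => by have := h.lt_of_mem hy; omega
  have hocc : ∀ d ∈ c :: G, ∀ y ∈ d.occs, y ≠ x := fun d hd y hy => by
    have := (h.base.occ d (by simpa using hd) y hy).2.1; omega
  have hfr := h.fresh.arr x hx
  have hcl : ∀ y ≠ x, σ'.cl y = σ.cl y := by
    intro y hy
    rcases hcase with ⟨rfl, -⟩ | ⟨rfl, -⟩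
    · exact Function.update_of_ne hy _ _
    · rfl
  have hcn : ∀ y ≠ c.id, σ'.cn y = σ.cn y := by
    intro y hy
    rw [← h.c_eq] at hy
    rcases hcase with ⟨rfl, -⟩ | ⟨rfl, -⟩
    · exact Function.update_of_ne hy _ _
    · rfl
  have hhd : ∀ y ≠ c.id, σ'.hd y = σ.hd y := by
    intro y hy
    rw [← h.c_eq] at hy
    rcases hcase with ⟨rfl, -⟩ | ⟨rfl, -⟩
    · rfl
    · exact Function.update_of_ne hy _ _
  have hc0 : 0 < c.id := by have := h.base.lt_lo; omega
  have hold : ∀ d ∈ c :: G, ∀ y ∈ d.occs, y < σ.i := fun d hd y hy =>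
    (h.base.occ d (by simpa using hd) y hy).2.1
  have how' : ∀ y < σ.i, σ'.ow y = σ.ow y := fun y hy => by
    rw [how, Function.update_of_ne (by omega)]
  refine ⟨{ base := ?_, fresh := ?_, id_lt := ?_, rules := ?_, cur := ?_, stack := ?_, marked := ?_,
            fired := ?_, waiting := ?_, tr := ?_, der := h.der, c_eq := ?_, own := ?_, ne := ?_ },
    fun f hf => ?_⟩
  · refine
    { chain := fun a ha => ?_
      nodup := List.nodup_cons.2 ⟨fun hm => hUx x hm rfl, h.base.nodup⟩
      base_le := h.base.base_le
      lt_lo := h.base.lt_lo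
      pending := ?_
      ids := ?_
      id_le := ?_
      own_le := ?_
      occ := ?_
      cl_neg := ?_
      cl_pos := ?_
      hd := ?_
      cn := ?_
      neg_nodup := ?_
      pos_eq := ?_
      unmarked := ?_
      zero := ?_ }
    · have h1 : Chain σ'.nx (base a) (σ.top a) (U.filter fun y => σ.atom y = a) :=
        (h.base.chain a ha).congr fun y hy => by
          rw [hnx, Function.update_of_ne (hUx y (List.mem_of_mem_filter hy))]
      rw [htop a ha, hat]
      by_cases he : σ.atom x = a
      · simp only [he, if_true, List.filter_cons, decide_true]
        refine ⟨rfl, ?_⟩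
        rwa [show σ'.nx x = σ.top a by rw [hnx, Function.update_self, he]]
      · simp only [he, if_false, List.filter_cons, decide_false]
        exact h1
    · intro y hy
      rw [hmrk]
      rcases List.mem_cons.1 hy with rfl | hy
      · exact ⟨hfr.2.2.2.1, c', by simp, (hoccs _).2 (Or.inl rfl)⟩
      · obtain ⟨h1, d, hd, h2⟩ := h.base.pending y hy
        refine ⟨h1, ?_⟩
        rcases mem_cons_of_mem_append hd with rfl | hd
        · exact ⟨c', by simp, (hoccs _).2 (Or.inr h2)⟩
        · exact ⟨d, List.mem_cons_of_mem _ hd, h2⟩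
    · intro d hd d' hd' he
      rcases mem_cons_of_mem_append hd with h1 | h1 <;>
        rcases mem_cons_of_mem_append hd' with h2 | h2
      · rw [h1, h2]
      · rw [h1, hid] at he
        exact absurd he.symm (h.ne d' h2)
      · rw [h2, hid] at he
        exact absurd he (h.ne d h1)
      · exact h.base.ids d (by simp [h1]) d' (by simp [h2]) he
    · intro d hd
      rw [hi]
      rcases mem_cons_of_mem_append hd with rfl | hd
      · omega
      · have := h.base.id_le d (by simp [hd])
        omega
    · intro d hd
      rcases mem_cons_of_mem_append hd with rfl | hd
      · rw [hown]
        exact h.base.own_le c (by simp)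
      · exact h.base.own_le d (by simp [hd])
    · have key : ∀ d ∈ c :: G, ∀ y ∈ d.occs, lo ≤ y ∧ y < σ'.i ∧ σ'.inp y ≤ 1 ∧
          σ'.ow y = if σ'.inp y = 0 then 0 else d.own := by
        intro d hd y hy
        have h1 := h.base.occ d (by simpa using hd) y hy
        rw [hi, hin, how' y h1.2.1]
        exact ⟨h1.1, by omega, h1.2.2⟩
      intro d hd y hy
      rcases mem_cons_of_mem_append hd with rfl | hd
      · rcases (hoccs y).1 hy with rfl | hy
        · rw [hi, hin, how, Function.update_self, hown, h.own]
          exact ⟨by omega, by omega, hinp, rfl⟩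
        · rw [hown]
          exact key c (by simp) y hy
      · exact key d (by simp [hd]) y hy
    · intro d hd y hy
      rcases mem_cons_of_mem_append hd with rfl | hd
      · have h1 := h.base.cl_neg c (by simp)
        rcases hcase with ⟨rfl, rfl⟩ | ⟨rfl, rfl, -⟩
        · rcases List.mem_cons.1 hy with rfl | hy
          · exact (Function.update_self ..).trans h.c_eq
          · rw [hcl y (hocc c (by simp) y (Clause.mem_occs.2 (Or.inl hy)))]
            exact h1 y hy
        · exact h1 y hy
      · rw [hcl y (hocc d (by simp [hd]) y (Clause.mem_occs.2 (Or.inl hy)))]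
        exact h.base.cl_neg d (by simp [hd]) y hy
    · intro d hd y hy
      rcases mem_cons_of_mem_append hd with rfl | hd
      · have h1 := h.base.cl_pos c (by simp)
        rcases hcase with ⟨rfl, rfl⟩ | ⟨rfl, rfl, -⟩
        · rw [hcl y (hocc c (by simp) y (Clause.mem_occs.2 (Or.inr hy)))]
          exact h1 y hy
        · rcases List.mem_cons.1 hy with rfl | hy
          · exact hfr.2.2.1
          · exact h1 y hy
      · rw [hcl y (hocc d (by simp [hd]) y (Clause.mem_occs.2 (Or.inr hy)))]
        exact h.base.cl_pos d (by simp [hd]) y hy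
    · intro d hd
      rcases mem_cons_of_mem_append hd with rfl | hd
      · have h1 := h.base.hd c (by simp)
        rcases hcase with ⟨rfl, rfl⟩ | ⟨rfl, rfl, -⟩
        · exact h1
        -- The latest positive occurrence overwrites the head, which agrees with its being put first
        -- in `pos`.
        · rw [hid, ← h.c_eq]
          exact Function.update_self ..
      · rw [hhd _ (h.ne d hd)]
        exact h.base.hd d (by simp [hd])
    · rw [hmrk]
      intro d hd
      rcases mem_cons_of_mem_append hd with rfl | hd
      · have h1 := h.base.cn c (by simp)
        rcases hcase with ⟨rfl, rfl⟩ | ⟨rfl, rfl, -⟩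
        -- The new premise lies in the fresh part of the arrays and is unmarked, so the number of
        -- unmarked premises grows by one.
        · simp only [List.filter_cons, hfr.2.2.2.1, decide_true, if_true, List.length_cons, ← h1,
            ← h.c_eq]
          exact Function.update_self ..
        · exact h1
      · rw [hcn _ (h.ne d hd)]
        exact h.base.cn d (by simp [hd])
    · intro d hd
      rcases mem_cons_of_mem_append hd with rfl | hd
      · have h1 := h.base.neg_nodup c (by simp)
        rcases hcase with ⟨rfl, rfl⟩ | ⟨rfl, rfl, -⟩
        · exact List.nodup_cons.2
            ⟨fun hm => hocc c (by simp) x (Clause.mem_occs.2 (Or.inl hm)) rfl, h1⟩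
        · exact h1
      · exact h.base.neg_nodup d (by simp [hd])
    · rw [hat]
      intro d hd
      rcases mem_cons_of_mem_append hd with rfl | hd
      · have h1 := h.base.pos_eq c (by simp)
        rcases hcase with ⟨rfl, rfl⟩ | ⟨rfl, rfl, h2⟩
        · exact h1
        · intro y hy z hz
          rcases List.mem_cons.1 hy with hy | hy <;> rcases List.mem_cons.1 hz with hz | hz
          · rw [hy, hz]
          · rw [hy, h2 z hz]
          · rw [hz, h2 y hy]
          · exact h1 y hy z hz
      · exact h.base.pos_eq d (by simp [hd])
    · have key : ∀ d ∈ c :: G, ∀ y ∈ d.occs, σ'.ow y ≤ s → σ'.mrk y = 0 → y ∈ x :: U := by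
        intro d hd y hy h1 h2
        rw [how' y (hold d hd y hy)] at h1
        rw [hmrk] at h2
        exact List.mem_cons_of_mem _ (h.base.unmarked d (by simpa using hd) y hy h1 h2)
      intro d hd y hy
      rcases mem_cons_of_mem_append hd with rfl | hd
      · rcases (hoccs y).1 hy with rfl | hy
        · simp
        · exact key c (by simp) y hy
      · exact key d (by simp [hd]) y hy
    · rw [hcn 0 hc0.ne, hhd 0 hc0.ne]
      exact h.base.zero
  · constructor
    · intro y hy
      rw [hi] at hy
      have h1 := h.fresh.arr y (by omega)
      rw [hcn y (by omega), hhd y (by omega), hcl y (by omega), hmrk, how,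
        Function.update_of_ne (by omega)]
      exact h1
    · intro p
      rw [htr, hi]
      have := h.fresh.tr p
      omega
    · intro v
      have h1 := h.fresh.top v
      rw [hi, htl, hta]
      constructor
      · split
        · by_cases hv : v = σ.inp (x + 1)
          · rw [hv, Function.update_self]
            omega
          · rw [Function.update_of_ne hv]
            omega
        · omega
      · split
        · omega
        · by_cases hv : v = σ.inp (x + 1)
          · rw [hv, Function.update_self]
            omega
          · rw [Function.update_of_ne hv]
            omega
    · rw [hwk, hwp, hi]
      intro z hz
      have := h.fresh.stack z hz
      omega
    · rw [hwk, hcn 0 hc0.ne, hhd 0 hc0.ne]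
      exact h.fresh.zero
  · intro d hd
    have := h.id_lt d hd
    omega
  · rw [← h.rules]
    exact rulesOf_congr hin fun d _ _ y _ _ => by rw [hmrk]
  · rw [hcur, h.cur]
  · exact h.stack.congr hwp hwk
  · rw [hmrk, hat]
    have key : ∀ d ∈ c :: G, ∀ y ∈ d.occs, σ'.ow y ≤ s → σ.mrk y ≠ 0 → σ.atom y ∈ D := by
      intro d hd y hy h1 h2
      rw [how' y (hold d hd y hy)] at h1
      exact h.marked d (by simpa using hd) y hy h1 h2
    intro d hd y hy
    rcases mem_cons_of_mem_append hd with rfl | hd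
    · rcases (hoccs y).1 hy with rfl | hy
      · exact fun _ h2 => absurd hfr.2.2.2.1 h2
      · exact key c (by simp) y hy
    · exact key d (List.mem_cons_of_mem _ hd) y hy
  · rw [hmrk, hat]
    intro d hd h1 y hy h2
    rw [how' y (hold d (by simp [hd]) y (Clause.mem_occs.2 (Or.inr hy)))] at h2
    rcases h.fired d hd h1 y hy h2 with h3 | ⟨z, hz, h3⟩
    · exact Or.inl h3
    · refine Or.inr ⟨z, hz, ?_⟩
      rwa [how' z (h.waiting z hz).1]
  · rw [hat, hin]
    intro z hz
    have h1 := h.waiting z hz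
    rw [how' z h1.1]
    exact ⟨by omega, h1.2⟩
  · rw [htr]
    exact h.tr
  · rw [hid, ← h.c_eq]
    rcases hcase with ⟨rfl, -⟩ | ⟨rfl, -⟩ <;> rfl
  · rw [hown, h.own]
  · rw [hid]
    exact h.ne
  · refine ⟨?_, ?_, ?_, hin, ?_, fun y hy => ?_, fun p => Or.inl (by rw [htr])⟩
    · rcases hcase with ⟨rfl, -⟩ | ⟨rfl, -⟩ <;> rfl
    · rcases hcase with ⟨rfl, -⟩ | ⟨rfl, -⟩ <;> rfl
    · rcases hcase with ⟨rfl, -⟩ | ⟨rfl, -⟩ <;> rfl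
    · rcases hcase with ⟨rfl, -⟩ | ⟨rfl, -⟩ <;> rfl
    · rw [hnx, Function.update_of_ne (by omega), how' y (by omega), hcl y (by omega),
        hcn y (by omega), hhd y (by omega), hmrk]
      refine ⟨rfl, rfl, rfl, rfl, rfl, rfl, ?_⟩
      rcases hcase with ⟨rfl, -⟩ | ⟨rfl, -⟩ <;> rfl

theorem Reading.setI (h : Reading σ s lo base wb c G R U ws D) {i : ℕ} (hi : σ.i ≤ i) :
    Reading (σ.setI i) s lo base wb c G R U ws D :=
  { toSeg := h.toSeg.setI hi, c_eq := h.c_eq, own := h.own, ne := h.ne }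

theorem Frame.setI (h : Frame σ σ' x) (i : ℕ) : Frame σ (σ'.setI i) x := { h with }

/-- A new clause is begun. -/
theorem Seg.begin (h : Seg σ s lo base wb [] G R U ws D) (hlo : lo ≤ σ.i) :
    Reading (σ.setC σ.i) s lo base wb ⟨σ.i, s, [], []⟩ G R U ws D := by
  have hfr := h.fresh.arr σ.i le_rfl
  have hb := h.base
  rw [List.nil_append] at hb
  refine
  { base := ?_
    fresh := { h.fresh with }
    id_lt := h.id_lt
    rules := h.rules
    cur := h.cur
    stack := h.stack.congr rfl rfl
    marked := fun d hd y hy => ?_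
    fired := h.fired
    waiting := h.waiting
    tr := h.tr
    der := h.der
    c_eq := rfl
    own := rfl
    ne := fun d hd => (h.id_lt d hd).ne }
  · have hb' : Base (σ.setC σ.i) s lo base (σ.setC σ.i).top G U :=
      hb.congr le_rfl rfl rfl rfl rfl rfl rfl rfl
    refine
    { hb' with
      pending := fun y hy => ?_
      ids := fun d hd d' hd' he => ?_
      id_le := fun d hd => ?_
      own_le := fun d hd => ?_
      occ := fun d hd => ?_
      cl_neg := fun d hd => ?_
      cl_pos := fun d hd => ?_
      hd := fun d hd => ?_
      cn := fun d hd => ?_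
      neg_nodup := fun d hd => ?_
      pos_eq := fun d hd => ?_
      unmarked := fun d hd => ?_ }
    · obtain ⟨h1, d, hd, h2⟩ := hb'.pending y hy
      exact ⟨h1, d, List.mem_cons_of_mem _ hd, h2⟩
    · rcases mem_cons_of_mem_append hd with h1 | h1 <;>
        rcases mem_cons_of_mem_append hd' with h2 | h2
      · rw [h1, h2]
      · rw [h1] at he
        exact absurd he.symm (h.id_lt d' h2).ne
      · rw [h2] at he
        exact absurd he (h.id_lt d h1).ne
      · exact hb'.ids d h1 d' h2 he
    · rcases mem_cons_of_mem_append hd with rfl | hd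
      · exact ⟨hlo, le_rfl⟩
      · exact hb'.id_le d hd
    · rcases mem_cons_of_mem_append hd with rfl | hd
      · exact le_rfl
      · exact hb'.own_le d hd
    · rcases mem_cons_of_mem_append hd with rfl | hd
      · simp [Clause.occs]
      · exact hb'.occ d hd
    · rcases mem_cons_of_mem_append hd with rfl | hd
      · simp
      · exact hb'.cl_neg d hd
    · rcases mem_cons_of_mem_append hd with rfl | hd
      · simp
      · exact hb'.cl_pos d hd
    · rcases mem_cons_of_mem_append hd with rfl | hd
      · exact hfr.2.1
      · exact hb'.hd d hd
    · rcases mem_cons_of_mem_append hd with rfl | hd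
      · exact hfr.1
      · exact hb'.cn d hd
    · rcases mem_cons_of_mem_append hd with rfl | hd
      · simp
      · exact hb'.neg_nodup d hd
    · rcases mem_cons_of_mem_append hd with rfl | hd
      · simp
      · exact hb'.pos_eq d hd
    · rcases mem_cons_of_mem_append hd with rfl | hd
      · simp [Clause.occs]
      · exact hb'.unmarked d hd
  · rcases mem_cons_of_mem_append hd with rfl | hd
    · simp [Clause.occs] at hy
    · exact h.marked d hd y hy

theorem rulesOf_cons (σ : View) (s : ℕ) (c : Clause) (G : List Clause) :
    rulesOf σ s (c :: G) = rulesOf σ s G ∪ c.rules σ s := by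
  ext r
  simp only [rulesOf, List.mem_cons, Set.mem_ofPred_eq, Set.mem_union]
  grind

/-- The unfinished clause is complete. -/
theorem Reading.finish (h : Reading σ s lo base wb c G R U ws D) (hc : c.id < σ.i) :
    ∃ ws', Seg (σ.fire σ.c) s lo base wb [] (c :: G) (R ∪ c.rules σ s) U ws' D ∧
      ws'.length ≤ ws.length + 1 := by
  have hat : (σ.fire σ.c).atom = σ.atom := by funext y; simp [View.atom]
  have htop : (σ.fire σ.c).top = σ.top := by funext y; simp [View.top]
  have hocc : ∀ y ∈ c.occs, σ.ow y ≤ s := by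
    intro y hy
    rw [(h.base.occ c (by simp) y hy).2.2.2, h.own]
    split <;> omega
  have hz : (σ.fire σ.c).wk 0 = σ.wk 0 := by
    unfold View.fire
    split
    · change update σ.wk (σ.wp + 1) (σ.hd σ.c) 0 = σ.wk 0
      exact Function.update_of_ne (by omega) _ _
    · rfl
  -- the head of the clause, if it has to be put on the stack
  suffices key : ∃ qs, Stack (σ.fire σ.c) s (qs ++ ws) wb ∧ qs.length ≤ 1 ∧
      (∀ z ∈ qs, z < σ.i ∧ σ.inp z ≤ 1 ∧ σ.ow z ≤ s ∧ Der (R ∪ c.rules σ s) (σ.atom z)) ∧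
      ((∀ y ∈ c.neg, σ.mrk y ≠ 0) → ∀ x ∈ c.pos, ∃ z ∈ qs, σ.ow z ≤ s ∧ σ.atom z = σ.atom x) by
    obtain ⟨qs, hst, hqs, hw, hf⟩ := key
    have hw' : ∀ z ∈ qs ++ ws, z < σ.i ∧ σ.inp z ≤ 1 ∧ σ.ow z ≤ s ∧
        Der (R ∪ c.rules σ s) (σ.atom z) := by
      intro z hz
      rcases List.mem_append.1 hz with hz | hz
      · exact hw z hz
      · have h1 := h.waiting z hz
        exact ⟨h1.1, h1.2.1, h1.2.2.1, h1.2.2.2.mono Set.subset_union_left⟩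
    refine ⟨qs ++ ws, ⟨?_, ?_, ?_, ?_, ?_, hst, ?_, ?_, ?_, ?_, ?_⟩, by
      rw [List.length_append]; omega⟩
    · rw [htop]
      exact h.base.congr (by simp) (by simp) (by simp) (by simp) (by simp) (by simp) (by simp)
        (by simp)
    · have hf := h.fresh
      refine ⟨by simpa using hf.arr, by simpa using hf.tr, by simpa using hf.top, ?_,
        by simpa [hz] using hf.zero⟩
      rw [hst.eq, fire_i]
      intro z hz
      rcases List.mem_append.1 hz with hz | hz
      · exact (hw' z hz).1.le
      · exact hf.stack z (by rw [h.stack.eq]; exact List.mem_append_right _ hz)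
    · rw [fire_i]
      intro d hd
      rcases List.mem_cons.1 hd with rfl | hd
      · exact hc
      · exact h.id_lt d hd
    · rw [← h.rules, ← rulesOf_cons]
      exact rulesOf_congr (by simp) (by simp)
    · simpa using h.cur
    · rw [hat]
      simpa using h.marked
    · rw [hat]
      intro d hd
      simp only [fire_mrk, fire_ow]
      rcases List.mem_cons.1 hd with rfl | hd
      · intro h1 x hx _
        obtain ⟨z, hz, h2⟩ := hf h1 x hx
        exact Or.inr ⟨z, List.mem_append_left _ hz, h2⟩
      · intro h1 x hx ho
        rcases h.fired d hd h1 x hx ho with h2 | ⟨z, hz, h2⟩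
        · exact Or.inl h2
        · exact Or.inr ⟨z, List.mem_append_right _ hz, h2⟩
    · rw [hat]
      simpa using hw'
    · simpa using h.tr
    · exact fun a ha => ⟨(h.der a ha).1, (h.der a ha).2.mono Set.subset_union_left⟩
  have hcn := h.base.cn c (by simp)
  have hhd := h.base.hd c (by simp)
  have hlo := h.base.lt_lo
  rw [h.c_eq]
  have hcn0 : σ.cn c.id = 0 ↔ ∀ y ∈ c.neg, σ.mrk y ≠ 0 := by
    rw [hcn, List.length_eq_zero_iff, List.filter_eq_nil_iff]
    simp
  cases hp : c.pos with
  | nil =>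
    rw [hp, List.headD_nil] at hhd
    refine ⟨[], ?_, by simp, by simp, by simp⟩
    rw [View.fire, if_neg (by omega)]
    exact h.stack
  | cons x l =>
    rw [hp, List.headD_cons] at hhd
    have hx : x ∈ c.occs := Clause.mem_occs.2 (Or.inr (by simp [hp]))
    have h1 := h.base.occ c (by simp) x hx
    by_cases hn : σ.cn c.id = 0
    · refine ⟨[x], ?_, by simp, ?_, ?_⟩
      · rw [View.fire, if_pos ⟨hn, by omega⟩, hhd]
        exact h.stack.push (by omega) rfl rfl
      · intro z hz
        rw [List.mem_singleton] at hz
        subst hz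
        refine ⟨h1.2.1, h1.2.2.1, hocc z hx, ?_⟩
        -- All premises are marked, hence already derivable, so the new rule yields its head.
        refine Der.intro (B := {a | ∃ y ∈ c.neg, σ.atom y = a})
          (Or.inr ⟨z, by simp [hp], rfl, Or.inl ⟨h.own, rfl⟩⟩) ?_
        rintro a ⟨y, hy, rfl⟩
        have hy' : y ∈ c.occs := Clause.mem_occs.2 (Or.inl hy)
        exact (h.der _ (h.marked c (by simp) y hy' (hocc y hy') (hcn0.1 hn y hy))).2.mono
          Set.subset_union_left
      · intro _ z hz
        exact ⟨x, by simp, hocc x hx, h.base.pos_eq c (by simp) x (by simp [hp]) z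
          (by rw [hp]; exact hz)⟩
    · refine ⟨[], ?_, by simp, by simp, fun h2 => absurd (hcn0.2 h2) hn⟩
      rw [View.fire, if_neg (by omega)]
      exact h.stack

theorem frame_fire (σ : View) (c f : ℕ) : Frame σ (σ.fire c) f := by
  constructor <;> simp

/-- The atoms at the positions `l`. -/
def View.atoms (σ : View) (l : List ℕ) : Set (ℕ × ℕ) := {a | ∃ y ∈ l, σ.atom y = a}

theorem View.atoms_cons (σ : View) (x : ℕ) (l : List ℕ) :
    σ.atoms (x :: l) = σ.atoms l ∪ {σ.atom x} := by
  ext a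
  simp only [View.atoms, List.mem_cons, Set.mem_ofPred_eq, Set.mem_union, Set.mem_singleton_iff]
  grind

theorem View.atoms_congr (h : σ'.inp = σ.inp) : σ'.atoms = σ.atoms := by
  funext l
  simp [View.atoms, View.atom, h]

theorem Reading.rules_eq (h : Reading σ s lo base wb c G R U ws D) :
    c.rules σ s = {r | r.1 = σ.atoms c.neg ∧ r.2 ∈ σ.atoms c.pos} := by
  ext r
  simp only [Clause.rules, h.own, View.atoms, Set.mem_ofPred_eq]
  grind

/-- The positions of the literals of the clauses `A` that belong to the block `s`. -/
def ownOccs (A : List Clause) (s : ℕ) : Set ℕ := {y | ∃ c ∈ A, c.own = s ∧ y ∈ c.occs}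

end Read

theorem Atom.code_eq {n k : ℕ} (a : Atom n k) : a.code = [a.raw.1, a.raw.2] := by
  cases a <;> rfl

theorem Atom.raw_le {n k : ℕ} (a : Atom n k) : a.raw.1 ≤ 1 := by
  cases a <;> simp [Atom.raw]

/-- In the word of the formula that begins at `o`, the marks `m` show which occurrences of
abnormality letters belong to `A`. -/
def Formula.Marked {n k : ℕ} (m : ℕ → ℕ) (A : Set (ℕ × ℕ)) : Formula n k → ℕ → Prop
  | .atom (.ab j), o => m o ≠ 0 ↔ (1, j.val) ∈ A
  | .neg φ, o => φ.Marked m A (o + 1)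
  | .conj φ ψ, o => φ.Marked m A (o + 1) ∧ ψ.Marked m A (o + 1 + φ.code.length + 1)
  | .disj φ ψ, o => φ.Marked m A (o + 1) ∧ ψ.Marked m A (o + 1 + φ.code.length + 1)
  | _, _ => True

theorem Formula.marked_atom {n k : ℕ} {m : ℕ → ℕ} {A : Set (ℕ × ℕ)} {a : Atom n k} {o : ℕ}
    (h : a.raw.1 ≠ 0 → (m o ≠ 0 ↔ a.raw ∈ A)) : (Formula.atom a).Marked m A o := by
  cases a with
  | letter i => trivial
  | ab j => exact h (by simp [Atom.raw])

/-! ### Scanning of clauses and Horn CNFs. -/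

section Parse

variable {n k : ℕ}

abbrev TokenIter : View → ℕ → View → Prop :=
  Iter (fun σ => σ.inp σ.i < 12) ((Program.instrs [.load 9 0 2, .const 10 12]).length + 1) tokenProg

theorem tokenIter_succ {σ : View} (h₁ : σ.inp σ.i ≠ 4) (h₂ : 2 ≤ σ.inp σ.i)
    (h₃ : σ.inp σ.i ≠ 7) (h₄ : σ.inp σ.i < 12) : TokenIter σ 83 (σ.setI (σ.i + 1)) := by
  have := vexec_token σ
  rw [View.token, if_neg h₁, if_neg (by omega), if_neg h₃] at this
  exact .single h₄ this

variable {s lo : ℕ} {base : ℕ × ℕ → ℕ} {G : List Clause} {R : Set Rule} {wb U ws : List ℕ}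
  {D : Set (ℕ × ℕ)}

/-- Reading a clause. -/
theorem Formula.IsClause.parse {φ : Formula n k} (hφ : φ.IsClause) {σ : View} {c : Clause}
    {U : List ℕ} (h : Reading σ s lo base wb c G R U ws D) (htxt : Txt σ.inp σ.i φ.code)
    (hpos : (σ.atoms c.pos ∪ φ.pos).Subsingleton) :
    ∃ σ' c' U' B, TokenIter σ B σ' ∧ Reading σ' s lo base wb c' G R U' ws D ∧
      σ'.i = σ.i + φ.code.length ∧ c'.id = c.id ∧ (∀ f ≤ c.id, Frame σ σ' f) ∧
      σ.atoms c'.neg = σ.atoms c.neg ∪ φ.negs ∧ σ.atoms c'.pos = σ.atoms c.pos ∪ φ.pos ∧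
      (∀ y ∈ c.occs, y ∈ c'.occs) ∧
      (∀ m A, (∀ y ∈ c'.occs, σ.i ≤ y → σ.inp y ≠ 0 → (m y ≠ 0 ↔ σ.atom y ∈ A)) →
        φ.Marked m A σ.i) ∧
      B + 400 * U'.length ≤ 400 * U.length + 1000 * φ.code.length := by
  have hd : (Program.instrs [.load 9 0 2, .const 10 12]).length = 2 := rfl
  induction hφ generalizing σ c U with
  | falsum =>
    obtain ⟨h0, -⟩ := htxt
    exact ⟨_, c, U, 83, tokenIter_succ (by omega) (by omega) (by omega) (by omega),
      h.setI (by omega), rfl, rfl, fun f _ => (Frame.refl σ f).setI _,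
      by simp [Formula.negs], by simp [Formula.pos], fun y hy => hy, fun m A _ => trivial,
      by simp [Formula.code]; omega⟩
  | pos a =>
    have ht := Atom.raw_le a
    rw [Formula.code, Atom.code_eq] at htxt
    obtain ⟨h0, h1, -⟩ := htxt
    have hat : σ.atom σ.i = a.raw := Prod.ext h0 h1
    obtain ⟨h2, h3⟩ := h.addOcc (c' := { c with pos := σ.i :: c.pos }) le_rfl (by omega)
      (Or.inr ⟨rfl, rfl, fun y hy => hpos (Or.inl ⟨y, hy, rfl⟩) (Or.inr hat)⟩)
    have hv := vexec_token σ
    rw [View.token, if_neg (by omega), if_pos (by omega)] at hv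
    refine ⟨_, _, _, _, .single (by omega) hv, h2, by simp [Formula.code, Atom.code_eq, View.setI],
      rfl, h3, by simp [Formula.negs], by simp [Formula.pos, View.atoms_cons, hat], ?_, ?_, ?_⟩
    · intro y hy
      rcases Clause.mem_occs.1 hy with hy | hy <;> simp [Clause.mem_occs, hy]
    -- The marks are set only at the end of the block, so correctness is claimed for every later `m`
    -- that is right on the occurrences of the clause.
    · intro m A hm
      refine Formula.marked_atom fun ha => ?_
      rw [← hat]
      exact hm _ (by simp [Clause.mem_occs]) le_rfl (by omega)
    -- Two symbols provide 2000 units, for one token (83 with its test) and one new listed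
    -- occurrence (400).
    · simp [Formula.code, Atom.code_eq]
      omega
  | neg a =>
    have ht := Atom.raw_le a
    rw [Formula.code, Formula.code, Atom.code_eq] at htxt
    obtain ⟨h4, h0, h1, -⟩ := htxt
    have hat : σ.atom (σ.i + 1) = a.raw := Prod.ext h0 h1
    obtain ⟨h2, h3⟩ := h.addOcc (x := σ.i + 1) (c' := { c with neg := (σ.i + 1) :: c.neg })
      (by omega) (by omega) (Or.inl ⟨rfl, rfl⟩)
    have hv := vexec_token σ
    rw [View.token, if_pos (by omega)] at hv
    refine ⟨_, _, _, _, .single (by omega) hv, h2,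
      by simp [Formula.code, Atom.code_eq, View.setI],
      rfl, h3, by simp [Formula.negs, View.atoms_cons, hat], by simp [Formula.pos], ?_, ?_, ?_⟩
    · intro y hy
      rcases Clause.mem_occs.1 hy with hy | hy <;> simp [Clause.mem_occs, hy]
    · intro m A hm
      refine Formula.marked_atom fun ha => ?_
      rw [← hat]
      exact hm _ (by simp [Clause.mem_occs]) (by omega) (by omega)
    · simp [Formula.code, Atom.code_eq]
      omega
  | @disj φ ψ h₁ h₂ ih₁ ih₂ =>
    simp only [Formula.code, txt_append, List.length_append, List.length_cons,
      List.length_nil] at htxt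
    obtain ⟨⟨⟨⟨⟨h5, -⟩, hφ⟩, h8, -⟩, hψ⟩, h6, -⟩ := htxt
    rw [Formula.pos, ← Set.union_assoc] at hpos
    obtain ⟨σ₁, c₁, U₁, B₁, hit₁, hr₁, hi₁, hid₁, hf₁, hn₁, hp₁, ho₁, hm₁, hB₁⟩ :=
      ih₁ (h.setI (i := σ.i + 1) (by omega)) hφ (hpos.anti Set.subset_union_left)
    have hf₁' : Frame σ σ₁ c.id := ((Frame.refl σ c.id).setI _).trans (hf₁ c.id le_rfl)
    have hin₁ := hf₁'.inp
    simp only [View.setI] at hi₁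
    obtain ⟨σ₂, c₂, U₂, B₂, hit₂, hr₂, hi₂, hid₂, hf₂, hn₂, hp₂, ho₂, hm₂, hB₂⟩ :=
      ih₂ (hr₁.setI (i := σ₁.i + 1) (by omega))
        (by
          change Txt σ₁.inp (σ₁.i + 1) _
          rw [hin₁, hi₁]
          convert hψ using 1
          omega)
        (by
          rw [View.atoms_congr (σ := σ) (σ' := σ₁.setI (σ₁.i + 1)) hin₁]
          rw [View.atoms_congr (σ := σ) (σ' := σ.setI (σ.i + 1)) rfl] at hp₁
          rwa [hp₁])
    have hf₂' : Frame σ₁ σ₂ c.id :=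
      ((Frame.refl σ₁ c.id).setI _).trans (hf₂ c.id hid₁.ge)
    have hin₂ : σ₂.inp = σ.inp := hf₂'.inp.trans hin₁
    have hat₁ : (σ₁.setI (σ₁.i + 1)).atoms = σ.atoms := View.atoms_congr hin₁
    have hat₀ : (σ.setI (σ.i + 1)).atoms = σ.atoms := rfl
    have hat₁' : (σ₁.setI (σ₁.i + 1)).atom = σ.atom := by
      funext y
      simp [View.atom, View.setI, hin₁]
    simp only [View.setI] at hi₂
    rw [hat₁] at hn₂ hp₂
    rw [hat₀] at hn₁ hp₁
    have e8 : σ₁.inp σ₁.i = 8 := by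
      rw [hin₁, hi₁, ← h8]
      congr 1
      omega
    have e6 : σ₂.inp σ₂.i = 6 := by
      rw [hin₂, hi₂, hi₁, ← h6]
      congr 1
      omega
    have hlen : (Formula.disj φ ψ).code.length = φ.code.length + ψ.code.length + 3 := by
      simp [Formula.code]
      omega
    refine ⟨σ₂.setI (σ₂.i + 1), c₂, U₂, _, (tokenIter_succ (σ := σ) ?_ ?_ ?_ ?_).trans
      (hit₁.trans ((tokenIter_succ (σ := σ₁) ?_ ?_ ?_ ?_).trans (hit₂.trans
        (tokenIter_succ (σ := σ₂) ?_ ?_ ?_ ?_)))), hr₂.setI (by omega), ?_, hid₂.trans hid₁,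
      fun f hf => ?_, ?_, ?_, fun y hy => ho₂ y (ho₁ y hy), fun m A hm => ⟨?_, ?_⟩, ?_⟩
    any_goals omega
    · simp only [View.setI]
      omega
    · exact ((hf₁'.trans hf₂').mono hf).setI _
    · rw [hn₂, hn₁, Set.union_assoc]
      rfl
    · rw [hp₂, hp₁, Set.union_assoc]
      rfl
    · refine hm₁ m A fun y hy hle => hm y (ho₂ y hy) ?_
      simp only [View.setI] at hle
      omega
    · have := hm₂ m A fun y hy hle h0 => ?_
      · rw [View.setI, hi₁] at this
        convert this using 1
      · rw [hat₁']
        refine hm y hy ?_ ?_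
        · simp only [View.setI] at hle
          omega
        · rwa [← hin₁]

/-- Reading a Horn CNF. -/
theorem Formula.IsHornCNF.parse {φ : Formula n k} (hφ : φ.IsHornCNF) {σ : View} {c : Clause}
    {G : List Clause} {R : Set Rule} {U ws : List ℕ}
    (h : Reading σ s lo base wb c G R U ws D) (hn : c.neg = []) (hp : c.pos = [])
    (htxt : Txt σ.inp σ.i φ.code) :
    ∃ σ' c' G' R' U' ws' B, TokenIter σ B σ' ∧ Reading σ' s lo base wb c' G' R' U' ws' D ∧
      σ'.i = σ.i + φ.code.length ∧ c'.id < σ'.i ∧ (∀ f ≤ c.id, Frame σ σ' f) ∧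
      R' ∪ c'.rules σ' s = R ∪ φ.rules ∧ ownOccs (c :: G) s ⊆ ownOccs (c' :: G') s ∧
      (∀ m A, (∀ y ∈ ownOccs (c' :: G') s, σ.i ≤ y → σ.inp y ≠ 0 →
        (m y ≠ 0 ↔ σ.atom y ∈ A)) → φ.Marked m A σ.i) ∧
      B + 400 * U'.length + 300 * ws'.length ≤
        400 * U.length + 300 * ws.length + 1000 * φ.code.length := by
  have hd : (Program.instrs [.load 9 0 2, .const 10 12]).length = 2 := rfl
  induction hφ generalizing σ c G R U ws with
  | verum =>
    obtain ⟨h0, -⟩ := htxt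
    have hid := (h.base.id_le c (by simp)).2
    refine ⟨_, c, G, R, U, ws, 83,
      tokenIter_succ (by omega) (by omega) (by omega) (by omega), h.setI (by omega), rfl,
      Nat.lt_succ_of_le hid, fun f _ => (Frame.refl σ f).setI _, ?_, subset_rfl,
      fun m A _ => trivial, by simp [Formula.code]; omega⟩
    congr 1
    ext r
    simp [Clause.rules, hp, Formula.rules, Formula.pos]
  | @clause φ hcl =>
    obtain ⟨σ', c', U', B, hit, hr, hi, hid, hf, hn', hp', ho, hm, hB⟩ := hcl.1.parse h htxt (by
      rw [hp, Formula.pos_eq]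
      simpa [View.atoms] using hcl.2.image _)
    have hid' := (h.base.id_le c (by simp)).2
    have hl : 0 < φ.code.length := by cases φ <;> simp [Formula.code, Atom.code_eq]
    refine ⟨σ', c', G, R, U', ws, B, hit, hr, hi, by omega, hf, ?_, ?_, ?_, by omega⟩
    · rw [hr.rules_eq, View.atoms_congr (hf c.id le_rfl).inp, hn', hp', hcl.1.rules_eq, hn, hp]
      simp [View.atoms]
    · rintro y ⟨d, hd, h1, h2⟩
      rcases List.mem_cons.1 hd with rfl | hd
      · exact ⟨c', by simp, hr.own, ho y h2⟩
      · exact ⟨d, by simp [hd], h1, h2⟩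
    · exact fun m A hy => hm m A fun y hy' => hy y ⟨c', by simp, hr.own, hy'⟩
  | @conj φ ψ h₁ h₂ ih₁ ih₂ =>
    simp only [Formula.code, txt_append, List.length_append, List.length_cons,
      List.length_nil] at htxt
    obtain ⟨⟨⟨⟨⟨h5, -⟩, hφ⟩, h7, -⟩, hψ⟩, h6, -⟩ := htxt
    obtain ⟨σ₁, c₁, G₁, R₁, U₁, ws₁, B₁, hit₁, hr₁, hi₁, hid₁, hf₁, hR₁, ho₁, hm₁, hB₁⟩ :=
      ih₁ (h.setI (i := σ.i + 1) (by omega)) hn hp hφ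
    have hf₁' : Frame σ σ₁ c.id := ((Frame.refl σ c.id).setI _).trans (hf₁ c.id le_rfl)
    have hin₁ := hf₁'.inp
    simp only [View.setI] at hi₁
    -- The last clause of `φ` is still open when `φ` has been read; the sign `∧` completes it and
    -- begins the first clause of `ψ`.
    obtain ⟨ws₁', hs₁, hws₁⟩ := hr₁.finish hid₁
    have hlo := h.base.id_le c (by simp)
    have hb := (hs₁.begin (by rw [fire_i]; omega)).setI (i := σ₁.i + 1) (by simp [View.setC])
    rw [fire_i] at hb
    have hv := vexec_token σ₁
    have e7 : σ₁.inp σ₁.i = 7 := by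
      rw [hin₁, hi₁, ← h7]
      congr 1
      omega
    rw [View.token, if_neg (by omega), if_neg (by omega), if_pos e7] at hv
    set σ₂ := ((σ₁.fire σ₁.c).setC σ₁.i).setI (σ₁.i + 1) with hσ₂
    have hi₂ : σ₂.i = σ₁.i + 1 := rfl
    have hf₂ : Frame σ₁ σ₂ c.id := { frame_fire σ₁ σ₁.c c.id with }
    have hin₂ : σ₂.inp = σ.inp := hf₂.inp.trans hin₁
    obtain ⟨σ₃, c₃, G₃, R₃, U₃, ws₃, B₃, hit₃, hr₃, hi₃, hid₃, hf₃, hR₃, ho₃, hm₃, hB₃⟩ :=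
      ih₂ hb rfl rfl (by
        rw [hin₂, hi₂, hi₁]
        convert hψ using 1
        omega)
    have hf₃' := (hf₁'.trans hf₂).trans (hf₃ c.id (by simp only; omega))
    have e6 : σ₃.inp σ₃.i = 6 := by
      rw [hf₃'.inp, hi₃, hi₂, hi₁, ← h6]
      congr 1
      omega
    have hlen : (Formula.conj φ ψ).code.length = φ.code.length + ψ.code.length + 3 := by
      simp [Formula.code]
      omega
    have hsub : ownOccs (c₁ :: G₁) s ⊆ ownOccs (c₃ :: G₃) s := by
      refine Set.Subset.trans ?_ ho₃
      rintro y ⟨d, hd, h1⟩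
      exact ⟨d, List.mem_cons_of_mem _ hd, h1⟩
    refine ⟨σ₃.setI (σ₃.i + 1), c₃, G₃, R₃, U₃, ws₃, _,
      (tokenIter_succ (σ := σ) ?_ ?_ ?_ ?_).trans (hit₁.trans ((Iter.single (by omega) hv).trans
        (hit₃.trans (tokenIter_succ (σ := σ₃) ?_ ?_ ?_ ?_)))), hr₃.setI (by omega), ?_, ?_,
      fun f hf => ?_, ?_, ho₁.trans hsub, fun m A hm => ⟨?_, ?_⟩, ?_⟩
    any_goals omega
    · simp only [View.setI]
      omega
    · simp only [View.setI]
      omega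
    · exact (hf₃'.mono hf).setI _
    · change R₃ ∪ c₃.rules σ₃ s = _
      rw [hR₃, hR₁, Set.union_assoc]
      rfl
    · refine hm₁ m A fun y hy hle => hm y (hsub hy) ?_
      simp only [View.setI] at hle
      omega
    · have := hm₃ m A fun y hy hle h0 => ?_
      · rw [hi₂, hi₁] at this
        exact this
      · have : σ₂.atom y = σ.atom y := by simp [View.atom, hin₂]
        rw [this]
        refine hm y hy (by omega) ?_
        rwa [← hin₂]

/-- The first symbol tells a formula from a block, a closing brace and a comma. -/
theorem Formula.exists_code_eq (φ : Formula n k) : ∃ a l, φ.code = a :: l ∧ a < 9 := by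
  cases φ with
  | atom a => exact ⟨_, _, Atom.code_eq a, by have := Atom.raw_le a; omega⟩
  | _ => exact ⟨_, _, rfl, by omega⟩

/-- Reading a formula that is a member of the block. -/
theorem Formula.IsHornCNF.member {φ : Formula n k} (hφ : φ.IsHornCNF) {σ : View}
    (h : Seg σ s lo base wb [] G R U ws D) (hlo : lo ≤ σ.i)
    (htxt : Txt σ.inp σ.i (φ.code ++ [12])) :
    ∃ σ' G' U' ws' B, VExec memberProg σ B σ' ∧
      Seg σ' s lo base wb [] G' (R ∪ φ.rules) U' ws' D ∧
      σ'.i = σ.i + (φ.code.length + 1) ∧ Frame σ σ' σ.i ∧ ownOccs G s ⊆ ownOccs G' s ∧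
      (∀ m A, (∀ y ∈ ownOccs G' s, σ.i ≤ y → σ.inp y ≠ 0 →
        (m y ≠ 0 ↔ σ.atom y ∈ A)) → φ.Marked m A σ.i) ∧
      B + 400 * U'.length + 300 * ws'.length ≤
        400 * U.length + 300 * ws.length + 1000 * φ.code.length + 500 := by
  rw [txt_append] at htxt
  obtain ⟨htxt, h12, -⟩ := htxt
  obtain ⟨σ₁, c₁, G₁, R₁, U₁, ws₁, B₁, hit₁, hr₁, hi₁, hid₁, hf₁, hR₁, ho₁, hm₁, hB₁⟩ :=
    hφ.parse (h.begin hlo) rfl rfl htxt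
  obtain ⟨ws₂, hs, hws⟩ := hr₁.finish hid₁
  rw [hR₁] at hs
  have hf : Frame σ σ₁ σ.i := { hf₁ σ.i le_rfl with }
  have hi₁' : σ₁.i = σ.i + φ.code.length := hi₁
  refine ⟨(σ₁.fire σ₁.c).setI (σ₁.i + 1), c₁ :: G₁, U₁, ws₂, _, .cond_true (guard_pos 9) ?_
    ((vexec_setC σ).seq ((hit₁.vexec (guard_pos 12) ?_).seq (vexec_endClause σ₁))),
    hs.setI (by simp), ?_, ?_, ?_, hm₁, ?_⟩
  · obtain ⟨a, l, he, ha⟩ := φ.exists_code_eq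
    rw [he] at htxt
    rw [htxt.1]
    exact ha
  · rw [hf.inp, hi₁', h12]
    omega
  · simp only [View.setI]
    omega
  · exact (hf.trans (frame_fire σ₁ σ₁.c _)).setI _
  · refine Set.Subset.trans ?_ ho₁
    rintro y ⟨d, hd, h1⟩
    exact ⟨d, List.mem_cons_of_mem _ hd, h1⟩
  · have h1 : (Program.instrs [.load 9 0 2, .const 10 9]).length = 2 := rfl
    have h2 : (Program.instrs [.load 9 0 2, .const 10 12]).length = 2 := rfl
    omega

end Parse

/-! ### Reading blocks -/

section Blocks

variable {n k : ℕ}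

/-- The words of the sequence that begins at `o` are marked correctly: the abnormality letters of
the sequence itself have the values `A`. -/
def Body.Marked (m : ℕ → ℕ) : Set (ℕ × ℕ) → Body n k → ℕ → Prop
  | _, .nil, _ => True
  | A, .formula φ rest, o => φ.Marked m A o ∧ rest.Marked m A (o + (φ.code.length + 1))
  | A, .block C _ body rest, o =>
      body.Marked m {a | Der body.rules a} (o + (2 * C.length + 2)) ∧
        rest.Marked m A (o + ((blockCode C body.code).length + 1))

theorem length_blockCode (C : List (Fin n)) (b : List ℕ) :
    (blockCode C b).length = 2 * C.length + b.length + 3 := by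
  have : (C.flatMap fun i => [0, i.val]).length = 2 * C.length := by
    induction C with
    | nil => rfl
    | cons i C ih =>
      simp only [List.flatMap_cons, List.length_append, ih, List.length_cons, List.length_nil]
      omega
  simp only [blockCode, List.length_append, this, List.length_cons, List.length_nil]
  omega

theorem txt_blockCode {f : ℕ → ℕ} {o : ℕ} {C : List (Fin n)} {b : List ℕ} :
    Txt f o (blockCode C b) ↔ f o = 9 ∧ Txt f (o + 1) (lettersCode (C.map Fin.val)) ∧
      f (o + 1 + 2 * C.length) = 10 ∧ Txt f (o + (2 * C.length + 2)) b ∧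
      f (o + (2 * C.length + 2) + b.length) = 11 := by
  have h1 : (C.flatMap fun i => [0, i.val]) = lettersCode (C.map Fin.val) := by
    simp [lettersCode, List.flatMap_map]
  have h2 : (lettersCode (C.map Fin.val)).length = 2 * C.length := by
    rw [length_lettersCode, List.length_map]
  have e1 : ∀ m, o + ([9] ++ lettersCode (C.map Fin.val) ++ [10]).length + m =
    o + (2 * C.length + 2) + m := by
    intro m
    simp only [List.length_append, h2, List.length_cons, List.length_nil]
    omega
  rw [blockCode, h1]
  simp only [txt_append, List.length_append, List.length_cons, List.length_nil, h2, Txt,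
    and_true, and_assoc]
  rw [show o + (0 + 1 + 2 * C.length) = o + 1 + 2 * C.length by omega,
    show o + (0 + 1 + 2 * C.length + (0 + 1)) = o + (2 * C.length + 2) by omega,
    show o + (0 + 1 + 2 * C.length + (0 + 1) + b.length) = o + (2 * C.length + 2) + b.length by
      omega]

abbrev MemberIter : View → ℕ → View → Prop :=
  Iter (fun σ => σ.i < σ.len) ((Program.instrs []).length + 1) memberProg

/-- The members of the sequence `b` are read correctly in each situation. -/
def Body.Readable (b : Body n k) : Prop :=
  ∀ ⦃σ : View⦄ ⦃s lo : ℕ⦄ ⦃base : ℕ × ℕ → ℕ⦄ ⦃wb : List ℕ⦄ ⦃G : List Clause⦄ ⦃R : Set Rule⦄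
    ⦃U ws : List ℕ⦄ ⦃D : Set (ℕ × ℕ)⦄, Seg σ s lo base wb [] G R U ws D → lo ≤ σ.i →
    Txt σ.inp σ.i b.code → σ.i + b.code.length ≤ σ.len →
    ∃ σ' G' U' ws' D' B, MemberIter σ B σ' ∧ Seg σ' s lo base wb [] G' (R ∪ b.rules) U' ws' D' ∧
      σ'.i = σ.i + b.code.length ∧ Frame σ σ' σ.i ∧ ownOccs G s ⊆ ownOccs G' s ∧
      (∀ m A, (∀ x, σ.i ≤ x → x < σ'.i → s < σ'.ow x → m x = σ'.mrk x) →
        (∀ y ∈ ownOccs G' s, σ.i ≤ y → σ.inp y ≠ 0 → (m y ≠ 0 ↔ σ.atom y ∈ A)) →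
        b.Marked m A σ.i) ∧
      B + 400 * U'.length + 300 * ws'.length ≤
        400 * U.length + 300 * ws.length + 2000 * b.code.length

/-- The situation at the beginning of a block. -/
theorem Fresh.seg {σ : View} (h : Fresh σ) (x : ℕ) :
    Seg (σ.openBlock.setI (σ.i + 1 + x)) σ.i (σ.i + 1 + x) σ.top (stackOf σ.wk σ.wp) [] [] ∅ [] []
      ∅ where
  base :=
    { chain := fun a _ => rfl
      nodup := List.nodup_nil
      base_le := h.top_le
      lt_lo := by omega
      pending := by simp
      ids := by simp
      id_le := by simp
      own_le := by simp
      occ := by simp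
      cl_neg := by simp
      cl_pos := by simp
      hd := by simp
      cn := by simp
      neg_nodup := by simp
      pos_eq := by simp
      unmarked := by simp
      zero := h.zero.2 }
  fresh :=
    { arr := fun y hy => h.arr y (by simp only [View.setI] at hy; omega)
      tr := fun p => (h.tr p).trans (by simp only [View.setI]; omega)
      top := fun v => ⟨(h.top v).1.trans (by simp only [View.setI]; omega),
        (h.top v).2.trans (by simp only [View.setI]; omega)⟩
      stack := fun z hz => (h.stack z hz).trans (by simp only [View.setI]; omega)
      zero := h.zero }
  id_lt := by simp
  rules := by simp [rulesOf]
  cur := rfl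
  stack := ⟨rfl, h.zero.1, by simp, h.stack⟩
  marked := by simp
  fired := by simp
  waiting := by simp
  tr := fun p => iff_of_false (not_lt.2 (h.tr p)) (Set.notMem_empty _)
  der := fun a ha => ha.elim

/-- Only `Fresh` is assumed, no parent: whatever lies before the brace is the base of the lists and
of the stack. At the end of the block the marks of its own abnormality letters agree with
derivability, so the condition that `Body.Readable` puts on `m` can be discharged. -/
theorem Body.Readable.block {b : Body n k} (hb : b.Readable) {C : List (Fin n)}
    (hC : ∀ i, i ∈ C) {σ : View} (h : Fresh σ) (htxt : Txt σ.inp σ.i (blockCode C b.code))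
    (hlen : σ.i + (blockCode C b.code).length ≤ σ.len) :
    ∃ σ' G U B, MemberIter σ B σ'.closeBlock ∧
      Deriving σ' σ.i (σ.i + (2 * C.length + 2)) σ.top G b.rules (stackOf σ.wk σ.wp) U []
        {a | Der b.rules a} ∧
      Frame σ σ' σ.i ∧ Fresh σ'.closeBlock ∧ σ'.pa σ.i = σ.cur ∧
      σ'.i + 1 = σ.i + (blockCode C b.code).length ∧
      (∀ p, σ'.tr p = σ.tr p ∨ σ.i < σ'.tr p) ∧
      (∀ m, (∀ x, σ.i ≤ x → x < σ'.i → σ.i ≤ σ'.ow x → m x = σ'.mrk x) →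
        b.Marked m {a | Der b.rules a} (σ.i + (2 * C.length + 2))) ∧
      B + 400 * U.length + 1000 ≤ 2000 * (blockCode C b.code).length := by
  rw [length_blockCode] at hlen ⊢
  obtain ⟨h9, hlet, h10, htxt, h11⟩ := txt_blockCode.1 htxt
  have hm : (C.map Fin.val).length = C.length := List.length_map ..
  -- the beginning of the block
  have hs : VExec memberProg σ (60 * C.length + 200)
      (σ.openBlock.setI (σ.i + 1 + (2 * C.length + 1))) := by
    have h1 := vexec_skip (σ := σ.openBlock) hlet (by rw [hm]; exact h10)
    have h2 := vexec_succ (σ.openBlock.setI (σ.openBlock.i + 2 * (C.map Fin.val).length))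
    rw [hm] at h1 h2
    have h3 := VExec.cond_false (guard_pos 9) (p := .all [.instr (.copy 4 2), formulaLoop,
        .all [.instr (.copy 10 4), fireProg, .instr (.succ 2)]]) (by rw [h9]; omega)
      (VExec.cond_true (guard_eq 9) (q := .cond [.load 9 0 2, .const 10 11] (.eq 9 10)
        (.all [.instrs [.copy 7 3, .succ 7], collectLoop, deriveLoop,
          .instrs [.load 3 12 3, .succ 2]])
        (.instr (.succ 2))) h9 ((vexec_openBlock σ).seq (h1.seq h2)))
    have e : (σ.openBlock.setI (σ.openBlock.i + 2 * C.length)).setI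
        ((σ.openBlock.setI (σ.openBlock.i + 2 * C.length)).i + 1) =
        σ.openBlock.setI (σ.i + 1 + (2 * C.length + 1)) := rfl
    rw [e] at h3
    refine h3.mono ?_
    have h1 : (Program.instrs [.load 9 0 2, .const 10 9]).length = 2 := rfl
    omega
  have hseg := h.seg (2 * C.length + 1)
  set σ₁ := σ.openBlock.setI (σ.i + 1 + (2 * C.length + 1)) with hσ₁
  have elo : σ.i + 1 + (2 * C.length + 1) = σ.i + (2 * C.length + 2) := by omega
  rw [elo] at hseg
  have hi₁ : σ₁.i = σ.i + (2 * C.length + 2) := elo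
  have hf₁ : Frame σ σ₁ σ.i :=
    { Frame.refl σ σ.i with
      arr := fun x hx => ⟨rfl, rfl, rfl, rfl, rfl, rfl, Function.update_of_ne hx.ne _ _⟩ }
  obtain ⟨σ₂, G, U, ws, D, B, hit, hs₂, hi₂, hf₂, -, hm₂, hB⟩ :=
    hb hseg hi₁.ge (by rw [hi₁]; exact htxt) (by
      rw [hi₁]
      change _ ≤ σ.len
      omega)
  rw [Set.empty_union] at hs₂
  have hin₂ : σ₂.inp = σ.inp := hf₂.inp
  obtain ⟨σ₃, U₃, B₃, he, hd, hrel, hB₃⟩ := hs₂.close (C := C.map Fin.val) (by rwa [hin₂])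
    (by rw [hin₂, hm]; exact h10) (by rw [hm]; omega) (by omega)
    (fun a ha h0 => by
      obtain ⟨x, rfl⟩ := Body.der_range ha
      cases x with
      -- Here the absence of fixed letters enters the algorithm: a derived letter is always among
      -- the described ones.
      | letter i => exact List.mem_map_of_mem (hC i)
      | ab j => simp [Atom.raw] at h0)
    (fun x hx hx' => by
      rw [(hf₂.arr x (by omega)).2.1]
      exact (h.arr x hx.le).2.2.2.2)
  have hi₃ : σ₃.i = σ₂.i := hrel.i
  have hf₃ : Frame σ σ₃ σ.i :=
    (hf₁.trans (hf₂.mono (by omega))).trans (hrel.frame (by omega) le_rfl)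
  have e11 : σ₂.inp σ₂.i = 11 := by rw [hin₂, hi₂, hi₁, h11]
  have hstep : VExec memberProg σ₂ (B₃ + 9) σ₃.closeBlock :=
    (VExec.cond_false (guard_pos 9) (by omega) (VExec.cond_false (guard_eq 9) (by omega)
      (VExec.cond_true (guard_eq 11) e11 he))).mono (by
        have h1 : (Program.instrs [.load 9 0 2, .const 10 9]).length = 2 := rfl
        have h2 : (Program.instrs [.load 9 0 2, .const 10 11]).length = 2 := rfl
        omega)
  have hl₂ : σ₂.len = σ.len := hf₂.len.trans hf₁.len
  have h0 : (Program.instrs []).length = 1 := rfl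
  refine ⟨σ₃, G, U₃, _, (Iter.single (by omega) hs).trans (hit.trans (Iter.single (by omega) hstep)),
    hd, hf₃, hd.fresh hs₂.fresh hrel (by omega), ?_, by omega, fun p => ?_, fun m hm => ?_, ?_⟩
  · rw [hrel.pa, (hf₂.arr σ.i (by omega)).2.2.2.2.2.2]
    exact Function.update_self ..
  · have h1 := hrel.tr p
    have h2 := hf₂.tr p
    have h3 : σ₁.tr p = σ.tr p := rfl
    omega
  · rw [← hi₁]
    refine hm₂ m _ (fun x hx hx' ho => ?_) fun y hy hle h0 => ?_
    · rw [hm x (by omega) (by omega) (by rw [hrel.ow]; omega)]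
      exact (hrel.mrk x).resolve_left (by omega)
    · obtain ⟨c, hc, hown, hy⟩ := hy
      have h1 := hd.base.occ c hc y hy
      have hin : σ₁.inp = σ₃.inp := (hrel.inp.trans hin₂).symm
      have hat : σ₁.atom y = σ₃.atom y := by simp [View.atom, hin]
      rw [hin] at h0
      rw [if_neg h0, hown] at h1
      rw [hm y (by omega) h1.2.1 h1.2.2.2.ge, hat]
      constructor
      · exact hd.marked c hc y hy h1.2.2.2.le
      · intro h2 h3
        exact hd.done y (hd.base.unmarked c hc y hy h1.2.2.2.le h3) h1.2.2.2.le h2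
  · simp only [List.length_nil] at hB
    omega

/-- By induction on the sequence. A child block is run above the parent's lists and stack, and
`Seg.merge` then restores the parent's invariant with the child's clauses added. -/
theorem Body.readable {b : Body n k} (hH : b.IsHorn) (hF : b.NoFixed) : b.Readable := by
  have hg : (Program.instrs []).length = 1 := rfl
  induction b with
  | nil =>
    intro σ s lo base wb G R U ws D h _ _ _
    refine ⟨σ, G, U, ws, D, 0, .refl _ _, ?_, rfl, Frame.refl _ _, subset_rfl,
      fun m A _ _ => trivial, by simp⟩
    rwa [Body.rules, Set.union_empty]
  | formula φ rest ih =>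
    intro σ s lo base wb G R U ws D h hlo htxt hlen
    rw [Body.code, txt_append] at htxt
    simp only [Body.code, List.length_append, List.length_cons, List.length_nil] at hlen htxt ⊢
    obtain ⟨σ₁, G₁, U₁, ws₁, B₁, he, h₁, hi₁, hf₁, ho₁, hm₁, hB₁⟩ := hH.1.member h hlo htxt.1
    have hin₁ := hf₁.inp
    have hl₁ := hf₁.len
    obtain ⟨σ₂, G₂, U₂, ws₂, D₂, B₂, hit, h₂, hi₂, hf₂, ho₂, hm₂, hB₂⟩ :=
      ih hH.2 hF h₁ (by omega) (by
        rw [hin₁, hi₁]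
        exact htxt.2) (by omega)
    have hat : σ₁.atom = σ.atom := by funext y; simp [View.atom, hin₁]
    refine ⟨σ₂, G₂, U₂, ws₂, D₂, _, (Iter.single (by omega) he).trans hit, ?_, by omega,
      hf₁.trans (hf₂.mono (by omega)), ho₁.trans ho₂, fun m A hx hy => ⟨?_, ?_⟩, by omega⟩
    · rwa [Body.rules, ← Set.union_assoc]
    · exact hm₁ m A fun y h1 => hy y (ho₂ h1)
    · rw [← hi₁]
      refine hm₂ m A (fun x h1 => hx x (by omega)) fun y h1 h2 h3 => ?_
      rw [hat]
      exact hy y h1 (by omega) (by rwa [← hin₁])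
  | block C hC body rest ihb ih =>
    intro σ s lo base wb G R U ws D h hlo htxt hlen
    rw [Body.code, txt_append, txt_append] at htxt
    simp only [Body.code, List.length_append, List.length_cons, List.length_nil] at hlen htxt ⊢
    obtain ⟨⟨htxt, h12, -⟩, hrest⟩ := htxt
    obtain ⟨σ₁, G₁, U₁, B₁, hit₁, hd, hf₁, hfr, hpa, hi₁, htr, hm₁, hB₁⟩ :=
      (ihb hH.1 hF.2.1).block hF.1 h.fresh htxt (by omega)
    have hbl := length_blockCode C body.code
    have hlt := h.base.lt_lo
    rw [h.stack.eq] at hd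
    have h₁ := h.merge hd hf₁ hfr (hpa.trans h.cur) (by omega) (by omega) (by omega) htr
    have hf₁' : Frame σ σ₁.closeBlock σ.i := { hf₁ with }
    set σ₂ := σ₁.closeBlock with hσ₂
    have hi₂ : σ₂.i = σ.i + (blockCode C body.code).length := hi₁
    have hin₂ : σ₂.inp = σ.inp := hf₁'.inp
    have hl₂ : σ₂.len = σ.len := hf₁'.len
    have e12 : σ₂.inp σ₂.i = 12 := by rw [hin₂, hi₂, h12]
    have hstep : VExec memberProg σ₂ 59 (σ₂.setI (σ₂.i + 1)) :=
      (VExec.cond_false (guard_pos 9) (by omega) (VExec.cond_false (guard_eq 9) (by omega)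
        (VExec.cond_false (guard_eq 11) (by omega) (vexec_succ σ₂)))).mono (by
          have h1 : (Program.instrs [.load 9 0 2, .const 10 9]).length = 2 := rfl
          have h2 : (Program.instrs [.load 9 0 2, .const 10 11]).length = 2 := rfl
          omega)
    have h₂ := h₁.setI (i := σ₂.i + 1) (by omega)
    set σ₃ := σ₂.setI (σ₂.i + 1) with hσ₃
    have hi₃ : σ₃.i = σ.i + ((blockCode C body.code).length + 1) := by
      change σ₂.i + 1 = _
      omega
    have hin₃ : σ₃.inp = σ.inp := hin₂
    have hl₃ : σ₃.len = σ.len := hl₂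
    obtain ⟨σ₄, G₄, U₄, ws₄, D₄, B₄, hit₄, h₄, hi₄, hf₄, ho₄, hm₄, hB₄⟩ :=
      ih hH.2 hF.2.2 h₂ (by omega) (by
        rw [hin₃, hi₃]
        exact hrest) (by omega)
    have hat : σ₃.atom = σ.atom := by funext y; simp [View.atom, hin₃]
    refine ⟨σ₄, G₄, U₄, ws₄, D₄, _, hit₁.trans ((Iter.single (by omega) hstep).trans hit₄), ?_,
      by omega, (hf₁'.setI _).trans (hf₄.mono (by omega)), ?_, fun m A hx hy => ⟨?_, ?_⟩, ?_⟩
    · rwa [Body.rules, ← Set.union_assoc]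
    · refine Set.Subset.trans ?_ ho₄
      rintro y ⟨c, hc, h1⟩
      exact ⟨c, List.mem_append_right _ hc, h1⟩
    · refine hm₁ m fun x h1 h2 h3 => ?_
      -- What follows the child does not touch marks at earlier positions, so the marks of the child
      -- are final.
      have h4 := hf₄.arr x (by omega)
      have h5 : σ₄.ow x = σ₁.ow x := h4.2.1
      have h6 : σ₄.mrk x = σ₁.mrk x := h4.2.2.2.2.2.1
      rw [← h6]
      exact hx x h1 (by omega) (by omega)
    · rw [← hi₃]
      refine hm₄ m A (fun x h1 => hx x (by omega)) fun y h1 h2 h3 => ?_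
      rw [hat]
      exact hy y h1 (by omega) (by rwa [← hin₃])
    · simp only [List.length_append] at hB₄
      omega

/-- The words of the theory, of which the first begins at `o`, are marked correctly. -/
def NAT.Marked (m : ℕ → ℕ) : NAT n k → ℕ → Prop
  | [], _ => True
  | B :: T, o => B.body.Marked m {a | Der B.body.rules a} (o + (2 * B.described.length + 2)) ∧
      NAT.Marked m T (o + (blockCode B.described B.body.code).length)

theorem NAT.code_cons (B : Block n k) (T : NAT n k) :
    NAT.code (B :: T) = blockCode B.described B.body.code ++ NAT.code T := rfl

/-- Reading a theory. -/
theorem NAT.read {T : NAT n k} (hH : T.IsHorn) (hF : T.NoFixed) {σ : View} (h : Fresh σ)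
    (htxt : Txt σ.inp σ.i T.code) (hlen : σ.i + T.code.length ≤ σ.len) :
    ∃ σ' B, MemberIter σ B σ' ∧ σ'.i = σ.i + T.code.length ∧ Frame σ σ' σ.i ∧
      NAT.Marked σ'.mrk T σ.i ∧ B ≤ 2000 * T.code.length := by
  suffices key : ∃ σ' B, MemberIter σ B σ' ∧ σ'.i = σ.i + T.code.length ∧ Frame σ σ' σ.i ∧
      (∀ m : ℕ → ℕ, (∀ x < σ'.i, m x = σ'.mrk x) → NAT.Marked m T σ.i) ∧
      B ≤ 2000 * T.code.length by
    obtain ⟨σ', B, h1, h2, h3, h4, h5⟩ := key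
    exact ⟨σ', B, h1, h2, h3, h4 _ fun _ _ => rfl, h5⟩
  induction T generalizing σ with
  | nil => exact ⟨σ, 0, .refl _ _, rfl, Frame.refl _ _, fun _ _ => trivial, by simp⟩
  | cons B T ih =>
    rw [NAT.code_cons, txt_append] at htxt
    rw [NAT.code_cons, List.length_append] at hlen ⊢
    have hB := hF B (by simp)
    -- Blocks of the theory are treated independently: leftovers of earlier ones lie before the next
    -- brace and only end its lists.
    obtain ⟨σ₁, G₁, U₁, B₁, hit₁, hd, hf₁, hfr, hpa, hi₁, htr, hm₁, hB₁⟩ :=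
      (Body.readable (hH B (by simp)) hB.2).block hB.1 h htxt.1 (by omega)
    have hf₁' : Frame σ σ₁.closeBlock σ.i := { hf₁ with }
    set σ₂ := σ₁.closeBlock with hσ₂
    have hi₂ : σ₂.i = σ.i + (blockCode B.described B.body.code).length := hi₁
    have hin₂ : σ₂.inp = σ.inp := hf₁'.inp
    have hl₂ : σ₂.len = σ.len := hf₁'.len
    obtain ⟨σ₃, B₃, hit₃, hi₃, hf₃, hm₃, hB₃⟩ :=
      ih (fun B hB => hH B (by simp [hB])) (fun B hB => hF B (by simp [hB])) hfr
        (by rw [hin₂, hi₂]; exact htxt.2) (by omega)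
    refine ⟨σ₃, _, hit₁.trans hit₃, by omega, hf₁'.trans (hf₃.mono (by omega)),
      fun m hm => ⟨?_, ?_⟩, by omega⟩
    · refine hm₁ m fun x h1 h2 h3 => ?_
      rw [hm x (by omega)]
      exact (hf₃.arr x (by omega)).2.2.2.2.2.1
    · rw [← hi₂]
      exact hm₃ m hm

end Blocks

/-! ### Writing the flat theory -/

/-- The output written so far. -/
def View.written (σ : View) : List ℕ := (List.range σ.j).map σ.out

theorem View.written_emit (σ : View) (x : ℕ) : (σ.emit x).written = σ.written ++ [x] := by
  simp only [View.written, View.emit, List.range_succ, List.map_append, List.map_cons,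
    List.map_nil, Function.update_self]
  congr 1
  refine List.map_congr_left fun y hy => ?_
  rw [List.mem_range] at hy
  exact Function.update_of_ne hy.ne _ _

/-- From `σ` to `σ'` the word `w` is written, `d` words are read, and `e` formulas are counted. -/
structure Wrote (σ σ' : View) (w : List ℕ) (d e : ℕ) : Prop where
  len : σ'.len = σ.len
  inp : σ'.inp = σ.inp
  mrk : σ'.mrk = σ.mrk
  i : σ'.i = σ.i + d
  m : σ'.m = σ.m + e
  written : σ'.written = σ.written ++ w

theorem Wrote.refl (σ : View) : Wrote σ σ [] 0 0 := ⟨rfl, rfl, rfl, rfl, rfl, by simp⟩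

theorem Wrote.trans {σ₁ σ₂ σ₃ : View} {w w' : List ℕ} {d d' e e' : ℕ} (h : Wrote σ₁ σ₂ w d e)
    (h' : Wrote σ₂ σ₃ w' d' e') : Wrote σ₁ σ₃ (w ++ w') (d + d') (e + e') where
  len := h'.len.trans h.len
  inp := h'.inp.trans h.inp
  mrk := h'.mrk.trans h.mrk
  i := by rw [h'.i, h.i, Nat.add_assoc]
  m := by rw [h'.m, h.m, Nat.add_assoc]
  written := by rw [h'.written, h.written, List.append_assoc]

theorem Wrote.setI {σ : View} (d : ℕ) : Wrote σ (σ.setI (σ.i + d)) [] d 0 :=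
  ⟨rfl, rfl, rfl, rfl, rfl, by simp [View.written, View.setI]⟩

theorem wrote_emit (σ : View) (x : ℕ) : Wrote σ (σ.emit x) [x] 0 0 :=
  ⟨rfl, rfl, rfl, rfl, rfl, View.written_emit σ x⟩

section Write

variable {n k : ℕ}

abbrev CopyIter : View → ℕ → View → Prop :=
  Iter (fun σ => σ.inp σ.i < 12) ((Program.instrs [.load 9 0 2, .const 10 12]).length + 1) copyProg

theorem copyIter_succ {σ : View} {x : ℕ} (hx : σ.inp σ.i = x) (h₁ : x ≠ 4) (h₂ : 2 ≤ x)
    (h₃ : x < 12) : CopyIter σ 83 ((σ.emit x).setI (σ.i + 1)) := by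
  have := vexec_copy σ
  rw [View.copy, if_neg (by omega), if_neg (by omega), hx] at this
  exact .single (by omega) this

/-- The formula is copied correctly, with the abnormality letters eliminated. -/
def Formula.Copied (φ : Formula n k) : Prop :=
  ∀ ⦃σ : View⦄ ⦃A : Set (ℕ × ℕ)⦄, Txt σ.inp σ.i φ.code → φ.Marked σ.mrk A σ.i →
    ∃ σ' B, CopyIter σ B σ' ∧ Wrote σ σ' (φ.subst A).code φ.code.length 0 ∧
      B ≤ 100 * φ.code.length

/-- The copying does not distinguish `∧` from `∨`, so one argument with a symbol `x` serves for
both. -/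
theorem Formula.Copied.paren {φ ψ χ : Formula n k} (hφ : φ.Copied) (hψ : ψ.Copied) {x : ℕ}
    (hx : x = 7 ∨ x = 8) (hcode : χ.code = [5] ++ φ.code ++ [x] ++ ψ.code ++ [6])
    (hsubst : ∀ A, (χ.subst A).code = [5] ++ (φ.subst A).code ++ [x] ++ (ψ.subst A).code ++ [6])
    (hm : ∀ m A o, χ.Marked m A o →
      φ.Marked m A (o + 1) ∧ ψ.Marked m A (o + 1 + φ.code.length + 1)) : χ.Copied := by
  intro σ A htxt hmark
  rw [hcode] at htxt ⊢
  simp only [txt_append, List.length_append, List.length_cons, List.length_nil] at htxt ⊢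
  obtain ⟨⟨⟨⟨⟨h5, -⟩, hφt⟩, hxt, -⟩, hψt⟩, h6, -⟩ := htxt
  obtain ⟨hm₁, hm₂⟩ := hm _ _ _ hmark
  have w₁ : Wrote σ ((σ.emit 5).setI (σ.i + 1)) [5] 1 0 := (wrote_emit σ 5).trans (Wrote.setI 1)
  obtain ⟨σ₁, B₁, hit₁, w₂, hB₁⟩ := hφ (σ := (σ.emit 5).setI (σ.i + 1)) (A := A) hφt hm₁
  have v₁ := w₁.trans w₂
  have w₃ : Wrote σ₁ ((σ₁.emit x).setI (σ₁.i + 1)) [x] 1 0 :=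
    (wrote_emit σ₁ x).trans (Wrote.setI 1)
  have v₂ := v₁.trans w₃
  have e₁ : σ₁.inp σ₁.i = x := by
    rw [v₁.inp, v₁.i, ← hxt]
  obtain ⟨σ₂, B₂, hit₂, w₄, hB₂⟩ := hψ (σ := (σ₁.emit x).setI (σ₁.i + 1)) (A := A)
    (by
      rw [v₂.inp, v₂.i]
      exact hψt)
    (by
      rw [v₂.mrk, v₂.i]
      convert hm₂ using 1
      omega)
  have v₃ := v₂.trans w₄
  have e₂ : σ₂.inp σ₂.i = 6 := by
    rw [v₃.inp, v₃.i, ← h6]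
  have v₄ := v₃.trans ((wrote_emit σ₂ 6).trans (Wrote.setI 1))
  refine ⟨_, _, (copyIter_succ h5 (by omega) (by omega) (by omega)).trans (hit₁.trans
    ((copyIter_succ e₁ (by omega) (by omega) (by omega)).trans
      (hit₂.trans (copyIter_succ e₂ (by omega) (by omega) (by omega))))), ?_, by omega⟩
  rw [hsubst]
  exact v₄

theorem Formula.IsClause.copied {φ : Formula n k} (hφ : φ.IsClause) : φ.Copied := by
  have hd : (Program.instrs [.load 9 0 2, .const 10 12]).length = 2 := rfl
  induction hφ with
  | falsum =>
    rintro σ A ⟨h3, -⟩ -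
    exact ⟨_, 83, copyIter_succ h3 (by omega) (by omega) (by omega),
      (wrote_emit σ 3).trans (Wrote.setI 1), by simp [Formula.code]⟩
  | pos a =>
    intro σ A htxt hm
    have hv := vexec_copy σ
    cases a with
    | letter i =>
      obtain ⟨h0, h1, -⟩ := htxt
      rw [View.copy, if_neg (by omega), if_pos (by omega), if_pos h0, h0, h1] at hv
      exact ⟨_, _, .single (by omega) hv,
        ((wrote_emit σ 0).trans (wrote_emit _ i.val)).trans (Wrote.setI 2),
        by simp [Formula.code, Atom.code, hd]⟩
    | ab j =>
      obtain ⟨h0, h1, -⟩ := htxt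
      simp only [Formula.Marked] at hm
      by_cases hj : (1, j.val) ∈ A
      · rw [View.copy, if_neg (by omega), if_pos (by omega), if_neg (by omega),
          if_neg (hm.2 hj), h0, h1] at hv
        refine ⟨_, _, .single (by omega) hv, ?_, by simp [Formula.code, Atom.code, hd]⟩
        simp only [Formula.subst, if_pos hj]
        exact (((wrote_emit σ 4).trans (wrote_emit _ 1)).trans (wrote_emit _ j.val)).trans
          (Wrote.setI 2)
      · rw [View.copy, if_neg (by omega), if_pos (by omega), if_neg (by omega),
          if_pos (not_not.1 fun h => hj (hm.1 h))] at hv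
        refine ⟨_, _, .single (by omega) hv, ?_, by simp [Formula.code, Atom.code, hd]⟩
        simp only [Formula.subst, if_neg hj]
        exact (wrote_emit σ 3).trans (Wrote.setI 2)
  | neg a =>
    intro σ A htxt hm
    have hv := vexec_copy σ
    cases a with
    | letter i =>
      obtain ⟨h4, h0, h1, -⟩ := htxt
      rw [View.copy, if_pos h4, if_pos (Or.inl h0), h0, h1] at hv
      exact ⟨_, _, .single (by omega) hv,
        (((wrote_emit σ 4).trans (wrote_emit _ 0)).trans (wrote_emit _ i.val)).trans
          (Wrote.setI 3), by simp [Formula.code, Atom.code, hd]⟩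
    | ab j =>
      obtain ⟨h4, h0, h1, -⟩ := htxt
      simp only [Formula.Marked] at hm
      by_cases hj : (1, j.val) ∈ A
      · have := hm.2 hj
        rw [View.copy, if_pos h4, if_neg (by omega)] at hv
        refine ⟨_, _, .single (by omega) hv, ?_, by simp [Formula.code, Atom.code, hd]⟩
        simp only [Formula.subst, if_pos hj]
        exact (wrote_emit σ 3).trans (Wrote.setI 3)
      · rw [View.copy, if_pos h4, if_pos (Or.inr (not_not.1 fun h => hj (hm.1 h))), h0, h1] at hv
        refine ⟨_, _, .single (by omega) hv, ?_, by simp [Formula.code, Atom.code, hd]⟩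
        simp only [Formula.subst, if_neg hj]
        exact (((wrote_emit σ 4).trans (wrote_emit _ 1)).trans (wrote_emit _ j.val)).trans
          (Wrote.setI 3)
  | disj h₁ h₂ ih₁ ih₂ => exact ih₁.paren ih₂ (Or.inr rfl) rfl (fun A => rfl) fun m A o h => h

theorem Formula.IsHornCNF.copied {φ : Formula n k} (hφ : φ.IsHornCNF) : φ.Copied := by
  induction hφ with
  | verum =>
    rintro σ A ⟨h2, -⟩ -
    exact ⟨_, 83, copyIter_succ h2 (by omega) (by omega) (by omega),
      (wrote_emit σ 2).trans (Wrote.setI 1), by simp [Formula.code]⟩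
  | clause h => exact h.1.copied
  | conj h₁ h₂ ih₁ ih₂ => exact ih₁.paren ih₂ (Or.inl rfl) rfl (fun A => rfl) fun m A o h => h

/-- The word for the formulas `l`, as the beginning of their conjunction. -/
def conjCode (l : List (Formula n k)) : List ℕ := l.flatMap fun φ => [5] ++ φ.code ++ [7]

abbrev CopyMemberIter : View → ℕ → View → Prop :=
  Iter (fun σ => σ.i < σ.len) ((Program.instrs []).length + 1) copyMemberProg

theorem copyMemberIter_succ {σ : View} (hlt : σ.i < σ.len) (h : 10 ≤ σ.inp σ.i) :
    CopyMemberIter σ 58 (σ.setI (σ.i + 1)) :=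
  (Iter.single hlt (VExec.cond_false (guard_pos 9) (by omega)
    (VExec.cond_false (guard_eq 9) (by omega) (vexec_succ σ)))).mono (by decide)

/-- The formulas of a sequence are copied. -/
def Body.Copied (b : Body n k) : Prop :=
  ∀ ⦃σ : View⦄ ⦃A : Set (ℕ × ℕ)⦄, Txt σ.inp σ.i b.code → b.Marked σ.mrk A σ.i →
    σ.i + b.code.length ≤ σ.len →
    ∃ σ' B, CopyMemberIter σ B σ' ∧
      Wrote σ σ' (conjCode (b.formulas A)) b.code.length (b.formulas A).length ∧
      B ≤ 500 * b.code.length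

theorem Body.Copied.block {b : Body n k} (hb : b.Copied) {C : List (Fin n)} {σ : View}
    {A : Set (ℕ × ℕ)} (htxt : Txt σ.inp σ.i (blockCode C b.code))
    (hm : b.Marked σ.mrk A (σ.i + (2 * C.length + 2)))
    (hlen : σ.i + (blockCode C b.code).length ≤ σ.len) :
    ∃ σ' B, CopyMemberIter σ B σ' ∧
      Wrote σ σ' (conjCode (b.formulas A)) (blockCode C b.code).length (b.formulas A).length ∧
      B ≤ 500 * (blockCode C b.code).length := by
  rw [length_blockCode] at hlen ⊢
  obtain ⟨h9, hlet, h10, htxt, h11⟩ := txt_blockCode.1 htxt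
  have hC : (C.map Fin.val).length = C.length := List.length_map ..
  have hs : VExec copyMemberProg σ (60 * C.length + 200)
      (σ.setI (σ.i + (2 * C.length + 2))) := by
    have h1 := vexec_skip (σ := σ.setI (σ.i + 1)) hlet (by rw [hC]; exact h10)
    have h2 := vexec_succ ((σ.setI (σ.i + 1)).setI
      ((σ.setI (σ.i + 1)).i + 2 * (C.map Fin.val).length))
    rw [hC] at h1 h2
    have h3 := VExec.cond_false (guard_pos 9)
      (p := .all [emitConst 5, copyLoop, .all [emitConst 7, .instr (.succ 8), .instr (.succ 2)]])
      (by rw [h9]; omega)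
      (VExec.cond_true (guard_eq 9) (q := .instr (.succ 2)) h9 ((vexec_succ σ).seq (h1.seq h2)))
    have e : ((σ.setI (σ.i + 1)).setI ((σ.setI (σ.i + 1)).i + 2 * C.length)).setI
        (((σ.setI (σ.i + 1)).setI ((σ.setI (σ.i + 1)).i + 2 * C.length)).i + 1) =
        σ.setI (σ.i + (2 * C.length + 2)) := by
      simp only [View.setI]
      congr 1
      omega
    rw [e] at h3
    refine h3.mono ?_
    have h1 : (Program.instrs [.load 9 0 2, .const 10 9]).length = 2 := rfl
    omega
  have w₁ := Wrote.setI (σ := σ) (2 * C.length + 2)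
  have hg : (Program.instrs []).length = 1 := rfl
  obtain ⟨σ₂, B₂, hit, w₂, hB⟩ := hb (σ := σ.setI (σ.i + (2 * C.length + 2))) htxt hm (by
    change _ ≤ σ.len
    simp only [View.setI]
    omega)
  have v₂ := w₁.trans w₂
  have e11 : σ₂.inp σ₂.i = 11 := by
    rw [v₂.inp, v₂.i, ← h11]
    congr 1
    omega
  have hl₂ := v₂.len
  have hi₂ := v₂.i
  refine ⟨_, _, (Iter.single (by omega) hs).trans (hit.trans (copyMemberIter_succ (by omega)
    (by omega))), ?_, ?_⟩
  · convert v₂.trans (Wrote.setI 1) using 1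
    · simp
    · omega
    · omega
  · omega

theorem Body.copied {b : Body n k} (hH : b.IsHorn) : b.Copied := by
  have hg : (Program.instrs []).length = 1 := rfl
  induction b with
  | nil =>
    intro σ A _ _ _
    exact ⟨σ, 0, .refl _ _, Wrote.refl σ, by simp⟩
  | formula φ rest ih =>
    intro σ A htxt hm hlen
    rw [Body.code, txt_append, txt_append] at htxt
    simp only [Body.code, List.length_append, List.length_cons, List.length_nil] at hlen htxt ⊢
    obtain ⟨⟨htφ, h12, -⟩, hrest⟩ := htxt
    obtain ⟨σ₁, B₁, hit₁, w₁, hB₁⟩ := hH.1.copied (σ := σ.emit 5) htφ hm.1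
    have v₁ := (wrote_emit σ 5).trans w₁
    have e12 : σ₁.inp σ₁.i = 12 := by
      rw [v₁.inp, v₁.i, ← h12]
      congr 1
      omega
    have hlt : σ.inp σ.i < 9 := by
      obtain ⟨a, l, he, ha⟩ := φ.exists_code_eq
      rw [he] at htφ
      rw [htφ.1]
      exact ha
    have hs := VExec.cond_true (guard_pos 9) (q := .cond [.load 9 0 2, .const 10 9] (.eq 9 10)
      (.all [.instr (.succ 2), skipProg, .instr (.succ 2)]) (.instr (.succ 2))) hlt
      ((vexec_emitConst 5 σ).seq ((hit₁.vexec (guard_pos 12) (by rw [e12]; omega)).seq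
        (vexec_endCopy σ₁)))
    have w₂ : Wrote σ₁ (((σ₁.emit 7).setM (σ₁.m + 1)).setI (σ₁.i + 1)) [7] 1 1 :=
      ⟨rfl, rfl, rfl, rfl, rfl, View.written_emit σ₁ 7⟩
    have v₂ := v₁.trans w₂
    obtain ⟨σ₃, B₃, hit₃, w₃, hB₃⟩ := ih hH.2 (A := A) (by
      rw [v₂.inp, v₂.i]
      convert hrest using 1
      omega) (by
      rw [v₂.mrk, v₂.i]
      convert hm.2 using 1
      omega) (by
      rw [v₂.len, v₂.i]
      omega)
    refine ⟨σ₃, _, (Iter.single (by omega) hs).trans hit₃, ?_, ?_⟩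
    · convert v₂.trans w₃ using 1
      · simp [conjCode, Body.formulas]
      · omega
      · simp only [Body.formulas, List.length_cons]
        omega
    · have h1 : (Program.instrs [.load 9 0 2, .const 10 9]).length = 2 := rfl
      have h2 : (Program.instrs [.load 9 0 2, .const 10 12]).length = 2 := rfl
      have h3 : 0 < φ.code.length := by
        obtain ⟨a, l, he, ha⟩ := φ.exists_code_eq
        simp [he]
      omega
  | block C hC body rest ihb ih =>
    intro σ A htxt hm hlen
    rw [Body.code, txt_append, txt_append] at htxt
    simp only [Body.code, List.length_append, List.length_cons, List.length_nil] at hlen htxt ⊢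
    obtain ⟨⟨htxt, h12, -⟩, hrest⟩ := htxt
    obtain ⟨σ₁, B₁, hit₁, w₁, hB₁⟩ := (ihb hH.1).block htxt hm.1 (by omega)
    have e12 : σ₁.inp σ₁.i = 12 := by rw [w₁.inp, w₁.i, ← h12]
    have hi₁ := w₁.i
    have hl₁ := w₁.len
    have v₂ := w₁.trans (Wrote.setI 1)
    obtain ⟨σ₃, B₃, hit₃, w₃, hB₃⟩ := ih hH.2 (A := A) (by
      rw [v₂.inp, v₂.i]
      exact hrest) (by
      rw [v₂.mrk, v₂.i]
      exact hm.2) (by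
      rw [v₂.len, v₂.i]
      omega)
    refine ⟨σ₃, _, hit₁.trans ((copyMemberIter_succ (by omega) (by omega)).trans hit₃), ?_,
      by omega⟩
    convert v₂.trans w₃ using 1
    · simp [conjCode, Body.formulas]
    · simp only [Body.formulas, List.length_append]
      omega

theorem NAT.copied {T : NAT n k} (hH : T.IsHorn) {σ : View} (htxt : Txt σ.inp σ.i T.code)
    (hm : NAT.Marked σ.mrk T σ.i) (hlen : σ.i + T.code.length ≤ σ.len) :
    ∃ σ' B, CopyMemberIter σ B σ' ∧
      Wrote σ σ' (conjCode T.formulas) T.code.length T.formulas.length ∧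
      B ≤ 500 * T.code.length := by
  induction T generalizing σ with
  | nil => exact ⟨σ, 0, .refl _ _, Wrote.refl σ, by simp⟩
  | cons B T ih =>
    rw [NAT.code_cons, txt_append] at htxt
    rw [NAT.code_cons, List.length_append] at hlen ⊢
    obtain ⟨σ₁, B₁, hit₁, w₁, hB₁⟩ := (Body.copied (hH B (by simp))).block htxt.1 hm.1 (by omega)
    have hi₁ := w₁.i
    have hl₁ := w₁.len
    obtain ⟨σ₂, B₂, hit₂, w₂, hB₂⟩ := ih (fun B hB => hH B (by simp [hB])) (σ := σ₁)
      (by rw [w₁.inp, hi₁]; exact htxt.2) (by rw [w₁.mrk, hi₁]; exact hm.2) (by omega)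
    refine ⟨σ₂, _, hit₁.trans hit₂, ?_, by omega⟩
    convert w₁.trans w₂ using 1
    · simp [conjCode, NAT.formulas]
    · simp [NAT.formulas]

end Write

/-! ### The whole program -/

theorem described_written {C : List ℕ} {σ : View} (hC : Txt σ.inp σ.i (lettersCode C))
    (hend : σ.inp (σ.i + 2 * C.length) = 10) :
    ∃ σ', VExec describedLoop σ (60 * C.length + 10) σ' ∧
      Wrote σ σ' (lettersCode C) (2 * C.length) 0 := by
  have hd : (Program.instrs [.load 9 0 2, .const 10 10]).length = 2 := rfl
  suffices key : ∃ σ', Iter (fun σ => σ.inp σ.i < 10)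
      ((Program.instrs [.load 9 0 2, .const 10 10]).length + 1) describedProg σ
      (60 * C.length) σ' ∧ Wrote σ σ' (lettersCode C) (2 * C.length) 0 by
    obtain ⟨σ', hit, w⟩ := key
    refine ⟨σ', (hit.vexec (guard_pos 10) ?_).mono (by omega), w⟩
    rw [w.inp, w.i, hend]
    omega
  induction C generalizing σ with
  | nil => exact ⟨σ, .refl _ _, Wrote.refl σ⟩
  | cons p C ih =>
    rw [lettersCode_cons] at hC
    obtain ⟨h0, h1, hC⟩ := hC
    have hv := vexec_described σ
    rw [h0, h1] at hv
    have w₁ : Wrote σ (((σ.emit 0).emit p).setI (σ.i + 2)) [0, p] 2 0 :=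
      ((wrote_emit σ 0).trans (wrote_emit _ p)).trans (Wrote.setI 2)
    obtain ⟨σ₂, hit, w₂⟩ := ih (σ := ((σ.emit 0).emit p).setI (σ.i + 2)) hC
      (by
        rw [w₁.inp, w₁.i, ← hend, List.length_cons]
        congr 1
        omega)
    refine ⟨σ₂, .step (by omega) hv hit (by rw [List.length_cons]; omega), ?_⟩
    convert w₁.trans w₂ using 1
    · rfl
    · rw [List.length_cons]
      omega

theorem parens_written (σ : View) :
    ∃ σ', VExec closeLoop σ (60 * σ.m + 10) σ' ∧
      σ'.written = σ.written ++ List.replicate σ.m 6 := by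
  have hd : (Program.instrs [.const 9 0]).length = 1 := rfl
  suffices key : ∃ σ', Iter (fun σ => 0 < σ.m) ((Program.instrs [.const 9 0]).length + 1)
      (.seq (emitConst 6) (.instr (.pred 8))) σ (60 * σ.m) σ' ∧ σ'.m = 0 ∧
      σ'.written = σ.written ++ List.replicate σ.m 6 by
    obtain ⟨σ', hit, h0, hw⟩ := key
    exact ⟨σ', (hit.vexec guard_close (by omega)).mono (by omega), hw⟩
  generalize hm : σ.m = m
  induction m generalizing σ with
  | zero => exact ⟨σ, .refl _ _, hm, by simp⟩
  | succ m ih =>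
    obtain ⟨σ', hit, h0, hw⟩ := ih ((σ.emit 6).setM (σ.m - 1)) (by
      simp only [View.setM]
      omega)
    refine ⟨σ', .step (by omega) (vexec_closeParen σ) hit (by omega), h0, ?_⟩
    rw [hw, show ((σ.emit 6).setM (σ.m - 1)).written = σ.written ++ [6] from
      View.written_emit σ 6, List.append_assoc]
    rfl

section Main

variable {n k : ℕ}

/-- Bounds the number of closing brackets, and so the time of the last loop. -/
theorem length_formulas_le (b : Body n k) (A : Set (ℕ × ℕ)) :
    (b.formulas A).length ≤ b.code.length := by
  induction b generalizing A with
  | nil => simp [Body.formulas]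
  | formula φ rest ih =>
    have := ih A
    simp only [Body.formulas, Body.code, List.length_cons, List.length_append]
    omega
  | block C hC body rest ihb ih =>
    have := ihb {a | Der body.rules a}
    have := ih A
    have := length_blockCode C body.code
    simp only [Body.formulas, Body.code, List.length_append]
    omega

theorem NAT.length_formulas_le (T : NAT n k) : T.formulas.length ≤ T.code.length := by
  induction T with
  | nil => simp [NAT.formulas]
  | cons B T ih =>
    have h1 := Circ.length_formulas_le B.body {a | Der B.body.rules a}
    have h2 := length_blockCode B.described B.body.code
    have h3 : NAT.formulas (B :: T) =
      B.body.formulas {a | Der B.body.rules a} ++ NAT.formulas T := rfl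
    rw [NAT.code_cons, h3, List.length_append, List.length_append]
    omega

/-- The prefix `l'` serves the induction; the input is the case of the empty prefix. -/
theorem txt_getD (l l' : List ℕ) :
    Txt (fun i => (l' ++ l).getD i 0) l'.length l := by
  induction l generalizing l' with
  | nil => trivial
  | cons a l ih =>
    refine ⟨by simp, ?_⟩
    have := ih (l' ++ [a])
    simpa using this

theorem flat_code {Z : List (Fin n)} (hZ : Z.Nodup) (l : List (Formula n k)) :
    (NAT.flat Z hZ (bigConj l)).code =
      [9] ++ lettersCode (Z.map Fin.val) ++ [10] ++ conjCode l ++ [2] ++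
        List.replicate l.length 6 ++ [12, 11] := by
  have h1 : (Z.flatMap fun i => [0, i.val]) = lettersCode (Z.map Fin.val) := by
    simp [lettersCode, List.flatMap_map]
  simp [NAT.flat, NAT.code, blockCode, h1, Body.code, bigConj_code, conjCode]

/-- The first block is treated apart, because its brace and described letters are copied while those
of all other blocks are skipped. -/
theorem NAT.written {B : Block n k} {T : NAT n k} (hH : NAT.IsHorn (B :: T)) {σ : View}
    (hj : σ.j = 0) (hm0 : σ.m = 0) (htxt : Txt σ.inp 0 (NAT.code (B :: T)))
    (hm : NAT.Marked σ.mrk (B :: T) 0) (hlen : σ.len = (NAT.code (B :: T)).length) :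
    ∃ σ' t, VExec writeProg σ t σ' ∧
      σ'.written = (NAT.flat B.described B.nodup (bigConj (NAT.formulas (B :: T)))).code ∧
      t ≤ 1000 * (NAT.code (B :: T)).length := by
  have hg : (Program.instrs []).length = 1 := rfl
  have hnum := NAT.length_formulas_le (B :: T)
  rw [NAT.code_cons, txt_append] at htxt
  rw [NAT.code_cons, List.length_append] at hlen hnum ⊢
  obtain ⟨hB, hT⟩ := htxt
  have hbl := length_blockCode B.described B.body.code
  rw [hbl] at hlen hnum hT ⊢
  obtain ⟨-, hlet, h10, hbody, h11⟩ := txt_blockCode.1 hB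
  have hC : (B.described.map Fin.val).length = B.described.length := List.length_map ..
  have hw₀ : σ.written = [] := by simp [View.written, hj]
  obtain ⟨σ₂, he₂, w₂⟩ := described_written (σ := (σ.emit 9).setI 1)
    (C := B.described.map Fin.val) (by simpa [View.setI, View.emit] using hlet)
    (by rw [hC]; simpa [View.setI, View.emit] using h10)
  have hw₁ : ((σ.emit 9).setI 1).written = [9] := by
    have := View.written_emit σ 9
    rw [hw₀] at this
    exact this
  have w₃ : Wrote σ₂ ((σ₂.emit 10).setI (σ₂.i + 1)) [10] 1 0 :=
    (wrote_emit σ₂ 10).trans (Wrote.setI 1)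
  have v₃ := w₂.trans w₃
  rw [hC] at he₂ v₃
  set σ₃ := (σ₂.emit 10).setI (σ₂.i + 1) with hσ₃
  have hi₃ : σ₃.i = 2 * B.described.length + 2 := by
    rw [v₃.i]
    simp only [View.setI]
    omega
  have hin₃ : σ₃.inp = σ.inp := v₃.inp
  have hl₃ : σ₃.len = σ.len := v₃.len
  have hmk₃ : σ₃.mrk = σ.mrk := v₃.mrk
  have hm₃ : σ₃.m = 0 := by
    rw [v₃.m]
    exact hm0
  obtain ⟨σ₄, B₄, hit₄, w₄, hB₄⟩ := Body.copied (hH B (by simp)) (σ := σ₃)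
    (A := {a | Der B.body.rules a})
    (by rw [hin₃, hi₃]; simpa using hbody) (by rw [hmk₃, hi₃]; simpa using hm.1) (by omega)
  have hi₄ := w₄.i
  have hl₄ := w₄.len
  have e11 : σ₄.inp σ₄.i = 11 := by
    rw [w₄.inp, hin₃, hi₄, hi₃, ← h11]
    congr 1
    omega
  have w₅ := w₄.trans (Wrote.setI 1)
  set σ₅ := σ₄.setI (σ₄.i + 1) with hσ₅
  have hi₅ := w₅.i
  have hl₅ := w₅.len
  obtain ⟨σ₆, B₆, hit₆, w₆, hB₆⟩ := NAT.copied (T := T) (fun B hB => hH B (by simp [hB]))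
    (σ := σ₅)
    (by
      rw [w₅.inp, hin₃, hi₅, hi₃]
      convert hT using 1
      omega)
    (by
      rw [w₅.mrk, hmk₃, hi₅, hi₃]
      convert hm.2 using 1
      rw [hbl]
      omega) (by omega)
  have v₆ := w₅.trans w₆
  have hi₆ := w₆.i
  have hl₆ := w₆.len
  have he₆ := (hit₄.trans ((copyMemberIter_succ (by omega) (by omega)).trans hit₆)).vexec
    guard_end (by omega)
  obtain ⟨σ₈, he₈, hw₈⟩ := parens_written (σ₆.emit 2)
  have hm₆ : (σ₆.emit 2).m = (NAT.formulas (B :: T)).length := by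
    have : (σ₆.emit 2).m = σ₆.m := rfl
    rw [this, v₆.m, hm₃]
    simp [NAT.formulas]
  refine ⟨_, _, (vexec_beginWrite σ).seq (he₂.seq ((vexec_emit_succ σ₂).seq (he₆.seq
    ((vexec_emitConst 2 σ₆).seq (he₈.seq (vexec_endWrite σ₈)))))), ?_, ?_⟩
  · rw [View.written_emit, View.written_emit, hw₈, hm₆, View.written_emit, v₆.written, v₃.written,
      hw₁, flat_code]
    simp [conjCode, NAT.formulas]
  · rw [hm₆]
    omega

/-- The program computes the flat normal form in linear time. -/
theorem NAT.flatten {B : Block n k} {T : NAT n k} (hH : NAT.IsHorn (B :: T))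
    (hF : NAT.NoFixed (B :: T)) :
    ∃ t ≤ 4000 * NAT.size (B :: T), Program.Computes (.seq markProg writeProg)
      (NAT.code (B :: T)) t
      (NAT.flat B.described B.nodup (bigConj (NAT.formulas (B :: T)))).code := by
  have hpos : 0 < (NAT.code (B :: T)).length := by
    rw [NAT.code_cons, List.length_append, length_blockCode]
    omega
  set w := NAT.code (B :: T) with hw
  set σ := view (State.init w) with hσ
  have hi : σ.i = 0 := by simp [hσ, view, State.init]
  have hl : σ.len = w.length := by simp [hσ, view, State.init]
  have hfr : Fresh σ := by
    have : stackOf σ.wk σ.wp = [] := by simp [hσ, view, State.init, stackOf]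
    constructor
    · intro x _
      simp [hσ, view, State.init]
    · simp [hσ, view, State.init]
    · simp [hσ, view, State.init]
    · simp [this]
    -- Registers and the arrays other than the input start at `0`, which is what `Fresh` asks for.
    · simp [hσ, view, State.init]
  have htxt : Txt σ.inp 0 w := by
    have := txt_getD w []
    simpa [hσ, view, State.init] using this
  obtain ⟨σ₁, B₁, hit, hi₁, hf, hm, hB₁⟩ := NAT.read hH hF hfr (by rw [hi]; exact htxt)
    (by rw [hi, hl, ← hw]; omega)
  rw [← hw] at hi₁ hB₁
  have hl₁ := hf.len
  have he := hit.vexec guard_end (by omega)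
  obtain ⟨σ₂, t₂, he₂, hw₂, ht₂⟩ := NAT.written hH (σ := σ₁)
    (hf.j.trans (by simp [hσ, view, State.init])) (hf.m.trans (by simp [hσ, view, State.init]))
    (by rw [hf.inp]; exact htxt) (by rwa [hi] at hm) (hl₁.trans hl)
  rw [← hw] at ht₂
  obtain ⟨t, s, hex, ht, hs⟩ := (he.seq he₂) _ hσ.symm
  have hg : (Program.instrs []).length = 1 := rfl
  refine ⟨t, ?_, s, hex, ?_⟩
  · change t ≤ 4000 * w.length
    -- Marking takes 2000 and writing 1000 steps for each symbol; the constant overhead is absorbed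
    -- because the input is not empty.
    omega
  · rw [← hw₂, ← hs]
    rfl

end Main

end Circ

theorem mainTheorem6 :
    ∃ (p : Circ.Program) (c : ℕ), ∀ (n k : ℕ) (T : Circ.NAT n k),
      T ≠ [] → T.IsHorn → T.NoFixed →
      ∃ (Z : List (Fin n)) (hZ : Z.Nodup) (ψ : Circ.Formula n k),
        ψ.IsHornCNF ∧
        (Circ.NAT.flat Z hZ ψ).IsHorn ∧
        (Circ.NAT.flat Z hZ ψ).NoFixed ∧
        (∀ M : Circ.Interp n k, (Circ.NAT.flat Z hZ ψ).Sat M ↔ T.Sat M) ∧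
        ∃ t : ℕ, t ≤ c * T.size ∧ p.Computes T.code t (Circ.NAT.flat Z hZ ψ).code := by
  refine ⟨.seq Circ.markProg Circ.writeProg, 4000, fun n k T hT hH hF => ?_⟩
  obtain ⟨B, T, rfl⟩ := List.exists_cons_of_ne_nil hT
  have hall := (hF B (by simp)).1
  obtain ⟨h₁, h₂⟩ := Circ.NAT.flat_spec hH hF B.nodup hall
  -- The first block describes all letters, so its list, which can be copied from the input, serves
  -- as `Z`.
  refine ⟨B.described, B.nodup, _, h₁, ?_, ?_, h₂, Circ.NAT.flatten hH hF⟩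
  · intro B' hB'
    rw [Circ.NAT.flat, List.mem_singleton] at hB'
    subst hB'
    exact ⟨h₁, trivial⟩
  · intro B' hB'
    rw [Circ.NAT.flat, List.mem_singleton] at hB'
    subst hB'
    exact ⟨hall, trivial⟩
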